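/- For $\nu\in\mathbb C$ let $P_\nu$ be the Legendre function of the first kind on $(-1,1]$, given by the Mehler–Dirichlet integral $$P_\nu(1)=1,\qquad P_\nu(\cos\theta)=\frac2\pi\int_0^\theta\frac{\cos\frac{(2\nu+1)\beta}{2}}{\sqrt{2(\cos\beta-\cos\theta)}}\,d\beta\quad(0<\theta<\pi),$$ and let $\mathbf K(k)=\int_0^{\pi/2}(1-k^2\sin^2\theta)^{-1/2}\,d\theta$ ($0\le k<1$) be the complete elliptic integral of the first kind. Then the integral $\int_{-1}^1 x[P_\nu(x)]^3P_\nu(-x)\,dx$ converges absolutely for every $\nu\in\mathbb C$, and $$\int_{-1}^1 x[P_\nu(x)]^3P_\nu(-x)\,dx=\frac{\sin(2\nu\pi)\cos(\nu\pi)}{(2\nu+1)^2\pi},\qquad \nu\in\mathbb C\smallsetminus\{-1/2\}.$$ Moreover, the following evaluations hold: $$\begin{aligned} -\frac{\pi}{2}&=\int_{-1}^1 x[P_{-1/2}(x)]^3P_{-1/2}(-x)\,dx\\ &=\frac{32}{\pi^4}\int_0^1(1-2t)[\mathbf K(\sqrt t)]^3\mathbf K(\sqrt{1-t})\,dt=-\frac{32}{\pi^4}\int_0^1(1-2t)[\mathbf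 K(\sqrt{1-t})]^3\mathbf K(\sqrt t)\,dt; \end{aligned}$$ with $\lambda(p)=\frac{p^3(2+p)}{1+2p}$ and $w(p)=\frac{(1-p^2)p(2+p)}{1+2p}\left[1-2\,\frac{27p^2(1+p)^2}{4(1+p+p^2)^3}\right]$, $$\begin{aligned} -\frac{9\sqrt3}{4\pi}&=\int_{-1}^1 x[P_{-1/3}(x)]^3P_{-1/3}(-x)\,dx\\ &=\frac{216}{\sqrt3\,\pi^4}\int_0^1 w(p)\left[\mathbf K\left(\sqrt{\lambda(p)}\right)\right]^3\mathbf K\left(\sqrt{1-\lambda(p)}\right)dp\\ &=-\frac{72}{\sqrt3\,\pi^4}\int_0^1 w(p)\left[\mathbf K\left(\sqrt{1-\lambda(p)}\right)\right]^3\mathbf K\left(\sqrt{\lambda(p)}\right)dp; \end{aligned}$$ $$\begin{aligned} -\frac{2\sqrt2}{\pi}&=\int_{-1}^1 x[P_{-1/4}(x)]^3P_{-1/4}(-x)\,dx\\ &=\frac{32\sqrt2}{\pi^4}\int_0^1\frac{1-2u}{(1+\sqrt u)^2}\left[\mathbf K\left(\sqrt{\tfrac{2\sqrt u}{1+\sqrt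 u}}\right)\right]^3\mathbf K\left(\sqrt{\tfrac{1-\sqrt u}{1+\sqrt u}}\right)du\\ &=-\frac{64\sqrt2}{\pi^4}\int_0^1\frac{1-2u}{(1+\sqrt u)^2}\left[\mathbf K\left(\sqrt{\tfrac{1-\sqrt u}{1+\sqrt u}}\right)\right]^3\mathbf K\left(\sqrt{\tfrac{2\sqrt u}{1+\sqrt u}}\right)du; \end{aligned}$$ $$\begin{aligned} -\frac{27}{16\pi}&=\int_{-1}^1 x[P_{-1/6}(x)]^3P_{-1/6}(-x)\,dx\\ &=\frac{54}{\pi^4}\int_0^1\frac{t(1-t)(1+t)(2-t)(1-2t)}{(1-t+t^2)^3}[\mathbf K(\sqrt t)]^3\mathbf K(\sqrt{1-t})\,dt\\ &=-\frac{54}{\pi^4}\int_0^1\frac{t(1-t)(1+t)(2-t)(1-2t)}{(1-t+t^2)^3}[\mathbf K(\sqrt{1-t})]^3\mathbf K(\sqrt t)\,dt. \end{aligned}$$ -/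

import Mathlib

open MeasureTheory
open scoped Real

/-- The Legendre function of the first kind `P_ν(x)` of complex degree `ν` on `(-1, 1]`, given by
the Mehler–Dirichlet integral: `P_ν(1) = 1` and, with `x = cos θ`, `0 < θ < π`,
`P_ν(cos θ) = (2/π) ∫_0^θ cos((2ν+1)β/2) / √(2 (cos β - cos θ)) dβ`. -/
noncomputable def legendreP (ν : ℂ) (x : ℝ) : ℂ :=
  if x = 1 then 1
  else (2 / (π : ℂ)) *
    ∫ β in (0 : ℝ)..Real.arccos x,
      Complex.cos ((2 * ν + 1) * (β : ℂ) / 2) / ((√(2 * (Real.cos β - x)) : ℝ) : ℂ)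

/-- The complete elliptic integral of the first kind as a function of the modulus `k`,
`K(k) = ∫_0^{π/2} dθ / √(1 - k² sin² θ)`, `0 ≤ k < 1`. -/
noncomputable def ellipticK (k : ℝ) : ℝ :=
  ∫ θ in (0 : ℝ)..(π / 2), 1 / √(1 - k ^ 2 * Real.sin θ ^ 2)

/-! Write f(x) = P_ν(x), g(x) = P_ν(-x), H = fg, M for the integral of H over (-1, 1), and W = (1 -
x²)(fg' - f'g), a constant equal to -2 sin(πν)/π. The general formula rests on one fact about the
finite Hilbert transform: for non-integral ν the principal value of ∫ H(ξ)/(x - ξ) dξ equals (g² -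
f²)/W. Multiply it by xH(x) and integrate. On one side symmetry under x ↦ -x gives -(2/W) ∫ x f³g.
On the other side symmetrising in (x, ξ) replaces x/(x - ξ) by 1/2 and gives M²/2. Hence ∫ x f³g =
-W M²/4 (`legQuartic_of_ne`). Green's identity for two degrees, followed by a limit, gives (2ν + 1)M
= 2 cos(πν) (`legPair_self_mul`). Integral degrees, where W = 0, and the value at ν = -1/2 follow by
continuity in ν.

The Hilbert transform is found without contour integration. The products of Legendre solutions solve
the symmetric square of the Legendre system, and integration by parts shows that the Cauchy
transform of H, with corrections involving M, solves the same system in the upper half-plane.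
Pairing it with two Legendre solutions gives a conserved quantity (`hasDerivAt_sysInv`). Its value
for (f, f) is read off at z = 1, its value for (g, g) at z = -1, and its value κ for (f, g) is never
needed: solving for the transform yields (W(g² - f²) - 2κfg)/W², and the κ term is even while the
principal value is odd (`exists_tendsto_sysY0`, `tendsto_sysY0_sub`). The limit to the real axis is
taken under the integral sign by means of the uniform bound `exists_norm_hilbert_le`.

All analysis is done on the hypergeometric series `legF`, identified with the Mehler–Dirichlet
integral in `legendreP_eq_legF`; it has at worst a logarithmic singularity at -1, so every integral
converges.

For the elliptic integrals, K(√t) = (π/2) P_{-1/2}(1 - 2t), and P_ν for ν = -1/3, -1/4, -1/6 is an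
algebraic multiple of P_{-1/2} after an algebraic change of variable. A `LegTransform` records the
differential identities behind such a relation; uniqueness at the singular points turns them into
equalities of functions (`LegTransform.legF_eq`, `LegTransform.legFr_eq`), and substitution in the
quartic integral finishes (`LegTransform.quartic_eq`). -/

section

open Filter Topology Set

/-! ### Power series whose coefficient ratios tend to 1 -/

/-- A coefficient sequence whose successive ratios tend to `1`. -/
def RatioOne (c : ℕ → ℂ) : Prop :=
  ∃ ρ : ℕ → ℂ, (∀ n, c (n + 1) = ρ n * c n) ∧ Tendsto ρ atTop (𝓝 1)

/-- The coefficients of the formal derivative of `∑ c n * z ^ n`. -/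
def derivCoeff (c : ℕ → ℂ) (n : ℕ) : ℂ := (n + 1) * c (n + 1)

/-- The sum of the power series with coefficients `c`. -/
noncomputable def powSum (c : ℕ → ℂ) (z : ℂ) : ℂ := ∑' n, c n * z ^ n

theorem tendsto_natCast_add_div_add (a b : ℂ) :
    Tendsto (fun n : ℕ => ((n : ℂ) + a) / (n + b)) atTop (𝓝 1) := by
  have hinv : Tendsto (fun n : ℕ => ((n : ℂ))⁻¹) atTop (𝓝 0) :=
    tendsto_inv_atTop_nhds_zero_nat (𝕜 := ℂ)
  have h : Tendsto (fun n : ℕ => (1 + a * (n : ℂ)⁻¹) / (1 + b * (n : ℂ)⁻¹)) atTop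
      (𝓝 ((1 + a * 0) / (1 + b * 0))) :=
    ((hinv.const_mul a).const_add 1).div ((hinv.const_mul b).const_add 1) (by simp)
  simp only [mul_zero, add_zero, div_one] at h
  refine h.congr' ?_
  filter_upwards [eventually_gt_atTop 0] with n hn
  have hn' : (n : ℂ) ≠ 0 := by exact_mod_cast hn.ne'
  rw [← mul_div_mul_left (1 + a * (n : ℂ)⁻¹) (1 + b * (n : ℂ)⁻¹) hn']
  congr 1 <;> field_simp

theorem RatioOne.derivCoeff {c : ℕ → ℂ} (h : RatioOne c) : RatioOne (derivCoeff c) := by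
  obtain ⟨ρ, h1, h2⟩ := h
  refine ⟨fun n => ((n : ℂ) + 2) / (n + 1) * ρ (n + 1), fun n => ?_, ?_⟩
  · have : (n : ℂ) + 1 ≠ 0 := Nat.cast_add_one_ne_zero n
    simp only [_root_.derivCoeff, h1 (n + 1)]
    push_cast
    field_simp
    ring
  · simpa using (tendsto_natCast_add_div_add 2 1).mul (h2.comp (tendsto_add_atTop_nat 1))

theorem RatioOne.summable {c : ℕ → ℂ} (h : RatioOne c) {z : ℂ} (hz : ‖z‖ < 1) :
    Summable (fun n => c n * z ^ n) := by
  obtain ⟨ρ, h1, h2⟩ := h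
  obtain ⟨r, hr1, hr2⟩ := exists_between hz
  refine summable_of_ratio_norm_eventually_le (r := r) hr2 ?_
  have h3 : Tendsto (fun n => ‖ρ n‖ * ‖z‖) atTop (𝓝 ‖z‖) := by
    simpa using h2.norm.mul_const ‖z‖
  filter_upwards [h3.eventually_le_const hr1] with n hn
  have : c (n + 1) * z ^ (n + 1) = (ρ n * z) * (c n * z ^ n) := by rw [h1, pow_succ]; ring
  rw [this, norm_mul, norm_mul]
  exact mul_le_mul_of_nonneg_right hn (norm_nonneg _)

/-- The Euler operator z d/dz acts on coefficients as multiplication by n, so identities between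
such series can be compared at equal powers of z. -/
theorem tsum_natCast_mul_pow {c : ℕ → ℂ} {z : ℂ}
    (h : Summable fun n => derivCoeff c n * z ^ n) :
    HasSum (fun n : ℕ => n * c n * z ^ n) (z * powSum (derivCoeff c) z) := by
  rw [← hasSum_nat_add_iff' 1]
  simp only [Finset.range_one, Finset.sum_singleton, Nat.cast_zero, zero_mul, sub_zero]
  have e : (fun n : ℕ => ((n + 1 : ℕ) : ℂ) * c (n + 1) * z ^ (n + 1)) =
      fun n => z * (derivCoeff c n * z ^ n) := by
    funext n
    simp only [derivCoeff]
    push_cast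
    ring
  rw [e]
  exact h.hasSum.mul_left z

theorem RatioOne.hasDerivAt {c : ℕ → ℂ} (h : RatioOne c) {z : ℂ} (hz : ‖z‖ < 1) :
    HasDerivAt (powSum c) (powSum (_root_.derivCoeff c) z) z := by
  obtain ⟨r, hr1, hr2⟩ := exists_between hz
  have hr0 : 0 ≤ r := (norm_nonneg z).trans hr1.le
  have hs : Summable fun n : ℕ => ‖c n‖ * (n * r ^ (n - 1)) := by
    rw [← summable_nat_add_iff 1]
    have := (h.derivCoeff.summable (z := (r : ℂ)) (by simpa [abs_of_nonneg hr0] using hr2)).norm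
    refine this.congr fun n => ?_
    simp only [_root_.derivCoeff, norm_mul, norm_pow, Complex.norm_real, Real.norm_eq_abs,
      abs_of_nonneg hr0, Nat.add_sub_cancel]
    have : ‖(n : ℂ) + 1‖ = n + 1 := by
      rw [← Nat.cast_succ, Complex.norm_natCast]; push_cast; rfl
    rw [this]; push_cast; ring
  have hd := hasDerivAt_tsum_of_isPreconnected (g := fun n z => c n * z ^ n)
    (g' := fun n z => c n * (n * z ^ (n - 1))) (t := Metric.ball (0 : ℂ) r) (y₀ := 0) (y := z) hs
    Metric.isOpen_ball (convex_ball (0 : ℂ) r).isPreconnected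
    (fun n y _ => (hasDerivAt_pow n y).const_mul _)
    (fun n y hy => by
      rw [norm_mul, norm_mul, norm_pow, Complex.norm_natCast]
      have : ‖y‖ ≤ r := (mem_ball_zero_iff.1 hy).le
      gcongr)
    (Metric.mem_ball_self (lt_of_le_of_lt (norm_nonneg z) hr1)) (h.summable (by simp))
    (mem_ball_zero_iff.2 hr1)
  have hs' : Summable fun n : ℕ => c n * (n * z ^ (n - 1)) := by
    refine Summable.of_norm_bounded hs fun n => ?_
    rw [norm_mul, norm_mul, norm_pow, Complex.norm_natCast]
    gcongr
  have e : powSum (_root_.derivCoeff c) z = ∑' n : ℕ, c n * (n * z ^ (n - 1)) := by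
    rw [hs'.tsum_eq_zero_add]
    simp only [powSum, _root_.derivCoeff, Nat.cast_zero, zero_mul, mul_zero, zero_add,
      Nat.add_sub_cancel]
    refine tsum_congr fun n => ?_
    push_cast; ring
  rw [e]
  exact hd

/-! ### The hypergeometric series and the Legendre system -/

/-- The Taylor coefficients of the hypergeometric function `₂F₁(-ν, ν + 1; γ; z)`. -/
noncomputable def gaussCoeff (ν γ : ℂ) (n : ℕ) : ℂ :=
  ∏ k ∈ Finset.range n, ((k - ν) * (k + 1 + ν) / ((k + 1) * (k + γ)))

theorem gaussCoeff_zero (ν γ : ℂ) : gaussCoeff ν γ 0 = 1 := by simp [gaussCoeff]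

theorem gaussCoeff_succ (ν γ : ℂ) (n : ℕ) :
    gaussCoeff ν γ (n + 1) =
      ((n - ν) * (n + 1 + ν) / ((n + 1) * (n + γ))) * gaussCoeff ν γ n := by
  rw [gaussCoeff, Finset.prod_range_succ, mul_comm]; rfl

theorem ratioOne_gaussCoeff (ν γ : ℂ) : RatioOne (gaussCoeff ν γ) := by
  refine ⟨_, gaussCoeff_succ ν γ, ?_⟩
  have := (tendsto_natCast_add_div_add (-ν) 1).mul (tendsto_natCast_add_div_add (1 + ν) γ)
  rw [mul_one] at this
  refine this.congr fun n => ?_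
  rw [div_mul_div_comm]
  congr 2
  ring

/-- The hypergeometric differential equation. -/
theorem gauss_ode (ν γ : ℂ) (hγ : ∀ n : ℕ, (n : ℂ) + γ ≠ 0) {z : ℂ} (hz : ‖z‖ < 1) :
    z * (1 - z) * powSum (derivCoeff (derivCoeff (gaussCoeff ν γ))) z +
      (γ - 2 * z) * powSum (derivCoeff (gaussCoeff ν γ)) z +
      ν * (ν + 1) * powSum (gaussCoeff ν γ) z = 0 := by
  set c := gaussCoeff ν γ with hc
  have h0 : RatioOne c := ratioOne_gaussCoeff ν γ
  have s0 := (h0.summable hz).hasSum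
  have s1 := (h0.derivCoeff.summable hz).hasSum
  have t1 := tsum_natCast_mul_pow (h0.derivCoeff.summable hz)
  have t2 := tsum_natCast_mul_pow (h0.derivCoeff.derivCoeff.summable hz)
  -- Applying the Euler operator to the series with coefficients (n - 1)c n produces z²F'', so every
  -- term of the equation becomes a series in z ^ n.
  have key : derivCoeff (fun n => ((n : ℂ) - 1) * c n) = fun n => n * derivCoeff c n := by
    funext n; simp only [derivCoeff]; push_cast; ring
  have t3 := tsum_natCast_mul_pow (c := fun n => ((n : ℂ) - 1) * c n) (z := z)
    (by rw [key]; exact t2.summable)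
  have e3 : powSum (derivCoeff fun n => ((n : ℂ) - 1) * c n) z =
      z * powSum (derivCoeff (derivCoeff c)) z := by
    rw [key]; exact t2.tsum_eq
  rw [e3] at t3
  have hall := ((((t2.sub t3).add (s1.mul_left γ)).sub (t1.mul_left 2)).add
    (s0.mul_left (ν * (ν + 1))))
  have hz0 : (fun n : ℕ => n * derivCoeff c n * z ^ n - n * ((n - 1) * c n) * z ^ n +
      γ * (derivCoeff c n * z ^ n) - 2 * (n * c n * z ^ n) + ν * (ν + 1) * (c n * z ^ n)) =
      fun _ => 0 := by
    funext n
    have h1 : (n : ℂ) + 1 ≠ 0 := Nat.cast_add_one_ne_zero n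
    have h2 := hγ n
    have h3 : (n + 1) * (n + γ) * c (n + 1) = (n - ν) * (n + 1 + ν) * c n := by
      rw [hc, gaussCoeff_succ]; field_simp
    simp only [derivCoeff]
    linear_combination z ^ n * h3
  rw [hz0] at hall
  have := hall.unique hasSum_zero
  simp only [powSum] at this ⊢
  linear_combination this

/-- The analytic continuation of the Legendre function `P_ν` to the disc `‖1 - z‖ < 2`. -/
noncomputable def legF (ν z : ℂ) : ℂ := powSum (gaussCoeff ν 1) ((1 - z) / 2)

/-- The quasi-derivative `(1 - z ^ 2) P_ν'(z)`. -/
noncomputable def legD (ν z : ℂ) : ℂ :=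
  (1 - z ^ 2) * (-(1 / 2) * powSum (derivCoeff (gaussCoeff ν 1)) ((1 - z) / 2))

theorem norm_half_one_sub_lt {z : ℂ} (hz : ‖1 - z‖ < 2) : ‖(1 - z) / 2‖ < 1 := by
  rw [norm_div, Complex.norm_ofNat]; linarith

theorem hasDerivAt_half_one_sub (z : ℂ) : HasDerivAt (fun z : ℂ => (1 - z) / 2) (-(1 / 2)) z := by
  have := ((hasDerivAt_id z).const_sub 1).div_const 2
  simpa [neg_div] using this

theorem hasDerivAt_legF' (ν : ℂ) {z : ℂ} (hz : ‖1 - z‖ < 2) :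
    HasDerivAt (legF ν) (-(1 / 2) * powSum (derivCoeff (gaussCoeff ν 1)) ((1 - z) / 2)) z := by
  rw [mul_comm]
  exact ((ratioOne_gaussCoeff ν 1).hasDerivAt (norm_half_one_sub_lt hz)).comp z
    (hasDerivAt_half_one_sub z)

theorem hasDerivAt_legF (ν : ℂ) {z : ℂ} (hz : ‖1 - z‖ < 2) (hz' : 1 - z ^ 2 ≠ 0) :
    HasDerivAt (legF ν) (legD ν z / (1 - z ^ 2)) z := by
  rw [legD, mul_div_cancel_left₀ _ hz']
  exact hasDerivAt_legF' ν hz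

/-- Together with `hasDerivAt_legF` this is Legendre's equation as a first order system for (P, (1 -
z²)P'). The second component stays bounded at -1, where P itself may have a logarithm. -/
theorem hasDerivAt_legD (ν : ℂ) {z : ℂ} (hz : ‖1 - z‖ < 2) :
    HasDerivAt (legD ν) (-(ν * (ν + 1)) * legF ν z) z := by
  have h1 : HasDerivAt (fun z : ℂ => 1 - z ^ 2) (-(2 * z)) z := by
    simpa using (hasDerivAt_pow 2 z).const_sub 1
  have h2 := ((((ratioOne_gaussCoeff ν 1).derivCoeff.hasDerivAt
    (norm_half_one_sub_lt hz)).comp z (hasDerivAt_half_one_sub z)).const_mul (-(1 / 2)))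
  refine (h1.mul h2).congr_deriv ?_
  have := gauss_ode ν 1 (fun n => Nat.cast_add_one_ne_zero n) (norm_half_one_sub_lt hz)
  rw [legF]
  simp only [Function.comp_apply]
  linear_combination this

theorem legF_one (ν : ℂ) : legF ν 1 = 1 := by
  have : powSum (gaussCoeff ν 1) 0 = 1 := by
    rw [powSum, tsum_eq_single 0 (fun n hn => by simp [hn])]
    simp [gaussCoeff_zero]
  simpa [legF] using this

theorem legD_one (ν : ℂ) : legD ν 1 = 0 := by simp [legD]

theorem norm_one_sub_ofReal_lt {x : ℝ} (hx : x ∈ Ioc (-1 : ℝ) 1) : ‖1 - (x : ℂ)‖ < 2 := by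
  have : (1 : ℂ) - x = ((1 - x : ℝ) : ℂ) := by push_cast; ring
  rw [this, Complex.norm_real, Real.norm_eq_abs, abs_lt]
  constructor <;> linarith [hx.1, hx.2]

theorem one_sub_sq_pos {x : ℝ} (hx : x ∈ Ioo (-1 : ℝ) 1) : 0 < 1 - x ^ 2 := by
  nlinarith [hx.1, hx.2]

theorem one_sub_sq_ne {x : ℝ} (hx : x ∈ Ioo (-1 : ℝ) 1) : 1 - (x : ℂ) ^ 2 ≠ 0 := by
  exact_mod_cast (one_sub_sq_pos hx).ne'

/-! ### Size of the coefficients -/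

/-- Pairing (k - ν) with (k + ν) exposes a partial Euler product of the sine, which supplies both
the uniform bound and the limit of these coefficients. -/
theorem derivCoeff_gaussCoeff_one (ν : ℂ) (n : ℕ) :
    derivCoeff (gaussCoeff ν 1) n =
      -ν * ((n + 1 + ν) / (n + 1)) * ∏ j ∈ Finset.range n, (1 - ν ^ 2 / ((j : ℂ) + 1) ^ 2) := by
  induction n with
  | zero => simp [derivCoeff, gaussCoeff]
  | succ n ih =>
    have h1 : (n : ℂ) + 1 ≠ 0 := Nat.cast_add_one_ne_zero n
    have h2 : (n : ℂ) + 1 + 1 ≠ 0 := by exact_mod_cast Nat.cast_add_one_ne_zero (R := ℂ) (n + 1)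
    rw [Finset.prod_range_succ]
    have h3 : derivCoeff (gaussCoeff ν 1) (n + 1) =
        (n + 1 - ν) * (n + 2 + ν) / ((n + 1) * (n + 1 + 1)) *
          derivCoeff (gaussCoeff ν 1) n := by
      simp only [derivCoeff, gaussCoeff_succ ν 1 (n + 1)]
      push_cast
      field_simp
      ring
    rw [h3, ih]
    push_cast
    field_simp
    ring

/-- Since 1 + t ≤ exp t, the product is at most exp(R² Σ 1/(j + 1)²). Uniformity in ν is what later
allows dominated convergence in the degree. -/
theorem exists_norm_derivCoeff_le (R : ℝ) :
    ∃ K : ℝ, 0 ≤ K ∧ ∀ ν : ℂ, ‖ν‖ ≤ R → ∀ n, ‖derivCoeff (gaussCoeff ν 1) n‖ ≤ K := by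
  by_cases hR : 0 ≤ R
  swap
  · exact ⟨0, le_rfl, fun ν hν => absurd ((norm_nonneg ν).trans hν) hR⟩
  have hs : Summable fun j : ℕ => 1 / ((j : ℝ) + 1) ^ 2 := by
    have := (summable_nat_add_iff 1).2 (Real.summable_one_div_nat_pow.2 (le_refl 2))
    simpa using this
  refine ⟨R * (1 + R) * Real.exp (R ^ 2 * ∑' j : ℕ, 1 / ((j : ℝ) + 1) ^ 2), by positivity,
    fun ν hν n => ?_⟩
  have hn1 : ‖(n : ℂ) + 1‖ = n + 1 := by
    rw [← Nat.cast_succ, Complex.norm_natCast]; push_cast; rfl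
  rw [derivCoeff_gaussCoeff_one, norm_mul, norm_mul, norm_neg]
  have h1 : ‖((n : ℂ) + 1 + ν) / (n + 1)‖ ≤ 1 + R := by
    rw [norm_div, hn1, div_le_iff₀ (by positivity)]
    calc ‖(n : ℂ) + 1 + ν‖ ≤ (n + 1) + R := (norm_add_le _ _).trans (by rw [hn1]; linarith)
      _ ≤ (1 + R) * (n + 1) := by nlinarith [(Nat.cast_nonneg n : (0 : ℝ) ≤ n)]
  have h2 : ‖∏ j ∈ Finset.range n, (1 - ν ^ 2 / ((j : ℂ) + 1) ^ 2)‖ ≤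
      Real.exp (R ^ 2 * ∑' j : ℕ, 1 / ((j : ℝ) + 1) ^ 2) := by
    rw [norm_prod]
    calc ∏ j ∈ Finset.range n, ‖1 - ν ^ 2 / ((j : ℂ) + 1) ^ 2‖
        ≤ ∏ j ∈ Finset.range n, Real.exp (R ^ 2 * (1 / ((j : ℝ) + 1) ^ 2)) := by
          refine Finset.prod_le_prod (fun _ _ => norm_nonneg _) fun j _ => ?_
          have hj : ‖(j : ℂ) + 1‖ = j + 1 := by
            rw [← Nat.cast_succ, Complex.norm_natCast]; push_cast; rfl
          refine (norm_sub_le _ _).trans ?_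
          rw [norm_one, norm_div, norm_pow, norm_pow, hj, mul_one_div]
          refine le_trans ?_ (Real.add_one_le_exp _)
          rw [add_comm]
          gcongr
      _ = Real.exp (R ^ 2 * ∑ j ∈ Finset.range n, 1 / ((j : ℝ) + 1) ^ 2) := by
          rw [← Real.exp_sum, Finset.mul_sum]
      _ ≤ _ := by
          gcongr
          exact hs.sum_le_tsum _ (fun _ _ => by positivity)
  gcongr

theorem tendsto_derivCoeff (ν : ℂ) :
    Tendsto (derivCoeff (gaussCoeff ν 1)) atTop (𝓝 (-(Complex.sin (π * ν) / π))) := by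
  have h1 := Complex.tendsto_euler_sin_prod ν
  have h2 := (tendsto_natCast_add_div_add (1 + ν) 1).mul (h1.const_mul (-(1 / π : ℂ)))
  have hpi : (π : ℂ) ≠ 0 := by exact_mod_cast Real.pi_ne_zero
  have e : (1 : ℂ) * (-(1 / π : ℂ) * Complex.sin (π * ν)) = -(Complex.sin (π * ν) / π) := by
    ring
  rw [e] at h2
  refine h2.congr fun n => ?_
  rw [derivCoeff_gaussCoeff_one]
  field_simp
  ring_nf

theorem norm_powSum_derivCoeff_le {ν : ℂ} {K : ℝ}
    (hK : ∀ n, ‖derivCoeff (gaussCoeff ν 1) n‖ ≤ K) {s : ℝ} (h0 : 0 ≤ s) (h1 : s < 1) :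
    ‖powSum (derivCoeff (gaussCoeff ν 1)) s‖ ≤ K * (1 - s)⁻¹ := by
  refine tsum_of_norm_bounded ((hasSum_geometric_of_lt_one h0 h1).mul_left K) fun n => ?_
  rw [norm_mul, norm_pow, Complex.norm_real, Real.norm_eq_abs, abs_of_nonneg h0]
  gcongr
  exact hK n

/-- Bounded (n + 1)c(n + 1) means comparison with Σ s^(n+1)/(n + 1) = -log(1 - s): the singularity
at x = -1 is at most logarithmic. -/
theorem norm_powSum_gaussCoeff_le {ν : ℂ} {K : ℝ}
    (hK : ∀ n, ‖derivCoeff (gaussCoeff ν 1) n‖ ≤ K) {s : ℝ} (h0 : 0 ≤ s) (h1 : s < 1) :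
    ‖powSum (gaussCoeff ν 1) s‖ ≤ 1 + K * -Real.log (1 - s) := by
  have hsum := (ratioOne_gaussCoeff ν 1).summable (z := (s : ℂ))
    (by rwa [Complex.norm_real, Real.norm_eq_abs, abs_of_nonneg h0])
  rw [powSum, hsum.tsum_eq_zero_add]
  refine (norm_add_le _ _).trans ?_
  simp only [gaussCoeff_zero, pow_zero, mul_one, norm_one]
  gcongr
  refine tsum_of_norm_bounded ((Real.hasSum_pow_div_log_of_abs_lt_one
    (by rwa [abs_of_nonneg h0])).mul_left K) fun n => ?_
  rw [norm_mul, norm_pow, Complex.norm_real, Real.norm_eq_abs, abs_of_nonneg h0]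
  have hn1 : ‖(n : ℂ) + 1‖ = n + 1 := by
    rw [← Nat.cast_succ, Complex.norm_natCast]; push_cast; rfl
  have := hK n
  rw [derivCoeff, norm_mul, hn1] at this
  have hp : (0 : ℝ) < n + 1 := by positivity
  calc ‖gaussCoeff ν 1 (n + 1)‖ * s ^ (n + 1)
      = ((n + 1) * ‖gaussCoeff ν 1 (n + 1)‖) * (s ^ (n + 1) / (n + 1)) := by field_simp
    _ ≤ _ := by gcongr

/-- Bounds for `P_ν` and its quasi-derivative, uniform for `ν` in a bounded set. -/
theorem exists_legendre_bound (R : ℝ) :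
    ∃ B : ℝ, 0 ≤ B ∧ ∀ ν : ℂ, ‖ν‖ ≤ R → ∀ x ∈ Ioo (-1 : ℝ) 1,
      ‖legF ν x‖ ≤ B * (1 + x) ^ (-(1 / 8) : ℝ) ∧ ‖legD ν x‖ ≤ B * (1 - x) := by
  obtain ⟨K, hK0, hK⟩ := exists_norm_derivCoeff_le R
  refine ⟨(1 + 8 * K) * 2, by positivity, fun ν hν x hx => ?_⟩
  have e : (1 - (x : ℂ)) / 2 = (((1 - x) / 2 : ℝ) : ℂ) := by push_cast; ring
  have h0 : 0 ≤ (1 - x) / 2 := by linarith [hx.2]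
  have h1 : (1 - x) / 2 < 1 := by linarith [hx.1]
  have e2 : 1 - (1 - x) / 2 = (1 + x) / 2 := by ring
  have hpos : 0 < (1 + x) / 2 := by linarith [hx.1]
  have hle : (1 + x) / 2 ≤ 1 := by linarith [hx.2]
  constructor
  · have := norm_powSum_gaussCoeff_le (hK ν hν) h0 h1
    rw [e2] at this
    rw [legF, e]
    -- The logarithm is traded for a small negative power, since powers multiply easily. The
    -- exponent 1/8 is small enough for all later products to remain integrable.
    have hlog : -Real.log ((1 + x) / 2) ≤ 8 * ((1 + x) / 2) ^ (-(1 / 8) : ℝ) := by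
      rw [← Real.log_inv]
      have := Real.log_le_rpow_div (inv_nonneg.2 hpos.le) (by norm_num : (0 : ℝ) < 1 / 8)
      rw [Real.inv_rpow hpos.le, ← Real.rpow_neg hpos.le] at this
      linarith
    have hone : 1 ≤ ((1 + x) / 2) ^ (-(1 / 8) : ℝ) :=
      Real.one_le_rpow_of_pos_of_le_one_of_nonpos hpos hle (by norm_num)
    have htwo : ((1 + x) / 2) ^ (-(1 / 8) : ℝ) ≤ 2 * (1 + x) ^ (-(1 / 8) : ℝ) := by
      rw [Real.div_rpow (by linarith [hx.1]) (by norm_num), div_eq_mul_inv, mul_comm,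
        ← Real.rpow_neg (by norm_num), neg_neg]
      gcongr
      · exact Real.rpow_nonneg (by linarith [hx.1]) _
      · calc (2 : ℝ) ^ (1 / 8 : ℝ) ≤ 2 ^ (1 : ℝ) :=
            Real.rpow_le_rpow_of_exponent_le (by norm_num) (by norm_num)
          _ = 2 := Real.rpow_one 2
    calc _ ≤ 1 + K * -Real.log ((1 + x) / 2) := this
      _ ≤ (1 + 8 * K) * ((1 + x) / 2) ^ (-(1 / 8) : ℝ) := by nlinarith
      _ ≤ (1 + 8 * K) * (2 * (1 + x) ^ (-(1 / 8) : ℝ)) := by gcongr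
      _ = _ := by ring
  · have := norm_powSum_derivCoeff_le (hK ν hν) h0 h1
    rw [e2] at this
    have e3 : 1 - (x : ℂ) ^ 2 = ((1 - x ^ 2 : ℝ) : ℂ) := by push_cast; ring
    rw [legD, e, e3, norm_mul, norm_mul, Complex.norm_real, Real.norm_eq_abs,
      abs_of_pos (one_sub_sq_pos hx)]
    have hh : ‖(-(1 / 2) : ℂ)‖ = 1 / 2 := by norm_num
    rw [hh]
    have hx1 : 0 ≤ 1 - x := by linarith [hx.2]
    have hx2 : 0 < 1 + x := by linarith [hx.1]
    calc (1 - x ^ 2) * (1 / 2 * ‖powSum (derivCoeff (gaussCoeff ν 1)) ↑((1 - x) / 2)‖)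
        ≤ (1 - x ^ 2) * (1 / 2 * (K * ((1 + x) / 2)⁻¹)) := by
          have := (one_sub_sq_pos hx).le
          gcongr
      _ = K * (1 - x) := by field_simp; ring
      _ ≤ _ := by
          gcongr
          linarith

/-- The value of `(1 - x ^ 2) P_ν'(x)` at the left end point. -/
theorem tendsto_legD_neg_one (ν : ℂ) :
    Tendsto (fun x : ℝ => legD ν x) (𝓝[>] (-1)) (𝓝 (2 * Complex.sin (π * ν) / π)) := by
  set d := derivCoeff (gaussCoeff ν 1) with hd
  -- With s = (1 - x)/2 one has 1 - x² = 4s(1 - s). The factor 1 - s turns the coefficients d into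
  -- their differences e, whose partial sums are d again, so Abel's theorem gives the limit as s →
  -- 1.
  set e : ℕ → ℂ := fun n => d n - if n = 0 then 0 else d (n - 1) with he
  have hsum : ∀ n, ∑ i ∈ Finset.range (n + 1), e i = d n := by
    intro n
    induction n with
    | zero => simp [he]
    | succ n ih => rw [Finset.sum_range_succ, ih]; simp [he]
  have hlim : Tendsto (fun n => ∑ i ∈ Finset.range n, e i) atTop
      (𝓝 (-(Complex.sin (π * ν) / π))) := by
    rw [← tendsto_add_atTop_iff_nat 1]
    simp only [hsum]
    exact tendsto_derivCoeff ν
  have habel := Complex.tendsto_tsum_powerSeries_nhdsWithin_lt hlim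
  rw [tendsto_map'_iff] at habel
  have hs : Tendsto (fun x : ℝ => (1 - x) / 2) (𝓝[>] (-1)) (𝓝[<] 1) := by
    rw [tendsto_nhdsWithin_iff]
    constructor
    · have : Tendsto (fun x : ℝ => (1 - x) / 2) (𝓝 (-1)) (𝓝 ((1 - (-1)) / 2)) := by
        apply Continuous.tendsto; fun_prop
      norm_num at this
      exact this.mono_left nhdsWithin_le_nhds
    · filter_upwards [self_mem_nhdsWithin] with x hx
      have : -1 < x := hx
      show (1 - x) / 2 < 1
      linarith
  have hs' : Tendsto (fun x : ℝ => (((1 - x) / 2 : ℝ) : ℂ)) (𝓝[>] (-1)) (𝓝 1) := by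
    have := (Complex.continuous_ofReal.tendsto 1).comp (tendsto_nhds_of_tendsto_nhdsWithin hs)
    rw [Complex.ofReal_one] at this
    exact this
  have h := (hs'.const_mul (-2)).mul (habel.comp hs)
  have e1 : (-2 * 1 : ℂ) * -(Complex.sin (π * ν) / π) = 2 * Complex.sin (π * ν) / π := by ring
  rw [e1] at h
  refine h.congr' ?_
  have hmem : Ioo (-1 : ℝ) 1 ∈ 𝓝[>] (-1 : ℝ) := Ioo_mem_nhdsGT (by norm_num)
  filter_upwards [hmem] with x hx
  simp only [Function.comp_apply]
  set s : ℂ := (((1 - x) / 2 : ℝ) : ℂ) with hsdef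
  have hsn : ‖s‖ < 1 := by
    rw [hsdef, Complex.norm_real, Real.norm_eq_abs, abs_lt]
    constructor <;> linarith [hx.1, hx.2]
  have S := ((ratioOne_gaussCoeff ν 1).derivCoeff.summable hsn).hasSum
  have S2 : HasSum (fun n : ℕ => (if n = 0 then 0 else d (n - 1)) * s ^ n) (s * powSum d s) := by
    rw [← hasSum_nat_add_iff' 1]
    simp only [Finset.range_one, Finset.sum_singleton, if_true, zero_mul, sub_zero]
    have e : (fun n : ℕ => (if n + 1 = 0 then 0 else d (n + 1 - 1)) * s ^ (n + 1)) =
        fun n => s * (d n * s ^ n) := by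
      funext n; simp; ring
    rw [e]
    exact S.mul_left s
  have S3 := (S.sub S2).tsum_eq
  have e4 : (fun n => d n * s ^ n - (if n = 0 then 0 else d (n - 1)) * s ^ n) =
      fun n => e n * s ^ n := by funext n; simp only [he]; ring
  rw [← hd] at S3
  rw [e4] at S3
  rw [S3, legD]
  have e5 : (1 - (x : ℂ)) / 2 = s := by rw [hsdef]; push_cast; ring
  have e6 : (x : ℂ) = 1 - 2 * s := by rw [hsdef]; push_cast; ring
  rw [e5, e6, ← hd]
  simp only [powSum]
  ring

/-! ### The Mehler–Dirichlet integral as a hypergeometric series -/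

theorem const_of_hasDerivAt_zero {𝕜 : Type*} [RCLike 𝕜] [NormedSpace 𝕜 ℂ] {f : 𝕜 → ℂ} {s : Set 𝕜}
    (hs : IsOpen s) (hs' : IsPreconnected s) (h : ∀ x ∈ s, HasDerivAt f 0 x) {x y : 𝕜}
    (hx : x ∈ s) (hy : y ∈ s) : f x = f y :=
  hs.is_const_of_deriv_eq_zero hs' (fun z hz => (h z hz).differentiableAt.differentiableWithinAt)
    (fun z hz => (h z hz).deriv) hx hy

/-- The substitution sin(β/2) = s sin φ with s = sin(θ/2) removes the endpoint singularity, because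
2(cos β - cos θ) becomes (2s cos φ)². -/
theorem legendreP_eq_integral (ν : ℂ) {x : ℝ} (hx : x ∈ Ioc (-1 : ℝ) 1) :
    legendreP ν x = (2 / (π : ℂ)) * ∫ φ in (0 : ℝ)..(π / 2),
      Complex.cos ((2 * ν + 1) * (Real.arcsin (√((1 - x) / 2) * Real.sin φ) : ℝ)) /
        ((√(1 - √((1 - x) / 2) ^ 2 * Real.sin φ ^ 2) : ℝ) : ℂ) := by
  -- At x = 1 the modulus s vanishes, the integrand is 1, and both sides equal 1.
  rcases eq_or_lt_of_le hx.2 with h1 | h1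
  · subst h1
    have hpi : (π : ℂ) ≠ 0 := by exact_mod_cast Real.pi_ne_zero
    simp [legendreP]
  rw [legendreP, if_neg h1.ne]
  congr 1
  set s := √((1 - x) / 2) with hs
  have hs2 : s ^ 2 = (1 - x) / 2 := Real.sq_sqrt (by linarith)
  have hs0 : 0 < s := Real.sqrt_pos.2 (by linarith)
  have hs1 : s < 1 := by nlinarith [hx.1]
  set θ := Real.arccos x with hθ
  have hθ0 : 0 < θ := Real.arccos_pos.2 h1
  have hθπ : θ ≤ π := Real.arccos_le_pi x
  have hcos : Real.cos θ = x := Real.cos_arccos hx.1.le hx.2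
  have hsin : Real.sin (θ / 2) = s := by
    rw [hs, Real.sin_half_eq_sqrt hθ0.le (by linarith [Real.pi_pos]), hcos]
  have hbound : ∀ φ ∈ Ioo 0 (π / 2), 0 < s * Real.sin φ ∧ s * Real.sin φ < s := by
    intro φ hφ
    have h2 : 0 < Real.sin φ := Real.sin_pos_of_pos_of_lt_pi hφ.1 (by linarith [hφ.2, Real.pi_pos])
    have h3 : Real.sin φ < 1 := by
      rw [← Real.sin_pi_div_two]
      exact Real.sin_lt_sin_of_lt_of_le_pi_div_two (by linarith [hφ.1, Real.pi_pos]) le_rfl hφ.2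
    exact ⟨by positivity, by nlinarith⟩
  set b : ℝ → ℝ := fun φ => 2 * Real.arcsin (s * Real.sin φ) with hb
  have hderiv : ∀ φ ∈ Ioo 0 (π / 2), HasDerivWithinAt b
      (2 * (1 / √(1 - (s * Real.sin φ) ^ 2) * (s * Real.cos φ))) (Ioo 0 (π / 2)) φ := by
    intro φ hφ
    obtain ⟨h2, h3⟩ := hbound φ hφ
    exact (((Real.hasDerivAt_arcsin (by linarith) (by linarith)).comp φ
      ((Real.hasDerivAt_sin φ).const_mul s)).const_mul 2).hasDerivWithinAt
  have hinj : InjOn b (Ioo 0 (π / 2)) := by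
    intro φ hφ ψ hψ h
    obtain ⟨h2, h3⟩ := hbound φ hφ
    obtain ⟨h4, h5⟩ := hbound ψ hψ
    have h6 : Real.arcsin (s * Real.sin φ) = Real.arcsin (s * Real.sin ψ) := by
      simp only [hb] at h; linarith
    have h7 := Real.injOn_arcsin ⟨by linarith, by linarith⟩ ⟨by linarith, by linarith⟩ h6
    have h8 : Real.sin φ = Real.sin ψ := mul_left_cancel₀ hs0.ne' h7
    exact Real.injOn_sin ⟨by linarith [hφ.1, Real.pi_pos], hφ.2.le⟩
      ⟨by linarith [hψ.1, Real.pi_pos], hψ.2.le⟩ h8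
  have himage : b '' Ioo 0 (π / 2) = Ioo 0 θ := by
    ext β
    constructor
    · rintro ⟨φ, hφ, rfl⟩
      obtain ⟨h2, h3⟩ := hbound φ hφ
      refine ⟨by simpa [hb] using Real.arcsin_pos.2 h2, ?_⟩
      have : Real.arcsin (s * Real.sin φ) < Real.arcsin s :=
        Real.arcsin_lt_arcsin (by linarith) h3 hs1.le
      rw [← hsin, Real.arcsin_sin (by linarith [Real.pi_pos]) (by linarith)] at this
      simp only [hb]
      rw [← hsin]
      linarith
    · intro hβ
      have h2 : 0 < Real.sin (β / 2) :=
        Real.sin_pos_of_pos_of_lt_pi (by linarith [hβ.1]) (by linarith [hβ.2, Real.pi_pos])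
      have h3 : Real.sin (β / 2) < s := by
        rw [← hsin]
        exact Real.sin_lt_sin_of_lt_of_le_pi_div_two (by linarith [hβ.1, Real.pi_pos])
          (by linarith) (by linarith [hβ.2])
      have h4 : Real.sin (β / 2) / s < 1 := (div_lt_one hs0).2 h3
      have h5 : 0 < Real.sin (β / 2) / s := by positivity
      refine ⟨Real.arcsin (Real.sin (β / 2) / s),
        ⟨Real.arcsin_pos.2 h5, Real.arcsin_lt_pi_div_two.2 h4⟩, ?_⟩
      simp only [hb]
      rw [Real.sin_arcsin (by linarith) h4.le, mul_div_cancel₀ _ hs0.ne',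
        Real.arcsin_sin (by linarith [hβ.1, Real.pi_pos]) (by linarith [hβ.2])]
      ring
  rw [intervalIntegral.integral_of_le hθ0.le, intervalIntegral.integral_of_le (by positivity),
    integral_Ioc_eq_integral_Ioo, integral_Ioc_eq_integral_Ioo, ← himage,
    integral_image_eq_integral_abs_deriv_smul measurableSet_Ioo hderiv hinj]
  refine setIntegral_congr_fun measurableSet_Ioo fun φ hφ => ?_
  obtain ⟨h2, h3⟩ := hbound φ hφ
  have hc : 0 < Real.cos φ :=
    Real.cos_pos_of_mem_Ioo ⟨by linarith [hφ.1, Real.pi_pos], hφ.2⟩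
  have h4 : 2 * (Real.cos (b φ) - x) = (2 * s * Real.cos φ) ^ 2 := by
    simp only [hb]
    rw [Real.cos_two_mul, Real.cos_sq', Real.sin_arcsin (by linarith) (by linarith)]
    have : x = 1 - 2 * s ^ 2 := by linarith
    rw [this]
    nlinarith [Real.sin_sq_add_cos_sq φ]
  have hq : 0 < 1 - (s * Real.sin φ) ^ 2 := by nlinarith
  have hsq := Real.sqrt_pos.2 hq
  rw [h4, Real.sqrt_sq (by positivity), abs_of_pos (by positivity), Complex.real_smul]
  have e1 : (2 * ν + 1) * ((b φ : ℝ) : ℂ) / 2 =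
      (2 * ν + 1) * (Real.arcsin (s * Real.sin φ) : ℝ) := by
    simp only [hb]; push_cast; ring
  rw [e1, mul_pow] at *
  have n1 : ((√(1 - s ^ 2 * Real.sin φ ^ 2) : ℝ) : ℂ) ≠ 0 := by
    exact_mod_cast hsq.ne'
  have n2 : (s : ℂ) ≠ 0 := by exact_mod_cast hs0.ne'
  have n3 : (Real.cos φ : ℂ) ≠ 0 := by exact_mod_cast hc.ne'
  push_cast at n3 ⊢
  field_simp

theorem natCast_add_half_ne_zero (n : ℕ) : (n : ℂ) + 1 / 2 ≠ 0 := by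
  have h : ((n : ℝ) + 1 / 2) ≠ 0 := by positivity
  have e : (n : ℂ) + 1 / 2 = (((n : ℝ) + 1 / 2 : ℝ) : ℂ) := by push_cast; rfl
  rw [e]
  exact_mod_cast h

/-- The hypergeometric equation with γ = 1/2 becomes, in the variable φ and after multiplication by
cos φ, the oscillator T'' = -(2ν + 1)²T with T(0) = 1 and T'(0) = 0. Here U is T'. -/
theorem gaussSeries_half_sin_sq (ν : ℂ) {φ : ℝ} (hφ : φ ∈ Ioo (-(π / 2)) (π / 2)) :
    powSum (gaussCoeff ν (1 / 2)) ((Real.sin φ : ℂ) ^ 2) * (Real.cos φ : ℂ) =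
      Complex.cos ((2 * ν + 1) * φ) := by
  set c := gaussCoeff ν (1 / 2) with hc
  have hR : RatioOne c := ratioOne_gaussCoeff ν _
  set ω := 2 * ν + 1 with hω
  set T : ℝ → ℂ := fun φ => powSum c ((Real.sin φ : ℂ) ^ 2) * (Real.cos φ : ℂ) with hT
  set U : ℝ → ℂ := fun φ => powSum (derivCoeff c) ((Real.sin φ : ℂ) ^ 2) *
    (2 * (Real.sin φ : ℂ) * (Real.cos φ : ℂ) ^ 2) -
      powSum c ((Real.sin φ : ℂ) ^ 2) * (Real.sin φ : ℂ) with hU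
  have hlt : ∀ ψ ∈ Ioo (-(π / 2)) (π / 2), ‖(Real.sin ψ : ℂ) ^ 2‖ < 1 := by
    intro ψ hψ
    rw [norm_pow, Complex.norm_real, Real.norm_eq_abs, sq_abs]
    nlinarith [Real.sin_sq_add_cos_sq ψ, Real.cos_pos_of_mem_Ioo hψ]
  have hds : ∀ ψ : ℝ, HasDerivAt (fun φ : ℝ => (Real.sin φ : ℂ)) (Real.cos ψ : ℂ) ψ :=
    fun ψ => (Real.hasDerivAt_sin ψ).ofReal_comp
  have hdc : ∀ ψ : ℝ, HasDerivAt (fun φ : ℝ => (Real.cos φ : ℂ)) (-(Real.sin ψ : ℂ)) ψ := by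
    intro ψ
    simpa using (Real.hasDerivAt_cos ψ).ofReal_comp
  have hd0 : ∀ c : ℕ → ℂ, RatioOne c → ∀ ψ ∈ Ioo (-(π / 2)) (π / 2),
      HasDerivAt (fun φ : ℝ => powSum c ((Real.sin φ : ℂ) ^ 2))
        (powSum (derivCoeff c) ((Real.sin ψ : ℂ) ^ 2) *
          (2 * (Real.sin ψ : ℂ) * (Real.cos ψ : ℂ))) ψ := by
    intro c hR ψ hψ
    have h1 := (hds ψ).pow 2
    have h2 := (hR.hasDerivAt (hlt ψ hψ)).comp ψ h1
    refine h2.congr_deriv ?_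
    push_cast
    ring
  have hsc : ∀ ψ : ℝ, (Real.sin ψ : ℂ) ^ 2 + (Real.cos ψ : ℂ) ^ 2 = 1 := by
    intro ψ; exact_mod_cast Real.sin_sq_add_cos_sq ψ
  have hTd : ∀ ψ ∈ Ioo (-(π / 2)) (π / 2), HasDerivAt T (U ψ) ψ := by
    intro ψ hψ
    refine ((hd0 c hR ψ hψ).mul (hdc ψ)).congr_deriv ?_
    simp only [hU]; ring
  have hUd : ∀ ψ ∈ Ioo (-(π / 2)) (π / 2), HasDerivAt U (-ω ^ 2 * T ψ) ψ := by
    intro ψ hψ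
    refine (((hd0 _ hR.derivCoeff ψ hψ).mul (((hds ψ).const_mul 2).mul ((hdc ψ).pow 2))).sub
      ((hd0 c hR ψ hψ).mul (hds ψ))).congr_deriv ?_
    have := gauss_ode ν (1 / 2) natCast_add_half_ne_zero (hlt ψ hψ)
    rw [← hc] at this
    have h3 : (Real.cos ψ : ℂ) ^ 2 = 1 - (Real.sin ψ : ℂ) ^ 2 := by linear_combination hsc ψ
    simp only [hT, hω, Pi.pow_apply, Pi.mul_apply]
    push_cast at this h3 ⊢
    linear_combination 4 * Complex.cos ψ * this +
      (4 * Complex.cos ψ * Complex.sin ψ ^ 2 *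
        powSum (derivCoeff (derivCoeff c)) (Complex.sin ψ ^ 2) +
        2 * Complex.cos ψ * powSum (derivCoeff c) (Complex.sin ψ ^ 2)) * h3
  have hcd : ∀ ψ : ℝ, HasDerivAt (fun φ : ℝ => Complex.cos (ω * φ)) (-Complex.sin (ω * ψ) * ω) ψ := by
    intro ψ
    have h1 : HasDerivAt (fun φ : ℝ => ω * (φ : ℂ)) ω ψ := by
      simpa using (Complex.ofRealCLM.hasDerivAt (x := ψ)).const_mul ω
    exact (Complex.hasDerivAt_cos _).comp ψ h1
  have hsd : ∀ ψ : ℝ, HasDerivAt (fun φ : ℝ => Complex.sin (ω * φ)) (Complex.cos (ω * ψ) * ω) ψ := by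
    intro ψ
    have h1 : HasDerivAt (fun φ : ℝ => ω * (φ : ℂ)) ω ψ := by
      simpa using (Complex.ofRealCLM.hasDerivAt (x := ψ)).const_mul ω
    exact (Complex.hasDerivAt_sin _).comp ψ h1
  have hmem0 : (0 : ℝ) ∈ Ioo (-(π / 2)) (π / 2) := by constructor <;> linarith [Real.pi_pos]
  have hT0 : T 0 = 1 := by
    have : powSum c 0 = 1 := by
      rw [powSum, tsum_eq_single 0 (fun n hn => by simp [hn])]
      simp [hc, gaussCoeff_zero]
    simp [hT, this]
  have hU0 : U 0 = 0 := by simp [hU]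
  have key : ∀ E : ℝ → ℂ, (∀ ψ ∈ Ioo (-(π / 2)) (π / 2), HasDerivAt E 0 ψ) → E φ = E 0 :=
    fun E hE => const_of_hasDerivAt_zero isOpen_Ioo isPreconnected_Ioo hE hφ hmem0
  show T φ = _
  -- The frequency zero is ν = -1/2. There the two first integrals used below degenerate, and T is
  -- constant because U vanishes.
  by_cases h0 : ω = 0
  · have hUz : ∀ ψ ∈ Ioo (-(π / 2)) (π / 2), U ψ = 0 := fun ψ hψ => by
      rw [← hU0]
      refine const_of_hasDerivAt_zero isOpen_Ioo isPreconnected_Ioo (fun x hx => ?_) hψ hmem0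
      simpa [h0] using hUd x hx
    rw [key T fun ψ hψ => by simpa [hUz ψ hψ] using hTd ψ hψ, hT0, h0]
    simp
  · have h1 := key (fun ψ => U ψ * Complex.cos (ω * ψ) + ω * (T ψ * Complex.sin (ω * ψ)))
      fun ψ hψ => (((hUd ψ hψ).mul (hcd ψ)).add
        (((hTd ψ hψ).mul (hsd ψ)).const_mul ω)).congr_deriv (by ring)
    have h2 := key (fun ψ => U ψ * Complex.sin (ω * ψ) - ω * (T ψ * Complex.cos (ω * ψ)))
      fun ψ hψ => (((hUd ψ hψ).mul (hsd ψ)).sub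
        (((hTd ψ hψ).mul (hcd ψ)).const_mul ω)).congr_deriv (by ring)
    simp only [hT0, hU0, Complex.ofReal_zero, mul_zero, Complex.sin_zero, Complex.cos_zero,
      add_zero, mul_one, zero_sub] at h1 h2
    refine mul_left_cancel₀ h0 ?_
    have := Complex.sin_sq_add_cos_sq (ω * φ)
    linear_combination Complex.sin (ω * φ) * h1 - Complex.cos (ω * φ) * h2 - ω * T φ * this

theorem integral_sin_pow_two_mul_half_pi (n : ℕ) :
    ∫ φ in (0 : ℝ)..(π / 2), Real.sin φ ^ (2 * n) =
      π / 2 * ∏ i ∈ Finset.range n, (2 * (i : ℝ) + 1) / (2 * i + 2) := by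
  have h := EulerSine.integral_cos_pow_eq (2 * n)
  rw [integral_sin_pow_even] at h
  have h2 := intervalIntegral.integral_comp_sub_left (fun x => Real.cos x ^ (2 * n)) (π / 2)
    (a := 0) (b := π / 2)
  simp only [Real.cos_pi_div_two_sub, sub_self, sub_zero] at h2
  rw [h2, h]
  ring

/-- Averaging sin^(2n) contributes (1/2)_n/n!, exactly the factor that changes the lower parameter
from 1/2 to 1. -/
theorem gaussCoeff_one_eq (ν : ℂ) (n : ℕ) :
    gaussCoeff ν 1 n = gaussCoeff ν (1 / 2) n *
      ((∏ i ∈ Finset.range n, (2 * (i : ℝ) + 1) / (2 * i + 2) : ℝ) : ℂ) := by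
  push_cast
  rw [gaussCoeff, gaussCoeff, ← Finset.prod_mul_distrib]
  refine Finset.prod_congr rfl fun k _ => ?_
  have h1 : (k : ℂ) + 1 ≠ 0 := Nat.cast_add_one_ne_zero k
  have h2 := natCast_add_half_ne_zero k
  have h3 : 2 * (k : ℂ) + 2 = 2 * (k + 1) := by ring
  have h4 : 2 * (k : ℂ) + 1 = 2 * (k + 1 / 2) := by ring
  rw [h3, h4, mul_div_mul_left _ _ two_ne_zero]
  generalize (k : ℂ) + 1 / 2 = a at *
  field_simp

/-- The Mehler–Dirichlet integral is the hypergeometric series. -/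
theorem legendreP_eq_legF (ν : ℂ) {x : ℝ} (hx : x ∈ Ioc (-1 : ℝ) 1) :
    legendreP ν x = legF ν x := by
  rw [legendreP_eq_integral ν hx]
  set s := √((1 - x) / 2) with hs
  have hs2 : s ^ 2 = (1 - x) / 2 := Real.sq_sqrt (by linarith [hx.2])
  have hs0 : 0 ≤ s := Real.sqrt_nonneg _
  have hs1 : s < 1 := by nlinarith [hx.1]
  set c := gaussCoeff ν (1 / 2) with hc
  have hR : RatioOne c := ratioOne_gaussCoeff ν _
  have hint : ∀ φ : ℝ, Complex.cos ((2 * ν + 1) * (Real.arcsin (s * Real.sin φ) : ℝ)) /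
        ((√(1 - s ^ 2 * Real.sin φ ^ 2) : ℝ) : ℂ) =
        ∑' n, c n * ((s : ℂ) ^ (2 * n) * ((Real.sin φ ^ (2 * n) : ℝ) : ℂ)) := by
    intro φ
    have h1 : |s * Real.sin φ| < 1 := by
      rw [abs_mul, abs_of_nonneg hs0]
      nlinarith [Real.abs_sin_le_one φ, abs_nonneg (Real.sin φ)]
    rw [abs_lt] at h1
    have h2 : 0 < 1 - (s * Real.sin φ) ^ 2 := by nlinarith
    have hm : Real.arcsin (s * Real.sin φ) ∈ Ioo (-(π / 2)) (π / 2) :=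
      ⟨Real.neg_pi_div_two_lt_arcsin.2 h1.1, Real.arcsin_lt_pi_div_two.2 h1.2⟩
    have h3 := gaussSeries_half_sin_sq ν hm
    rw [Real.sin_arcsin h1.1.le h1.2.le, Real.cos_arcsin] at h3
    rw [← h3, ← mul_pow]
    have h4 : ((√(1 - (s * Real.sin φ) ^ 2) : ℝ) : ℂ) ≠ 0 := by
      exact_mod_cast (Real.sqrt_pos.2 h2).ne'
    rw [mul_div_cancel_right₀ _ h4, powSum]
    refine tsum_congr fun n => ?_
    push_cast
    ring
  simp only [hint]
  have hsn : ‖((s ^ 2 : ℝ) : ℂ)‖ < 1 := by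
    rw [Complex.norm_real, Real.norm_eq_abs, abs_of_nonneg (by positivity)]
    nlinarith
  have hsum := (hR.summable hsn).norm
  -- Termwise integration: |sin φ| ≤ 1 makes the absolutely convergent series at s² < 1 a majorant
  -- independent of φ.
  have hhs := intervalIntegral.hasSum_integral_of_dominated_convergence (μ := volume)
    (a := 0) (b := π / 2)
    (F := fun (n : ℕ) (φ : ℝ) => c n * ((s : ℂ) ^ (2 * n) * ((Real.sin φ ^ (2 * n) : ℝ) : ℂ)))
    (f := fun φ => ∑' n, c n * ((s : ℂ) ^ (2 * n) * ((Real.sin φ ^ (2 * n) : ℝ) : ℂ)))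
    (fun n _ => ‖c n * ((s ^ 2 : ℝ) : ℂ) ^ n‖)
    (fun n => by
      have : Continuous fun φ : ℝ => c n * ((s : ℂ) ^ (2 * n) * ((Real.sin φ ^ (2 * n) : ℝ) : ℂ)) := by
        fun_prop
      exact this.aestronglyMeasurable)
    (fun n => Eventually.of_forall fun φ _ => by
      rw [norm_mul, norm_mul, norm_mul, norm_pow, norm_pow, Complex.norm_real, Complex.norm_real,
        Complex.norm_real, pow_mul, Real.norm_eq_abs, Real.norm_eq_abs, Real.norm_eq_abs, sq_abs,
        abs_of_nonneg (by positivity : 0 ≤ s ^ 2), abs_pow]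
      have : |Real.sin φ| ^ (2 * n) ≤ 1 := pow_le_one₀ (abs_nonneg _) (Real.abs_sin_le_one φ)
      have h0 : 0 ≤ (s ^ 2) ^ n := by positivity
      exact mul_le_mul_of_nonneg_left (mul_le_of_le_one_right h0 this) (norm_nonneg _))
    (Eventually.of_forall fun φ _ => hsum)
    (by simp)
    (Eventually.of_forall fun φ _ => by
      refine Summable.hasSum (Summable.of_norm_bounded hsum fun n => ?_)
      rw [norm_mul, norm_mul, norm_mul, norm_pow, norm_pow, Complex.norm_real, Complex.norm_real,
        Complex.norm_real, pow_mul, Real.norm_eq_abs, Real.norm_eq_abs, Real.norm_eq_abs, sq_abs,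
        abs_of_nonneg (by positivity : 0 ≤ s ^ 2), abs_pow]
      have : |Real.sin φ| ^ (2 * n) ≤ 1 := pow_le_one₀ (abs_nonneg _) (Real.abs_sin_le_one φ)
      have h0 : 0 ≤ (s ^ 2) ^ n := by positivity
      exact mul_le_mul_of_nonneg_left (mul_le_of_le_one_right h0 this) (norm_nonneg _))
  rw [← hhs.tsum_eq, ← tsum_mul_left, legF, powSum]
  refine tsum_congr fun n => ?_
  rw [intervalIntegral.integral_const_mul, intervalIntegral.integral_const_mul,
    intervalIntegral.integral_ofReal, integral_sin_pow_two_mul_half_pi, gaussCoeff_one_eq, ← hc]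
  have hpi : (π : ℂ) ≠ 0 := by exact_mod_cast Real.pi_ne_zero
  have e : (1 - (x : ℂ)) / 2 = (s : ℂ) ^ 2 := by
    have : ((s ^ 2 : ℝ) : ℂ) = (((1 - x) / 2 : ℝ) : ℂ) := by rw [hs2]
    push_cast at this; exact this.symm
  rw [e, ← pow_mul, Complex.ofReal_mul]
  push_cast
  field_simp

/-- The complete elliptic integral of the first kind is a Legendre function of degree `-1/2`. -/
theorem ellipticK_sqrt {t : ℝ} (ht : t ∈ Ico (0 : ℝ) 1) :
    (ellipticK (√t) : ℂ) = π / 2 * legF (-1 / 2) ((1 - 2 * t : ℝ) : ℂ) := by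
  rw [← legendreP_eq_legF _ ⟨by linarith [ht.2], by linarith [ht.1]⟩,
    legendreP_eq_integral _ ⟨by linarith [ht.2], by linarith [ht.1]⟩]
  have hpi : (π : ℂ) ≠ 0 := by exact_mod_cast Real.pi_ne_zero
  have e : (1 - (1 - 2 * t)) / 2 = t := by ring
  have e2 : (2 : ℂ) * (-1 / 2) + 1 = 0 := by norm_num
  rw [e, e2]
  simp only [zero_mul, Complex.cos_zero]
  rw [ellipticK, ← intervalIntegral.integral_ofReal, ← mul_assoc]
  have e3 : (π : ℂ) / 2 * (2 / π) = 1 := by field_simp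
  rw [e3, one_mul]
  refine intervalIntegral.integral_congr fun φ _ => ?_
  simp

/-! ### The reflected solution on (-1, 1) -/

/-- The reflected Legendre function `P_ν(-z)`. -/
noncomputable def legFr (ν z : ℂ) : ℂ := legF ν (-z)

/-- The quasi-derivative of `P_ν(-z)`. -/
noncomputable def legDr (ν z : ℂ) : ℂ := -legD ν (-z)

theorem hasDerivAt_legFr (ν : ℂ) {z : ℂ} (hz : ‖1 + z‖ < 2) (hz' : 1 - z ^ 2 ≠ 0) :
    HasDerivAt (legFr ν) (legDr ν z / (1 - z ^ 2)) z := by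
  have h := (hasDerivAt_legF ν (z := -z) (by rwa [sub_neg_eq_add]) (by rwa [neg_sq])).comp z
    (hasDerivAt_neg z)
  refine h.congr_deriv ?_
  rw [legDr, neg_sq]; ring

theorem hasDerivAt_legDr (ν : ℂ) {z : ℂ} (hz : ‖1 + z‖ < 2) :
    HasDerivAt (legDr ν) (-(ν * (ν + 1)) * legFr ν z) z := by
  have h := ((hasDerivAt_legD ν (z := -z) (by rwa [sub_neg_eq_add])).comp z
    (hasDerivAt_neg z)).neg
  refine h.congr_deriv ?_
  rw [legFr]; ring

theorem norm_one_add_ofReal_lt {x : ℝ} (hx : x ∈ Ioo (-1 : ℝ) 1) : ‖1 + (x : ℂ)‖ < 2 := by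
  have := norm_one_sub_ofReal_lt (x := -x) ⟨by linarith [hx.2], by linarith [hx.1]⟩
  rwa [Complex.ofReal_neg, sub_neg_eq_add] at this

theorem hasDerivAt_legF_real (ν : ℂ) {x : ℝ} (hx : x ∈ Ioo (-1 : ℝ) 1) :
    HasDerivAt (fun x : ℝ => legF ν x) (legD ν x / (1 - x ^ 2)) x :=
  (hasDerivAt_legF ν (norm_one_sub_ofReal_lt ⟨hx.1, hx.2.le⟩) (one_sub_sq_ne hx)).comp_ofReal

theorem hasDerivAt_legD_real (ν : ℂ) {x : ℝ} (hx : x ∈ Ioo (-1 : ℝ) 1) :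
    HasDerivAt (fun x : ℝ => legD ν x) (-(ν * (ν + 1)) * legF ν x) x :=
  (hasDerivAt_legD ν (norm_one_sub_ofReal_lt ⟨hx.1, hx.2.le⟩)).comp_ofReal

theorem hasDerivAt_legFr_real (ν : ℂ) {x : ℝ} (hx : x ∈ Ioo (-1 : ℝ) 1) :
    HasDerivAt (fun x : ℝ => legFr ν x) (legDr ν x / (1 - x ^ 2)) x :=
  (hasDerivAt_legFr ν (norm_one_add_ofReal_lt hx) (one_sub_sq_ne hx)).comp_ofReal

theorem hasDerivAt_legDr_real (ν : ℂ) {x : ℝ} (hx : x ∈ Ioo (-1 : ℝ) 1) :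
    HasDerivAt (fun x : ℝ => legDr ν x) (-(ν * (ν + 1)) * legFr ν x) x :=
  (hasDerivAt_legDr ν (norm_one_add_ofReal_lt hx)).comp_ofReal

theorem neg_mem_Ioo_one {x : ℝ} (hx : x ∈ Ioo (-1 : ℝ) 1) : -x ∈ Ioo (-1 : ℝ) 1 :=
  ⟨by linarith [hx.2], by linarith [hx.1]⟩

/-! ### Limits at the end points -/

theorem continuousAt_legF_one (ν : ℂ) : Tendsto (fun x : ℝ => legF ν x) (𝓝[<] 1) (𝓝 1) := by
  have h := (hasDerivAt_legF' ν (z := 1) (by simp)).continuousAt.tendsto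
  rw [legF_one] at h
  have h2 := (Complex.continuous_ofReal.tendsto (1 : ℝ)).mono_left
    (nhdsWithin_le_nhds (s := Iio (1 : ℝ)))
  rw [Complex.ofReal_one] at h2
  exact h.comp h2

theorem tendsto_legD_one (ν : ℂ) : Tendsto (fun x : ℝ => legD ν x) (𝓝[<] 1) (𝓝 0) := by
  have h := (hasDerivAt_legD ν (z := 1) (by simp)).continuousAt.tendsto
  rw [legD_one] at h
  have h2 := (Complex.continuous_ofReal.tendsto (1 : ℝ)).mono_left
    (nhdsWithin_le_nhds (s := Iio (1 : ℝ)))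
  rw [Complex.ofReal_one] at h2
  exact h.comp h2

theorem tendsto_neg_nhdsLT_one : Tendsto (fun x : ℝ => -x) (𝓝[<] 1) (𝓝[>] (-1)) :=
  tendsto_neg_nhdsLT

theorem tendsto_neg_nhdsGT_neg_one : Tendsto (fun x : ℝ => -x) (𝓝[>] (-1)) (𝓝[<] 1) := by
  simpa using tendsto_neg_nhdsGT (a := (-1 : ℝ))

theorem tendsto_legFr_neg_one (ν : ℂ) :
    Tendsto (fun x : ℝ => legFr ν x) (𝓝[>] (-1)) (𝓝 1) := by
  refine ((continuousAt_legF_one ν).comp tendsto_neg_nhdsGT_neg_one).congr fun x => ?_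
  simp [legFr]

theorem tendsto_legDr_neg_one (ν : ℂ) :
    Tendsto (fun x : ℝ => legDr ν x) (𝓝[>] (-1)) (𝓝 0) := by
  have := ((tendsto_legD_one ν).comp tendsto_neg_nhdsGT_neg_one).neg
  rw [neg_zero] at this
  refine this.congr fun x => ?_
  simp [legDr]

theorem tendsto_legDr_one (ν : ℂ) :
    Tendsto (fun x : ℝ => legDr ν x) (𝓝[<] 1) (𝓝 (-(2 * Complex.sin (π * ν) / π))) := by
  refine ((tendsto_legD_neg_one ν).comp tendsto_neg_nhdsLT_one).neg.congr fun x => ?_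
  simp [legDr]

theorem norm_legFr_le {ν : ℂ} {B : ℝ} (hB : ∀ x ∈ Ioo (-1 : ℝ) 1,
      ‖legF ν x‖ ≤ B * (1 + x) ^ (-(1 / 8) : ℝ) ∧ ‖legD ν x‖ ≤ B * (1 - x))
    {x : ℝ} (hx : x ∈ Ioo (-1 : ℝ) 1) :
    ‖legFr ν x‖ ≤ B * (1 - x) ^ (-(1 / 8) : ℝ) ∧ ‖legDr ν x‖ ≤ B * (1 + x) := by
  have := hB (-x) (neg_mem_Ioo_one hx)
  rw [Complex.ofReal_neg] at this
  rw [legFr, legDr, norm_neg]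
  simpa [sub_eq_add_neg] using this

theorem mul_rpow_neg_eighth {t : ℝ} (ht : 0 < t) : t * t ^ (-(1 / 8) : ℝ) = t ^ (7 / 8 : ℝ) := by
  nth_rewrite 1 [← Real.rpow_one t]
  rw [← Real.rpow_add ht]; norm_num

theorem tendsto_rpow_one_sub (r : ℝ) (hr : 0 < r) :
    Tendsto (fun x : ℝ => (1 - x) ^ r) (𝓝[<] 1) (𝓝 0) := by
  have h : ContinuousAt (fun x : ℝ => (1 - x) ^ r) 1 :=
    ContinuousAt.rpow_const (by fun_prop) (Or.inr hr.le)
  have := h.tendsto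
  simp only [sub_self, Real.zero_rpow hr.ne'] at this
  exact this.mono_left nhdsWithin_le_nhds

/-- The linear zero of the quasi-derivative at 1 beats the logarithmic growth of P_μ(-x) there. -/
theorem tendsto_legD_mul_legFr_one (ν μ : ℂ) :
    Tendsto (fun x : ℝ => legD ν x * legFr μ x) (𝓝[<] 1) (𝓝 0) := by
  obtain ⟨B, hB0, hB⟩ := exists_legendre_bound (max ‖ν‖ ‖μ‖)
  have h0 : Tendsto (fun x : ℝ => B * B * (1 - x) ^ (7 / 8 : ℝ)) (𝓝[<] 1) (𝓝 0) := by
    simpa using (tendsto_rpow_one_sub (7 / 8) (by norm_num)).const_mul (B * B)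
  refine squeeze_zero_norm' ?_ h0
  filter_upwards [Ioo_mem_nhdsLT (show (-1 : ℝ) < 1 by norm_num)] with x hx
  have h1 := (hB ν (le_max_left _ _) x hx).2
  have h2 := (norm_legFr_le (hB μ (le_max_right _ _)) hx).1
  have hx1 : 0 < 1 - x := by linarith [hx.2]
  rw [norm_mul]
  calc _ ≤ (B * (1 - x)) * (B * (1 - x) ^ (-(1 / 8) : ℝ)) := by gcongr
    _ = B * B * ((1 - x) * (1 - x) ^ (-(1 / 8) : ℝ)) := by ring
    _ = _ := by rw [mul_rpow_neg_eighth hx1]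

theorem tendsto_legF_mul_legDr_neg_one (ν μ : ℂ) :
    Tendsto (fun x : ℝ => legF ν x * legDr μ x) (𝓝[>] (-1)) (𝓝 0) := by
  have := ((tendsto_legD_mul_legFr_one μ ν).comp tendsto_neg_nhdsGT_neg_one).neg
  rw [neg_zero] at this
  refine this.congr fun x => ?_
  simp [legDr, legFr]; ring

/-! ### Wronskians of P_ν(x) and P_μ(-x) -/

theorem hasDerivAt_wronskian (ν μ : ℂ) {x : ℝ} (hx : x ∈ Ioo (-1 : ℝ) 1) :
    HasDerivAt (fun x : ℝ => legF ν x * legDr μ x - legD ν x * legFr μ x)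
      ((ν * (ν + 1) - μ * (μ + 1)) * (legF ν x * legFr μ x)) x := by
  refine (((hasDerivAt_legF_real ν hx).mul (hasDerivAt_legDr_real μ hx)).sub
    ((hasDerivAt_legD_real ν hx).mul (hasDerivAt_legFr_real μ hx))).congr_deriv ?_
  ring

/-- The value at 1 depends only on μ, the one at -1 only on ν. Their difference evaluates `legPair`,
and for μ = ν the two agree. -/
theorem tendsto_wronskian_one (ν μ : ℂ) :
    Tendsto (fun x : ℝ => legF ν x * legDr μ x - legD ν x * legFr μ x) (𝓝[<] 1)
      (𝓝 (-(2 * Complex.sin (π * μ) / π))) := by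
  simpa using ((continuousAt_legF_one ν).mul (tendsto_legDr_one μ)).sub
    (tendsto_legD_mul_legFr_one ν μ)

theorem tendsto_wronskian_neg_one (ν μ : ℂ) :
    Tendsto (fun x : ℝ => legF ν x * legDr μ x - legD ν x * legFr μ x) (𝓝[>] (-1))
      (𝓝 (-(2 * Complex.sin (π * ν) / π))) := by
  simpa using (tendsto_legF_mul_legDr_neg_one ν μ).sub
    ((tendsto_legD_neg_one ν).mul (tendsto_legFr_neg_one μ))

/-- The Wronskian of `P_ν(x)` and `P_ν(-x)`. -/
theorem wronskian_eq (ν : ℂ) {x : ℝ} (hx : x ∈ Ioo (-1 : ℝ) 1) :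
    legF ν x * legDr ν x - legD ν x * legFr ν x = -(2 * Complex.sin (π * ν) / π) := by
  refine tendsto_nhds_unique (tendsto_const_nhds.congr' ?_) (tendsto_wronskian_one ν ν)
  filter_upwards [Ioo_mem_nhdsLT (show (-1 : ℝ) < 1 by norm_num)] with y hy
  exact const_of_hasDerivAt_zero
    (f := fun x : ℝ => legF ν x * legDr ν x - legD ν x * legFr ν x) isOpen_Ioo isPreconnected_Ioo
    (fun z hz => by simpa using hasDerivAt_wronskian ν ν hz) hx hy

/-! ### Integrability -/

/-- On each half of the interval only one of the factors 1 + x, 1 - x is small, and 1 - x² is at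
least that factor. -/
theorem integrableOn_one_sub_sq_rpow {r : ℝ} (hr : r < 1) (hr0 : 0 ≤ r) :
    IntegrableOn (fun x : ℝ => (1 - x ^ 2) ^ (-r)) (Ioo (-1) 1) := by
  have h1 : IntegrableOn (fun x : ℝ => (1 + x) ^ (-r)) (Ioo (-1) 1) := by
    have := (intervalIntegral.intervalIntegrable_rpow' (a := 0) (b := 2)
      (r := -r) (by linarith)).comp_add_left 1
    norm_num at this
    rwa [intervalIntegrable_iff_integrableOn_Ioo_of_le (by norm_num)] at this
  have h2 : IntegrableOn (fun x : ℝ => (1 - x) ^ (-r)) (Ioo (-1) 1) := by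
    have := (intervalIntegral.intervalIntegrable_rpow' (a := 2) (b := 0)
      (r := -r) (by linarith)).comp_sub_left 1
    norm_num at this
    rwa [intervalIntegrable_iff_integrableOn_Ioo_of_le (by norm_num)] at this
  refine Integrable.mono' (h1.add h2) ?_ ?_
  · refine ContinuousOn.aestronglyMeasurable (fun x hx => ?_) measurableSet_Ioo
    have hc : ContinuousAt (fun x : ℝ => 1 - x ^ 2) x := by fun_prop
    exact (hc.rpow_const (Or.inl (one_sub_sq_pos hx).ne')).continuousWithinAt
  · refine (ae_restrict_iff' measurableSet_Ioo).2 (Eventually.of_forall fun x hx => ?_)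
    have hx1 : 0 < 1 - x := by linarith [hx.2]
    have hx2 : 0 < 1 + x := by linarith [hx.1]
    have hp := one_sub_sq_pos hx
    rw [Real.norm_eq_abs, abs_of_nonneg (Real.rpow_nonneg hp.le _)]
    simp only [Pi.add_apply]
    rcases le_total 0 x with h | h
    · have : (1 - x ^ 2) ^ (-r) ≤ (1 - x) ^ (-r) :=
        Real.rpow_le_rpow_of_nonpos hx1 (by nlinarith) (by linarith)
      linarith [Real.rpow_nonneg hx2.le (-r)]
    · have : (1 - x ^ 2) ^ (-r) ≤ (1 + x) ^ (-r) :=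
        Real.rpow_le_rpow_of_nonpos hx2 (by nlinarith) (by linarith)
      linarith [Real.rpow_nonneg hx1.le (-r)]

theorem one_sub_sq_rpow {x : ℝ} (hx : x ∈ Ioo (-1 : ℝ) 1) (r : ℝ) :
    (1 - x ^ 2) ^ r = (1 + x) ^ r * (1 - x) ^ r := by
  rw [← Real.mul_rpow (by linarith [hx.1]) (by linarith [hx.2])]
  congr 1; ring

theorem norm_legF_mul_legFr_le {ν μ : ℂ} {B : ℝ} (hB0 : 0 ≤ B)
    (hB : ∀ x ∈ Ioo (-1 : ℝ) 1,
      ‖legF ν x‖ ≤ B * (1 + x) ^ (-(1 / 8) : ℝ) ∧ ‖legD ν x‖ ≤ B * (1 - x))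
    (hB' : ∀ x ∈ Ioo (-1 : ℝ) 1,
      ‖legF μ x‖ ≤ B * (1 + x) ^ (-(1 / 8) : ℝ) ∧ ‖legD μ x‖ ≤ B * (1 - x))
    {x : ℝ} (hx : x ∈ Ioo (-1 : ℝ) 1) :
    ‖legF ν x * legFr μ x‖ ≤ B ^ 2 * (1 - x ^ 2) ^ (-(1 / 8) : ℝ) := by
  have hx2 : 0 < 1 + x := by linarith [hx.1]
  rw [norm_mul, one_sub_sq_rpow hx]
  calc _ ≤ (B * (1 + x) ^ (-(1 / 8) : ℝ)) * (B * (1 - x) ^ (-(1 / 8) : ℝ)) := by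
        gcongr
        · exact (hB x hx).1
        · exact (norm_legFr_le hB' hx).1
    _ = _ := by ring

theorem continuousOn_legF_real (ν : ℂ) : ContinuousOn (fun x : ℝ => legF ν x) (Ioo (-1) 1) :=
  fun _ hx => (hasDerivAt_legF_real ν hx).continuousAt.continuousWithinAt

theorem continuousOn_legFr_real (ν : ℂ) : ContinuousOn (fun x : ℝ => legFr ν x) (Ioo (-1) 1) :=
  fun _ hx => (hasDerivAt_legFr_real ν hx).continuousAt.continuousWithinAt

theorem integrableOn_of_norm_le {φ : ℝ → ℂ} (hφ : ContinuousOn φ (Ioo (-1) 1)) {C r : ℝ}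
    (hr : r < 1) (hr0 : 0 ≤ r) (h : ∀ x ∈ Ioo (-1 : ℝ) 1, ‖φ x‖ ≤ C * (1 - x ^ 2) ^ (-r)) :
    IntegrableOn φ (Ioo (-1) 1) :=
  Integrable.mono' ((integrableOn_one_sub_sq_rpow hr hr0).const_mul C)
    (hφ.aestronglyMeasurable measurableSet_Ioo)
    ((ae_restrict_iff' measurableSet_Ioo).2 (Eventually.of_forall h))

theorem integrableOn_legF_mul_legFr (ν μ : ℂ) :
    IntegrableOn (fun x : ℝ => legF ν x * legFr μ x) (Ioo (-1) 1) := by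
  obtain ⟨B, hB0, hB⟩ := exists_legendre_bound (max ‖ν‖ ‖μ‖)
  exact integrableOn_of_norm_le ((continuousOn_legF_real ν).mul (continuousOn_legFr_real μ))
    (by norm_num) (by norm_num) fun x hx =>
      norm_legF_mul_legFr_le hB0 (hB ν (le_max_left _ _)) (hB μ (le_max_right _ _)) hx

theorem setIntegral_Ioo_eq_sub_of_tendsto {f f' : ℝ → ℂ} {fa fb : ℂ}
    (hd : ∀ x ∈ Ioo (-1 : ℝ) 1, HasDerivAt f (f' x) x) (hint : IntegrableOn f' (Ioo (-1) 1))
    (ha : Tendsto f (𝓝[>] (-1)) (𝓝 fa)) (hb : Tendsto f (𝓝[<] 1) (𝓝 fb)) :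
    ∫ x in Ioo (-1 : ℝ) 1, f' x = fb - fa := by
  rw [← integral_Ioc_eq_integral_Ioo, ← intervalIntegral.integral_of_le (by norm_num)]
  exact intervalIntegral.integral_eq_sub_of_hasDerivAt_of_tendsto (by norm_num) hd
    ((intervalIntegrable_iff_integrableOn_Ioo_of_le (by norm_num)).2 hint) ha hb

/-! ### Evaluation of the pairing of P_ν(x) with P_μ(-x) -/

/-- The integral of `P_ν(x) P_μ(-x)`. -/
@[irreducible] noncomputable def legPair (ν μ : ℂ) : ℂ := ∫ x in Ioo (-1 : ℝ) 1, legF ν x * legFr μ x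

/-- Green's identity: the derivative of the mixed Wronskian is the integrand times the difference of
eigenvalues. -/
theorem legPair_mul (ν μ : ℂ) :
    (ν * (ν + 1) - μ * (μ + 1)) * legPair ν μ =
      2 / π * (Complex.sin (π * ν) - Complex.sin (π * μ)) := by
  have := setIntegral_Ioo_eq_sub_of_tendsto (fun x hx => hasDerivAt_wronskian ν μ hx)
    ((integrableOn_legF_mul_legFr ν μ).const_mul _) (tendsto_wronskian_neg_one ν μ)
    (tendsto_wronskian_one ν μ)
  rw [integral_const_mul] at this
  rw [legPair, this]
  ring

/-- Each coefficient is polynomial in ν and bounded by 1 + K on a disc of degrees, so the series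
converges uniformly in ν there. -/
theorem continuous_legF_degree {x : ℝ} (hx : x ∈ Ioo (-1 : ℝ) 1) :
    Continuous fun ν : ℂ => legF ν x := by
  rw [continuous_iff_continuousAt]
  intro ν₀
  obtain ⟨K, hK0, hK⟩ := exists_norm_derivCoeff_le (‖ν₀‖ + 1)
  have e : (1 - (x : ℂ)) / 2 = (((1 - x) / 2 : ℝ) : ℂ) := by push_cast; ring
  have h0 : 0 ≤ (1 - x) / 2 := by linarith [hx.2]
  have h1 : (1 - x) / 2 < 1 := by linarith [hx.1]
  have hc : ContinuousOn (fun ν : ℂ => legF ν x) (Metric.ball 0 (‖ν₀‖ + 1)) := by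
    simp only [legF, powSum]
    refine continuousOn_tsum (u := fun n => (1 + K) * ((1 - x) / 2) ^ n) (fun n => ?_)
      ((summable_geometric_of_lt_one h0 h1).mul_left _) fun n ν hν => ?_
    · refine Continuous.continuousOn ?_
      refine Continuous.mul ?_ continuous_const
      simp only [gaussCoeff]
      fun_prop
    · rw [e, norm_mul, norm_pow, Complex.norm_real, Real.norm_eq_abs, abs_of_nonneg h0]
      gcongr
      rcases n with _ | n
      · rw [gaussCoeff_zero, norm_one]; linarith
      · have := hK ν (mem_ball_zero_iff.1 hν).le n
        have hn1 : ‖(n : ℂ) + 1‖ = n + 1 := by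
          rw [← Nat.cast_succ, Complex.norm_natCast]; push_cast; rfl
        rw [derivCoeff, norm_mul, hn1] at this
        nlinarith [norm_nonneg (gaussCoeff ν 1 (n + 1)), (Nat.cast_nonneg n : (0 : ℝ) ≤ n)]
  exact hc.continuousAt (Metric.isOpen_ball.mem_nhds (mem_ball_zero_iff.2 (by linarith)))

theorem continuous_legPair : Continuous fun p : ℂ × ℂ => legPair p.1 p.2 := by
  rw [continuous_iff_continuousAt]
  intro p₀
  obtain ⟨B, hB0, hB⟩ := exists_legendre_bound (‖p₀‖ + 1)
  have hmem : ∀ᶠ p : ℂ × ℂ in 𝓝 p₀, ‖p‖ < ‖p₀‖ + 1 :=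
    continuous_norm.continuousAt.eventually_lt continuousAt_const (by linarith)
  simp only [ContinuousAt, legPair]
  refine tendsto_integral_filter_of_dominated_convergence
    (fun x : ℝ => B ^ 2 * (1 - x ^ 2) ^ (-(1 / 8) : ℝ)) ?_ ?_
    ((integrableOn_one_sub_sq_rpow (by norm_num) (by norm_num)).const_mul _) ?_
  · exact Eventually.of_forall fun p => (integrableOn_legF_mul_legFr p.1 p.2).1
  · filter_upwards [hmem] with p hp
    refine (ae_restrict_iff' measurableSet_Ioo).2 (Eventually.of_forall fun x hx => ?_)
    exact norm_legF_mul_legFr_le hB0 (hB _ ((norm_fst_le p).trans hp.le))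
      (hB _ ((norm_snd_le p).trans hp.le)) hx
  · refine (ae_restrict_iff' measurableSet_Ioo).2 (Eventually.of_forall fun x hx => ?_)
    have h1 := (continuous_legF_degree hx).comp (continuous_fst (X := ℂ) (Y := ℂ))
    have h2 := (continuous_legF_degree (neg_mem_Ioo_one hx)).comp (continuous_snd (X := ℂ) (Y := ℂ))
    have h3 := (h1.mul h2).tendsto p₀
    simp only [legFr, ← Complex.ofReal_neg]
    exact h3

theorem continuous_legPair_comp {u v : ℂ → ℂ} (hu : Continuous u) (hv : Continuous v) :
    Continuous fun z => legPair (u z) (v z) :=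
  continuous_legPair.comp (hu.prodMk hv)

/-- The difference of eigenvalues factors as (ν - μ)(ν + μ + 1). Dividing `legPair_mul` by μ - ν and
letting μ → ν differentiates the sine. -/
theorem legPair_self_mul (ν : ℂ) : (2 * ν + 1) * legPair ν ν = 2 * Complex.cos (π * ν) := by
  have hpi : (π : ℂ) ≠ 0 := by exact_mod_cast Real.pi_ne_zero
  have h1 : Tendsto (fun μ : ℂ => (ν + μ + 1) * legPair ν μ) (𝓝[≠] ν)
      (𝓝 ((ν + ν + 1) * legPair ν ν)) := by
    have h := continuous_legPair_comp (continuous_const (y := ν)) continuous_id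
    have h' : Continuous fun μ : ℂ => ν + μ + 1 := by fun_prop
    exact ((h'.mul h).tendsto ν).mono_left nhdsWithin_le_nhds
  have hd : HasDerivAt (fun μ : ℂ => Complex.sin (π * μ)) (Complex.cos (π * ν) * π) ν := by
    have h := (hasDerivAt_id ν).const_mul (π : ℂ)
    rw [mul_one] at h
    exact (Complex.hasDerivAt_sin _).comp _ h
  have h2 := (hasDerivAt_iff_tendsto_slope.1 hd).const_mul (2 / π : ℂ)
  have h3 := tendsto_nhds_unique (h2.congr' ?_) h1
  · rw [← two_mul] at h3
    rw [← h3]; field_simp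
  · filter_upwards [self_mem_nhdsWithin] with μ hμ
    have hne : μ - ν ≠ 0 := sub_ne_zero.2 hμ
    have := legPair_mul ν μ
    rw [slope_def_field, ← mul_div_assoc, div_eq_iff hne]
    linear_combination this

/-- At ν = -1/2 both sides of `legPair_self_mul` vanish, so continuity is used once more and the
value is the derivative of cos(πν) there. -/
theorem legPair_neg_half : legPair (-1 / 2) (-1 / 2) = π := by
  have h1 : Tendsto (fun ν : ℂ => legPair ν ν) (𝓝[≠] (-1 / 2)) (𝓝 (legPair (-1 / 2) (-1 / 2))) :=
    ((continuous_legPair_comp continuous_id continuous_id).tendsto (-1 / 2)).mono_left nhdsWithin_le_nhds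
  have hd : HasDerivAt (fun μ : ℂ => Complex.cos (π * μ)) (-Complex.sin (π * (-1 / 2)) * π)
      (-1 / 2) := by
    have h := (hasDerivAt_id (-1 / 2 : ℂ)).const_mul (π : ℂ)
    rw [mul_one] at h
    exact (Complex.hasDerivAt_cos _).comp _ h
  have e : (π : ℂ) * (-1 / 2) = -(π / 2) := by ring
  rw [e, Complex.sin_neg, Complex.sin_pi_div_two, neg_neg, one_mul] at hd
  refine tendsto_nhds_unique h1 ((hasDerivAt_iff_tendsto_slope.1 hd).congr' ?_)
  filter_upwards [self_mem_nhdsWithin] with μ hμ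
  have hne : μ - -1 / 2 ≠ 0 := sub_ne_zero.2 hμ
  rw [slope_def_field, div_eq_iff hne, e, Complex.cos_neg, Complex.cos_pi_div_two, sub_zero]
  linear_combination -(1 / 2) * legPair_self_mul μ

/-! ### Cauchy transforms -/

/-- The Cauchy transform of a function on `(-1, 1)`. -/
noncomputable def cauchyT (φ : ℝ → ℂ) (z : ℂ) : ℂ := ∫ ξ in Ioo (-1 : ℝ) 1, φ ξ / (z - ξ)

theorem im_le_norm_sub_ofReal (z : ℂ) (ξ : ℝ) : z.im ≤ ‖z - ξ‖ := by
  have := Complex.abs_im_le_norm (z - ξ)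
  simp only [Complex.sub_im, Complex.ofReal_im, sub_zero] at this
  exact (le_abs_self _).trans this

theorem sub_ofReal_ne_zero {z : ℂ} (hz : 0 < z.im) (ξ : ℝ) : z - ξ ≠ 0 :=
  norm_pos_iff.1 (hz.trans_le (im_le_norm_sub_ofReal z ξ))

theorem integrableOn_mul_of_bounded {φ k : ℝ → ℂ} {s : Set ℝ} (hφ : IntegrableOn φ s)
    (hk : Continuous k) {C : ℝ} (hC : ∀ ξ, ‖k ξ‖ ≤ C) : IntegrableOn (fun ξ => φ ξ * k ξ) s :=
  hφ.mul_bdd (c := C) hk.aestronglyMeasurable (Eventually.of_forall hC)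

theorem continuous_inv_sub_ofReal {z : ℂ} (hz : 0 < z.im) :
    Continuous fun ξ : ℝ => (z - ξ)⁻¹ :=
  (by fun_prop : Continuous fun ξ : ℝ => z - (ξ : ℂ)).inv₀ fun ξ => sub_ofReal_ne_zero hz ξ

theorem norm_inv_sub_ofReal_le {z : ℂ} (hz : 0 < z.im) (ξ : ℝ) : ‖(z - ξ)⁻¹‖ ≤ z.im⁻¹ := by
  rw [norm_inv]
  exact inv_anti₀ hz (im_le_norm_sub_ofReal z ξ)

theorem integrableOn_div_sub {φ : ℝ → ℂ} (hφ : IntegrableOn φ (Ioo (-1) 1)) {z : ℂ}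
    (hz : 0 < z.im) : IntegrableOn (fun ξ : ℝ => φ ξ / (z - ξ)) (Ioo (-1) 1) := by
  simp only [div_eq_mul_inv]
  exact integrableOn_mul_of_bounded hφ (continuous_inv_sub_ofReal hz) (norm_inv_sub_ofReal_le hz)

theorem integrableOn_div_sub_sq {φ : ℝ → ℂ} (hφ : IntegrableOn φ (Ioo (-1) 1)) {z : ℂ}
    (hz : 0 < z.im) : IntegrableOn (fun ξ : ℝ => φ ξ / (z - ξ) ^ 2) (Ioo (-1) 1) := by
  simp only [div_eq_mul_inv, ← inv_pow]
  refine integrableOn_mul_of_bounded hφ ((continuous_inv_sub_ofReal hz).pow 2)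
    (C := z.im⁻¹ ^ 2) fun ξ => ?_
  rw [norm_pow]
  have := norm_inv_sub_ofReal_le hz ξ
  gcongr

theorem hasDerivAt_cauchyT {φ : ℝ → ℂ} (hφ : IntegrableOn φ (Ioo (-1) 1)) {z : ℂ}
    (hz : 0 < z.im) :
    HasDerivAt (cauchyT φ) (∫ ξ in Ioo (-1 : ℝ) 1, -(φ ξ / (z - ξ) ^ 2)) z := by
  -- On this half-plane the distance to the real axis is at least half that of z, which bounds the
  -- differentiated kernel uniformly.
  set s : Set ℂ := {w | z.im / 2 < w.im} with hs
  have hso : IsOpen s := isOpen_lt continuous_const Complex.continuous_im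
  have hzs : z ∈ s := by simp only [hs, mem_ofPred_eq]; linarith
  have hpos : ∀ w ∈ s, 0 < w.im := fun w hw => by
    have : z.im / 2 < w.im := hw
    linarith
  refine (hasDerivAt_integral_of_dominated_loc_of_deriv_le (μ := volume.restrict (Ioo (-1) 1))
    (F := fun w (ξ : ℝ) => φ ξ / (w - ξ)) (F' := fun w (ξ : ℝ) => -(φ ξ / (w - ξ) ^ 2))
    (bound := fun ξ => ‖φ ξ‖ * ((z.im / 2)⁻¹) ^ 2) (hso.mem_nhds hzs) ?_
    (integrableOn_div_sub hφ hz) ((integrableOn_div_sub_sq hφ hz).neg).1 ?_ ?_ ?_).2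
  · filter_upwards [hso.mem_nhds hzs] with w hw
    exact (integrableOn_div_sub hφ (hpos w hw)).1
  · refine Eventually.of_forall fun ξ w hw => ?_
    rw [norm_neg, div_eq_mul_inv, norm_mul, ← inv_pow, norm_pow]
    have h1 := norm_inv_sub_ofReal_le (hpos w hw) ξ
    have h2 : w.im⁻¹ ≤ (z.im / 2)⁻¹ := inv_anti₀ (by linarith) (le_of_lt hw)
    gcongr
    exact h1.trans h2
  · exact hφ.norm.mul_const _
  · refine Eventually.of_forall fun ξ w hw => ?_
    have hne := sub_ofReal_ne_zero (hpos w hw) ξ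
    have h1 := ((hasDerivAt_id w).sub_const (ξ : ℂ)).inv hne
    have h2 := h1.const_mul (φ ξ)
    refine (h2.congr_deriv ?_)
    simp only [id]
    ring

theorem hasDerivAt_inv_sub_ofReal {z : ℂ} (hz : 0 < z.im) (ξ : ℝ) :
    HasDerivAt (fun ξ : ℝ => (z - ξ)⁻¹) (1 / (z - ξ) ^ 2) ξ := by
  have h0 : HasDerivAt (fun ξ : ℝ => z - (ξ : ℂ)) (-1) ξ := by
    simpa using (Complex.ofRealCLM.hasDerivAt (x := ξ)).const_sub z
  have := h0.inv (sub_ofReal_ne_zero hz ξ)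
  refine this.congr_deriv ?_
  rw [neg_neg]

theorem tendsto_mul_inv_sub {φ : ℝ → ℂ} {l : Filter ℝ} {a : ℝ} (hl : l ≤ 𝓝 a)
    (h : Tendsto φ l (𝓝 0)) {z : ℂ} (hz : 0 < z.im) :
    Tendsto (fun ξ : ℝ => φ ξ * (z - ξ)⁻¹) l (𝓝 0) := by
  simpa using h.mul (((continuous_inv_sub_ofReal hz).tendsto a).mono_left hl)

/-- Integration by parts for the Cauchy transform. -/
theorem cauchyT_deriv_eq {φ φ' : ℝ → ℂ} (hφ : IntegrableOn φ (Ioo (-1) 1))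
    (hφ' : IntegrableOn φ' (Ioo (-1) 1)) (hd : ∀ x ∈ Ioo (-1 : ℝ) 1, HasDerivAt φ (φ' x) x)
    (h1 : Tendsto φ (𝓝[<] 1) (𝓝 0)) (h2 : Tendsto φ (𝓝[>] (-1)) (𝓝 0)) {z : ℂ} (hz : 0 < z.im) :
    ∫ ξ in Ioo (-1 : ℝ) 1, -(φ ξ / (z - ξ) ^ 2) = cauchyT φ' z := by
  have hi := (integrableOn_div_sub hφ' hz).add (integrableOn_div_sub_sq hφ hz)
  have := setIntegral_Ioo_eq_sub_of_tendsto (f := fun ξ : ℝ => φ ξ * (z - ξ)⁻¹)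
    (fun x hx => ((hd x hx).mul (hasDerivAt_inv_sub_ofReal hz x)).congr_deriv
      (by simp only [Pi.add_apply]; ring)) hi
    (tendsto_mul_inv_sub nhdsWithin_le_nhds h2 hz) (tendsto_mul_inv_sub nhdsWithin_le_nhds h1 hz)
  simp only [Pi.add_apply] at this
  rw [integral_add (integrableOn_div_sub hφ' hz) (integrableOn_div_sub_sq hφ hz), sub_zero] at this
  rw [integral_neg, cauchyT]
  linear_combination -this

/-- Integration by parts for the Cauchy transform, with the weight `1 - x ^ 2`. -/
theorem one_sub_sq_mul_cauchyT_deriv {φ ψ : ℝ → ℂ} (hφ : IntegrableOn φ (Ioo (-1) 1))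
    (hψ : IntegrableOn ψ (Ioo (-1) 1))
    (hd : ∀ x ∈ Ioo (-1 : ℝ) 1, HasDerivAt φ (ψ x / (1 - x ^ 2)) x)
    (h1 : Tendsto (fun x : ℝ => (1 - (x : ℂ) ^ 2) * φ x) (𝓝[<] 1) (𝓝 0))
    (h2 : Tendsto (fun x : ℝ => (1 - (x : ℂ) ^ 2) * φ x) (𝓝[>] (-1)) (𝓝 0))
    {z : ℂ} (hz : 0 < z.im) :
    (1 - z ^ 2) * ∫ ξ in Ioo (-1 : ℝ) 1, -(φ ξ / (z - ξ) ^ 2) =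
      cauchyT ψ z + ∫ ξ in Ioo (-1 : ℝ) 1, φ ξ := by
  have hi := (((integrableOn_div_sub_sq hφ hz).const_mul (1 - z ^ 2)).add
    (integrableOn_div_sub hψ hz)).add hφ
  have hp : ∀ x : ℝ, HasDerivAt (fun x : ℝ => (1 : ℂ) - (x : ℂ) ^ 2) (-(2 * (x : ℂ))) x := by
    intro x
    have := ((hasDerivAt_pow 2 (x : ℂ)).const_sub 1).comp_ofReal
    simpa using this
  have := setIntegral_Ioo_eq_sub_of_tendsto
    (f := fun ξ : ℝ => (1 - (ξ : ℂ) ^ 2) * φ ξ * (z - ξ)⁻¹)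
    (fun x hx => (((hp x).mul (hd x hx)).mul (hasDerivAt_inv_sub_ofReal hz x)).congr_deriv
      (by
        have n1 := one_sub_sq_ne hx
        have n2 := sub_ofReal_ne_zero hz x
        simp only [Pi.add_apply, Pi.mul_apply]
        field_simp
        ring)) hi
    (tendsto_mul_inv_sub nhdsWithin_le_nhds h2 hz) (tendsto_mul_inv_sub nhdsWithin_le_nhds h1 hz)
  simp only [Pi.add_apply] at this
  have i1 := (integrableOn_div_sub_sq hφ hz).const_mul (1 - z ^ 2)
  have i12 : IntegrableOn (fun ξ : ℝ => (1 - z ^ 2) * (φ ξ / (z - ξ) ^ 2) + ψ ξ / (z - ξ))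
      (Ioo (-1) 1) := i1.add (integrableOn_div_sub hψ hz)
  rw [integral_add i12 hφ, integral_add i1 (integrableOn_div_sub hψ hz), integral_const_mul,
    sub_zero] at this
  rw [integral_neg, cauchyT]
  linear_combination -this

theorem setIntegral_odd_eq_zero {φ : ℝ → ℂ} (h : ∀ x ∈ Ioo (-1 : ℝ) 1, φ (-x) = -φ x) :
    ∫ x in Ioo (-1 : ℝ) 1, φ x = 0 := by
  have e : ∫ x in Ioo (-1 : ℝ) 1, φ (-x) = ∫ x in Ioo (-1 : ℝ) 1, φ x := by
    rw [← integral_Ioc_eq_integral_Ioo, ← integral_Ioc_eq_integral_Ioo,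
      ← intervalIntegral.integral_of_le (by norm_num),
      ← intervalIntegral.integral_of_le (by norm_num), intervalIntegral.integral_comp_neg]
    norm_num
  have e2 : ∫ x in Ioo (-1 : ℝ) 1, φ (-x) = -∫ x in Ioo (-1 : ℝ) 1, φ x := by
    rw [← integral_neg]
    exact setIntegral_congr_fun measurableSet_Ioo h
  rw [e2] at e
  have : (2 : ℂ) * ∫ x in Ioo (-1 : ℝ) 1, φ x = 0 := by linear_combination -e
  simpa using this

theorem tendsto_zero_of_norm_le_rpow {φ : ℝ → ℂ} {C r : ℝ} (hr : 0 < r)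
    (h : ∀ x ∈ Ioo (-1 : ℝ) 1, ‖φ x‖ ≤ C * (1 - x ^ 2) ^ r) :
    Tendsto φ (𝓝[<] 1) (𝓝 0) ∧ Tendsto φ (𝓝[>] (-1)) (𝓝 0) := by
  have hc : Continuous fun x : ℝ => C * (1 - x ^ 2) ^ r :=
    ((by fun_prop : Continuous fun x : ℝ => 1 - x ^ 2).rpow_const fun _ => Or.inr hr.le).const_mul C
  have e1 : (1 : ℝ) - 1 ^ 2 = 0 := by norm_num
  have e2 : (1 : ℝ) - (-1) ^ 2 = 0 := by norm_num
  constructor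
  · refine squeeze_zero_norm' (a := fun x : ℝ => C * (1 - x ^ 2) ^ r) ?_ ?_
    · filter_upwards [Ioo_mem_nhdsLT (show (-1 : ℝ) < 1 by norm_num)] using h
    · have := (hc.tendsto 1).mono_left (nhdsWithin_le_nhds (s := Iio 1))
      rwa [e1, Real.zero_rpow hr.ne', mul_zero] at this
  · refine squeeze_zero_norm' (a := fun x : ℝ => C * (1 - x ^ 2) ^ r) ?_ ?_
    · filter_upwards [Ioo_mem_nhdsGT (show (-1 : ℝ) < 1 by norm_num)] using h
    · have := (hc.tendsto (-1)).mono_left (nhdsWithin_le_nhds (s := Ioi (-1)))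
      rwa [e2, Real.zero_rpow hr.ne', mul_zero] at this

/-! ### The products of `P_ν(x)` and `P_ν(-x)` -/

/-- The product `P_ν(x) P_ν(-x)`. -/
noncomputable def prodH (ν : ℂ) (x : ℝ) : ℂ := legF ν x * legFr ν x

/-- The quasi-derivative of `prodH`. -/
noncomputable def prodH1 (ν : ℂ) (x : ℝ) : ℂ := legF ν x * legDr ν x + legD ν x * legFr ν x

/-- The product of the quasi-derivatives of `P_ν(x)` and `P_ν(-x)`. -/
noncomputable def prodH2 (ν : ℂ) (x : ℝ) : ℂ := legD ν x * legDr ν x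

theorem prodH_neg (ν : ℂ) (x : ℝ) : prodH ν (-x) = prodH ν x := by
  simp only [prodH, legFr, Complex.ofReal_neg, neg_neg]; ring

theorem prodH1_neg (ν : ℂ) (x : ℝ) : prodH1 ν (-x) = -prodH1 ν x := by
  simp only [prodH1, legFr, legDr, Complex.ofReal_neg, neg_neg]; ring

theorem prodH2_neg (ν : ℂ) (x : ℝ) : prodH2 ν (-x) = prodH2 ν x := by
  simp only [prodH2, legDr, Complex.ofReal_neg, neg_neg]; ring

theorem hasDerivAt_prodH (ν : ℂ) {x : ℝ} (hx : x ∈ Ioo (-1 : ℝ) 1) :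
    HasDerivAt (prodH ν) (prodH1 ν x / (1 - x ^ 2)) x := by
  refine ((hasDerivAt_legF_real ν hx).mul (hasDerivAt_legFr_real ν hx)).congr_deriv ?_
  rw [prodH1]; ring

theorem hasDerivAt_prodH1 (ν : ℂ) {x : ℝ} (hx : x ∈ Ioo (-1 : ℝ) 1) :
    HasDerivAt (prodH1 ν)
      ((2 * prodH2 ν x - 2 * (ν * (ν + 1)) * ((1 - (x : ℂ) ^ 2) * prodH ν x)) / (1 - x ^ 2)) x := by
  refine (((hasDerivAt_legF_real ν hx).mul (hasDerivAt_legDr_real ν hx)).add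
    ((hasDerivAt_legD_real ν hx).mul (hasDerivAt_legFr_real ν hx))).congr_deriv ?_
  have := one_sub_sq_ne hx
  rw [prodH2, prodH]
  field_simp
  ring

theorem hasDerivAt_prodH2 (ν : ℂ) {x : ℝ} (hx : x ∈ Ioo (-1 : ℝ) 1) :
    HasDerivAt (prodH2 ν) (-(ν * (ν + 1)) * prodH1 ν x) x := by
  refine ((hasDerivAt_legD_real ν hx).mul (hasDerivAt_legDr_real ν hx)).congr_deriv ?_
  rw [prodH1]; ring

/-- In each mixed product the factor with a logarithm is paired with a quasi-derivative vanishing at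
the same end, so `prodH1` is bounded and `prodH2` vanishes linearly at both ends. -/
theorem exists_prod_bound (ν : ℂ) : ∃ B : ℝ, 0 ≤ B ∧ ∀ x ∈ Ioo (-1 : ℝ) 1,
    ‖prodH ν x‖ ≤ B * (1 - x ^ 2) ^ (-(1 / 8) : ℝ) ∧ ‖prodH1 ν x‖ ≤ B ∧
      ‖prodH2 ν x‖ ≤ B * (1 - x ^ 2) := by
  obtain ⟨B, hB0, hB⟩ := exists_legendre_bound ‖ν‖
  replace hB := hB ν le_rfl
  refine ⟨4 * B ^ 2, by positivity, fun x hx => ?_⟩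
  have h1 := hB x hx
  have h2 := norm_legFr_le hB hx
  have hp := one_sub_sq_pos hx
  have hx1 : 0 < 1 - x := by linarith [hx.2]
  have hx2 : 0 < 1 + x := by linarith [hx.1]
  have hsmall : ∀ t : ℝ, 0 < t → t ≤ 2 → t ^ (7 / 8 : ℝ) ≤ 2 := fun t h0 h2 => by
    calc t ^ (7 / 8 : ℝ) ≤ 2 ^ (7 / 8 : ℝ) := by gcongr
      _ ≤ 2 ^ (1 : ℝ) := Real.rpow_le_rpow_of_exponent_le (by norm_num) (by norm_num)
      _ = 2 := Real.rpow_one 2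
  refine ⟨?_, ?_, ?_⟩
  · refine (norm_legF_mul_legFr_le hB0 hB hB hx).trans ?_
    have := Real.rpow_nonneg hp.le (-(1 / 8))
    nlinarith [sq_nonneg B, mul_nonneg (sq_nonneg B) this]
  · refine (norm_add_le _ _).trans ?_
    rw [norm_mul, norm_mul]
    calc _ ≤ (B * (1 + x) ^ (-(1 / 8) : ℝ)) * (B * (1 + x)) +
          (B * (1 - x)) * (B * (1 - x) ^ (-(1 / 8) : ℝ)) := by
          gcongr
          · exact h1.1
          · exact h2.2
          · exact h1.2
          · exact h2.1
      _ = B ^ 2 * ((1 + x) * (1 + x) ^ (-(1 / 8) : ℝ)) +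
          B ^ 2 * ((1 - x) * (1 - x) ^ (-(1 / 8) : ℝ)) := by ring
      _ ≤ B ^ 2 * 2 + B ^ 2 * 2 := by
          rw [mul_rpow_neg_eighth hx1, mul_rpow_neg_eighth hx2]
          gcongr
          · exact hsmall _ hx2 (by linarith [hx.2])
          · exact hsmall _ hx1 (by linarith [hx.1])
      _ = _ := by ring
  · rw [prodH2, norm_mul]
    calc _ ≤ (B * (1 - x)) * (B * (1 + x)) := by
          gcongr
          · exact h1.2
          · exact h2.2
      _ = B ^ 2 * (1 - x ^ 2) := by ring
      _ ≤ _ := by nlinarith [sq_nonneg B, mul_nonneg (sq_nonneg B) hp.le]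

theorem continuousOn_prodH (ν : ℂ) : ContinuousOn (prodH ν) (Ioo (-1) 1) :=
  fun _ hx => (hasDerivAt_prodH ν hx).continuousAt.continuousWithinAt

theorem continuousOn_prodH1 (ν : ℂ) : ContinuousOn (prodH1 ν) (Ioo (-1) 1) :=
  fun _ hx => (hasDerivAt_prodH1 ν hx).continuousAt.continuousWithinAt

theorem continuousOn_prodH2 (ν : ℂ) : ContinuousOn (prodH2 ν) (Ioo (-1) 1) :=
  fun _ hx => (hasDerivAt_prodH2 ν hx).continuousAt.continuousWithinAt

theorem integrableOn_of_bounded {φ : ℝ → ℂ} (hφ : ContinuousOn φ (Ioo (-1) 1)) {C : ℝ}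
    (h : ∀ x ∈ Ioo (-1 : ℝ) 1, ‖φ x‖ ≤ C) : IntegrableOn φ (Ioo (-1) 1) :=
  integrableOn_of_norm_le hφ (r := 0) (by norm_num) le_rfl fun x hx => by simpa using h x hx

theorem integrableOn_prodH (ν : ℂ) : IntegrableOn (prodH ν) (Ioo (-1) 1) :=
  integrableOn_legF_mul_legFr ν ν

theorem integrableOn_prodH1 (ν : ℂ) : IntegrableOn (prodH1 ν) (Ioo (-1) 1) := by
  obtain ⟨B, hB0, hB⟩ := exists_prod_bound ν
  exact integrableOn_of_bounded (continuousOn_prodH1 ν) fun x hx => (hB x hx).2.1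

theorem integrableOn_prodH2 (ν : ℂ) : IntegrableOn (prodH2 ν) (Ioo (-1) 1) := by
  obtain ⟨B, hB0, hB⟩ := exists_prod_bound ν
  refine integrableOn_of_bounded (C := B) (continuousOn_prodH2 ν) fun x hx => ?_
  nlinarith [(hB x hx).2.2, sq_nonneg x]

theorem integral_prodH (ν : ℂ) : ∫ x in Ioo (-1 : ℝ) 1, prodH ν x = legPair ν ν := by
  rw [legPair]; rfl

theorem norm_one_sub_sq {x : ℝ} (hx : x ∈ Ioo (-1 : ℝ) 1) : ‖1 - (x : ℂ) ^ 2‖ = 1 - x ^ 2 := by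
  have e3 : 1 - (x : ℂ) ^ 2 = ((1 - x ^ 2 : ℝ) : ℂ) := by push_cast; ring
  rw [e3, Complex.norm_real, Real.norm_eq_abs, abs_of_pos (one_sub_sq_pos hx)]

theorem norm_one_sub_sq_mul_prodH_le {ν : ℂ} {B : ℝ} {x : ℝ} (hx : x ∈ Ioo (-1 : ℝ) 1)
    (h : ‖prodH ν x‖ ≤ B * (1 - x ^ 2) ^ (-(1 / 8) : ℝ)) :
    ‖(1 - (x : ℂ) ^ 2) * prodH ν x‖ ≤ B * (1 - x ^ 2) ^ (7 / 8 : ℝ) := by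
  rw [norm_mul, norm_one_sub_sq hx, ← mul_rpow_neg_eighth (one_sub_sq_pos hx)]
  have := (one_sub_sq_pos hx).le
  calc _ ≤ (1 - x ^ 2) * (B * (1 - x ^ 2) ^ (-(1 / 8) : ℝ)) := by gcongr
    _ = _ := by ring

/-! ### A first order system for the Cauchy transforms -/

/-- The first component of the system solved by the Cauchy transform of `P_ν(x) P_ν(-x)`. -/
noncomputable def sysY0 (ν z : ℂ) : ℂ := cauchyT (prodH ν) z

/-- The second component of the system. -/
noncomputable def sysY1 (ν z : ℂ) : ℂ := cauchyT (prodH1 ν) z + legPair ν ν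

/-- The third component of the system. -/
noncomputable def sysY2 (ν z : ℂ) : ℂ := cauchyT (prodH2 ν) z - ν * (ν + 1) * z * legPair ν ν

theorem one_sub_sq_ne_of_im_pos {z : ℂ} (hz : 0 < z.im) : 1 - z ^ 2 ≠ 0 := by
  have h1 := sub_ofReal_ne_zero hz 1
  have h2 := sub_ofReal_ne_zero hz (-1)
  push_cast at h1 h2
  have : 1 - z ^ 2 = -((z - 1) * (z - -1)) := by ring
  rw [this]
  exact neg_ne_zero.2 (mul_ne_zero h1 h2)

/-- The constant M in `sysY1` comes from integration by parts: (1 - x²)/(z - x)² differs from (1 -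
z²)/(z - x)² by terms whose contribution survives as the total mass of H. -/
theorem hasDerivAt_sysY0 (ν : ℂ) {z : ℂ} (hz : 0 < z.im) :
    HasDerivAt (sysY0 ν) (sysY1 ν z / (1 - z ^ 2)) z := by
  obtain ⟨B, hB0, hB⟩ := exists_prod_bound ν
  have hlim := tendsto_zero_of_norm_le_rpow (φ := fun x : ℝ => (1 - (x : ℂ) ^ 2) * prodH ν x)
    (C := B) (r := 7 / 8) (by norm_num)
    fun x hx => norm_one_sub_sq_mul_prodH_le hx (hB x hx).1
  have := one_sub_sq_mul_cauchyT_deriv (integrableOn_prodH ν) (integrableOn_prodH1 ν)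
    (fun x hx => hasDerivAt_prodH ν hx) hlim.1 hlim.2 hz
  refine (hasDerivAt_cauchyT (integrableOn_prodH ν) hz).congr_deriv ?_
  rw [eq_div_iff (one_sub_sq_ne_of_im_pos hz), mul_comm, this, integral_prodH, sysY1]

theorem integrableOn_one_sub_sq_mul_prodH (ν : ℂ) :
    IntegrableOn (fun x : ℝ => (1 - (x : ℂ) ^ 2) * prodH ν x) (Ioo (-1) 1) := by
  obtain ⟨B, hB0, hB⟩ := exists_prod_bound ν
  refine integrableOn_of_bounded (C := B) (ContinuousOn.mul (by fun_prop) (continuousOn_prodH ν))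
    fun x hx => (norm_one_sub_sq_mul_prodH_le hx (hB x hx).1).trans ?_
  have : (1 - x ^ 2) ^ (7 / 8 : ℝ) ≤ 1 :=
    Real.rpow_le_one (one_sub_sq_pos hx).le (by nlinarith) (by norm_num)
  nlinarith

/-- Divide with remainder: (1 - x²)/(z - x) = (1 - z²)/(z - x) + z + x, and xH is odd. The term zM
is the origin of the linear correction in `sysY2`. -/
theorem cauchyT_one_sub_sq_mul_prodH (ν : ℂ) {z : ℂ} (hz : 0 < z.im) :
    cauchyT (fun x : ℝ => (1 - (x : ℂ) ^ 2) * prodH ν x) z =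
      (1 - z ^ 2) * sysY0 ν z + z * legPair ν ν := by
  have hodd : ∫ x in Ioo (-1 : ℝ) 1, (x : ℂ) * prodH ν x = 0 :=
    setIntegral_odd_eq_zero fun x _ => by rw [prodH_neg]; push_cast; ring
  have hi : IntegrableOn (fun x : ℝ => (x : ℂ) * prodH ν x) (Ioo (-1) 1) := by
    refine Integrable.bdd_mul (c := 1) (integrableOn_prodH ν)
      Complex.continuous_ofReal.aestronglyMeasurable ?_
    refine (ae_restrict_iff' measurableSet_Ioo).2 (Eventually.of_forall fun x hx => ?_)
    rw [Complex.norm_real, Real.norm_eq_abs, abs_le]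
    exact ⟨hx.1.le, hx.2.le⟩
  have e : ∀ x ∈ Ioo (-1 : ℝ) 1, (1 - (x : ℂ) ^ 2) * prodH ν x / (z - x) =
      (1 - z ^ 2) * (prodH ν x / (z - x)) + (z * prodH ν x + x * prodH ν x) := by
    intro x _
    have := sub_ofReal_ne_zero hz x
    field_simp
    ring
  have i1 := (integrableOn_div_sub (integrableOn_prodH ν) hz).const_mul (1 - z ^ 2)
  have i23 : IntegrableOn (fun x : ℝ => z * prodH ν x + x * prodH ν x) (Ioo (-1) 1) :=
    ((integrableOn_prodH ν).const_mul z).add hi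
  rw [cauchyT, setIntegral_congr_fun measurableSet_Ioo e, integral_add i1 i23,
    integral_add ((integrableOn_prodH ν).const_mul z) hi, integral_const_mul, integral_const_mul,
    integral_prodH, hodd, sysY0, cauchyT, add_zero]

theorem hasDerivAt_sysY1 (ν : ℂ) {z : ℂ} (hz : 0 < z.im) :
    HasDerivAt (sysY1 ν) (2 * sysY2 ν z / (1 - z ^ 2) - 2 * (ν * (ν + 1)) * sysY0 ν z) z := by
  obtain ⟨B, hB0, hB⟩ := exists_prod_bound ν
  have hlim := tendsto_zero_of_norm_le_rpow (φ := fun x : ℝ => (1 - (x : ℂ) ^ 2) * prodH1 ν x)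
    (C := B) (r := 1) (by norm_num) fun x hx => by
      rw [norm_mul, norm_one_sub_sq hx, Real.rpow_one, mul_comm B]
      have := (one_sub_sq_pos hx).le
      gcongr
      exact (hB x hx).2.1
  have hi2 := (integrableOn_prodH2 ν).const_mul 2
  have hi0 := (integrableOn_one_sub_sq_mul_prodH ν).const_mul (2 * (ν * (ν + 1)))
  have := one_sub_sq_mul_cauchyT_deriv (integrableOn_prodH1 ν) (hi2.sub hi0)
    (fun x hx => hasDerivAt_prodH1 ν hx) hlim.1 hlim.2 hz
  rw [setIntegral_odd_eq_zero (φ := prodH1 ν) fun x _ => prodH1_neg ν x, add_zero] at this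
  have e : cauchyT ((fun x => 2 * prodH2 ν x) -
      fun x : ℝ => 2 * (ν * (ν + 1)) * ((1 - (x : ℂ) ^ 2) * prodH ν x)) z =
      2 * cauchyT (prodH2 ν) z - 2 * (ν * (ν + 1)) *
        cauchyT (fun x : ℝ => (1 - (x : ℂ) ^ 2) * prodH ν x) z := by
    simp only [cauchyT]
    rw [← integral_const_mul, ← integral_const_mul, ← integral_sub
      ((integrableOn_div_sub (integrableOn_prodH2 ν) hz).const_mul _)
      ((integrableOn_div_sub (integrableOn_one_sub_sq_mul_prodH ν) hz).const_mul _)]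
    refine integral_congr_ae (Eventually.of_forall fun x => ?_)
    simp only [Pi.sub_apply]
    ring
  rw [e, cauchyT_one_sub_sq_mul_prodH ν hz] at this
  refine ((hasDerivAt_cauchyT (integrableOn_prodH1 ν) hz).add_const _).congr_deriv ?_
  have hne := one_sub_sq_ne_of_im_pos hz
  refine mul_left_cancel₀ hne ?_
  rw [this, sysY2]
  field_simp
  ring

theorem hasDerivAt_sysY2 (ν : ℂ) {z : ℂ} (hz : 0 < z.im) :
    HasDerivAt (sysY2 ν) (-(ν * (ν + 1)) * sysY1 ν z) z := by
  obtain ⟨B, hB0, hB⟩ := exists_prod_bound ν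
  have hlim := tendsto_zero_of_norm_le_rpow (φ := prodH2 ν)
    (C := B) (r := 1) (by norm_num) fun x hx => by
      rw [Real.rpow_one]
      exact (hB x hx).2.2
  have := cauchyT_deriv_eq (integrableOn_prodH2 ν) ((integrableOn_prodH1 ν).const_mul _)
    (fun x hx => hasDerivAt_prodH2 ν hx) hlim.1 hlim.2 hz
  have h2 : HasDerivAt (fun z : ℂ => ν * (ν + 1) * z * legPair ν ν)
      (ν * (ν + 1) * legPair ν ν) z := by
    have := (((hasDerivAt_id z).const_mul (ν * (ν + 1))).mul_const (legPair ν ν))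
    simpa using this
  refine ((hasDerivAt_cauchyT (integrableOn_prodH2 ν) hz).sub h2).congr_deriv ?_
  rw [this, sysY1, cauchyT, cauchyT]
  simp only [mul_div_assoc]
  rw [integral_const_mul]
  ring

/-! ### A conserved quantity and its values at the singular points -/

/-- The bilinear invariant of the system attached to two solutions `(a, A)`, `(b, B)` of the
Legendre system. -/
noncomputable def sysInv (ν : ℂ) (a A b B : ℂ → ℂ) (z : ℂ) : ℂ :=
  sysY0 ν z * (A z * B z) - 1 / 2 * sysY1 ν z * (a z * B z + A z * b z) + sysY2 ν z * (a z * b z)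

/-- The triple (`sysY0`, `sysY1`, `sysY2`) evolves like (cd, cD + Cd, CD) for Legendre solutions c
and d. On such triples the form is a symmetrised product of Wronskians, hence constant, and the
cancellation uses only the linear system. -/
theorem hasDerivAt_sysInv {ν : ℂ} {a A b B : ℂ → ℂ} {z : ℂ} (hz : 0 < z.im)
    (ha : HasDerivAt a (A z / (1 - z ^ 2)) z) (hA : HasDerivAt A (-(ν * (ν + 1)) * a z) z)
    (hb : HasDerivAt b (B z / (1 - z ^ 2)) z) (hB : HasDerivAt B (-(ν * (ν + 1)) * b z) z) :
    HasDerivAt (sysInv ν a A b B) 0 z := by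
  refine ((((hasDerivAt_sysY0 ν hz).mul (hA.mul hB)).sub
    (((hasDerivAt_sysY1 ν hz).const_mul (1 / 2)).mul ((ha.mul hB).add (hA.mul hb)))).add
      ((hasDerivAt_sysY2 ν hz).mul (ha.mul hb))).congr_deriv ?_
  have hne := one_sub_sq_ne_of_im_pos hz
  simp only [Pi.mul_apply, Pi.add_apply]
  field_simp
  ring

/-- The Wronskian of `P_ν(x)` and `P_ν(-x)`. -/
noncomputable def legW (ν : ℂ) : ℂ := -(2 * Complex.sin (π * ν) / π)

/-- The point `x + i y`. -/
noncomputable def vpt (x y : ℝ) : ℂ := x + y * Complex.I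

theorem vpt_im (x y : ℝ) : (vpt x y).im = y := by simp [vpt]

theorem vpt_re (x y : ℝ) : (vpt x y).re = x := by simp [vpt]

theorem vpt_im_pos {x y : ℝ} (hy : 0 < y) : 0 < (vpt x y).im := by rwa [vpt_im]

theorem hasDerivAt_vpt (x y : ℝ) : HasDerivAt (vpt x) Complex.I y := by
  have h1 : HasDerivAt (fun y : ℝ => (y : ℂ)) 1 y := Complex.ofRealCLM.hasDerivAt
  have := (h1.mul_const Complex.I).const_add (x : ℂ)
  rwa [one_mul] at this

theorem vpt_zero (x : ℝ) : vpt x 0 = x := by simp [vpt]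

theorem tendsto_vpt (x : ℝ) : Tendsto (vpt x) (𝓝[>] 0) (𝓝 x) := by
  have := (hasDerivAt_vpt x 0).continuousAt.tendsto
  rw [vpt_zero] at this
  exact this.mono_left nhdsWithin_le_nhds

/-- The kernel y/(σ + iy - ξ) is bounded by 1 and tends to 0 for every ξ ≠ σ. Thus, for y → 0+, a
first order zero in y cancels the possible growth of the Cauchy transform at an endpoint. -/
theorem tendsto_mul_cauchyT {φ : ℝ → ℂ} (hφ : IntegrableOn φ (Ioo (-1) 1)) {σ : ℝ}
    (hσ : σ ∉ Ioo (-1 : ℝ) 1) :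
    Tendsto (fun y : ℝ => (y : ℂ) * cauchyT φ (vpt σ y)) (𝓝[>] 0) (𝓝 0) := by
  simp only [cauchyT, ← integral_const_mul]
  have h0 : ∫ ξ in Ioo (-1 : ℝ) 1, (0 : ℂ) = 0 := by simp
  rw [← h0]
  refine tendsto_integral_filter_of_dominated_convergence (fun ξ => ‖φ ξ‖) ?_ ?_ hφ.norm ?_
  · filter_upwards [self_mem_nhdsWithin] with y hy
    exact ((integrableOn_div_sub hφ (vpt_im_pos hy)).const_mul _).1
  · filter_upwards [self_mem_nhdsWithin] with y hy
    refine Eventually.of_forall fun ξ => ?_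
    have hy' : 0 < y := hy
    have h1 := norm_inv_sub_ofReal_le (vpt_im_pos (x := σ) hy') ξ
    rw [vpt_im] at h1
    rw [div_eq_mul_inv, norm_mul, norm_mul, Complex.norm_real, Real.norm_eq_abs, abs_of_pos hy']
    calc y * (‖φ ξ‖ * ‖(vpt σ y - ξ)⁻¹‖) ≤ y * (‖φ ξ‖ * y⁻¹) := by gcongr
      _ = ‖φ ξ‖ := by field_simp
  · refine (ae_restrict_iff' measurableSet_Ioo).2 (Eventually.of_forall fun ξ hξ => ?_)
    have hne : (σ : ℂ) - ξ ≠ 0 := by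
      rw [sub_ne_zero]
      intro h
      exact hσ (by rwa [Complex.ofReal_injective h])
    have h1 : Tendsto (fun y : ℝ => (y : ℂ)) (𝓝[>] 0) (𝓝 0) := by
      have := (Complex.continuous_ofReal.tendsto 0).mono_left (nhdsWithin_le_nhds (s := Ioi 0))
      simpa using this
    simpa using h1.mul (((tendsto_const_nhds (x := φ ξ))).div
      ((tendsto_vpt σ).sub_const (ξ : ℂ)) hne)

theorem integrableOn_prodH2_div (ν : ℂ) :
    IntegrableOn (fun x : ℝ => prodH2 ν x / (1 - (x : ℂ) ^ 2)) (Ioo (-1) 1) := by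
  obtain ⟨B, hB0, hB⟩ := exists_prod_bound ν
  refine integrableOn_of_bounded (C := B) ((continuousOn_prodH2 ν).div (by fun_prop)
    fun x hx => one_sub_sq_ne hx) fun x hx => ?_
  rw [norm_div, norm_one_sub_sq hx, div_le_iff₀ (one_sub_sq_pos hx)]
  exact (hB x hx).2.2

/-- Integrate the derivative of `legD` times `legFr`. The boundary term at -1 is the source of the
Wronskian. -/
theorem integral_prodH2_div (ν : ℂ) :
    ∫ x in Ioo (-1 : ℝ) 1, prodH2 ν x / (1 - (x : ℂ) ^ 2) =
      legW ν + ν * (ν + 1) * legPair ν ν := by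
  have hi := ((integrableOn_prodH ν).const_mul (-(ν * (ν + 1)))).add (integrableOn_prodH2_div ν)
  have := setIntegral_Ioo_eq_sub_of_tendsto (f := fun x : ℝ => legD ν x * legFr ν x)
    (fun x hx => ((hasDerivAt_legD_real ν hx).mul (hasDerivAt_legFr_real ν hx)).congr_deriv
      (by simp only [Pi.add_apply, prodH, prodH2]; ring)) hi
    ((tendsto_legD_neg_one ν).mul (tendsto_legFr_neg_one ν)) (tendsto_legD_mul_legFr_one ν ν)
  simp only [Pi.add_apply] at this
  rw [integral_add ((integrableOn_prodH ν).const_mul _) (integrableOn_prodH2_div ν),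
    integral_const_mul, integral_prodH] at this
  rw [legW]
  linear_combination this

/-- For σ = ±1 one has 1/(σ - x) = (σ + x)/(1 - x²), and the part with x is odd. -/
theorem integral_prodH2_div_sub (ν : ℂ) {σ : ℝ} (hσ : σ ^ 2 = 1) :
    ∫ x in Ioo (-1 : ℝ) 1, prodH2 ν x / (σ - (x : ℂ)) =
      σ * (legW ν + ν * (ν + 1) * legPair ν ν) := by
  have hodd : ∫ x in Ioo (-1 : ℝ) 1, (x : ℂ) * (prodH2 ν x / (1 - (x : ℂ) ^ 2)) = 0 :=
    setIntegral_odd_eq_zero fun x _ => by rw [prodH2_neg]; push_cast; ring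
  have hi : IntegrableOn (fun x : ℝ => (x : ℂ) * (prodH2 ν x / (1 - (x : ℂ) ^ 2)))
      (Ioo (-1) 1) := by
    refine Integrable.bdd_mul (c := 1) (integrableOn_prodH2_div ν)
      Complex.continuous_ofReal.aestronglyMeasurable ?_
    refine (ae_restrict_iff' measurableSet_Ioo).2 (Eventually.of_forall fun x hx => ?_)
    rw [Complex.norm_real, Real.norm_eq_abs, abs_le]
    exact ⟨hx.1.le, hx.2.le⟩
  have e : ∀ x ∈ Ioo (-1 : ℝ) 1, prodH2 ν x / (σ - (x : ℂ)) =
      σ * (prodH2 ν x / (1 - (x : ℂ) ^ 2)) + x * (prodH2 ν x / (1 - (x : ℂ) ^ 2)) := by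
    intro x hx
    have h1 := one_sub_sq_ne hx
    have hσ' : (σ : ℂ) ^ 2 = 1 := by exact_mod_cast hσ
    have h3 : 1 - (x : ℂ) ^ 2 = (σ - x) * (σ + x) := by rw [← hσ']; ring
    have h4 : (σ : ℂ) - x ≠ 0 := fun h => h1 (by rw [h3, h, zero_mul])
    rw [← add_mul, div_eq_iff h4, mul_right_comm, mul_comm ((σ : ℂ) + x), ← h3,
      mul_div_cancel₀ _ h1]
  rw [setIntegral_congr_fun measurableSet_Ioo e,
    integral_add ((integrableOn_prodH2_div ν).const_mul _) hi, integral_const_mul, hodd,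
    integral_prodH2_div, add_zero]

theorem one_sub_sq_le_two_mul_abs {σ x : ℝ} (hσ : σ ^ 2 = 1) (hx : x ∈ Ioo (-1 : ℝ) 1) :
    1 - x ^ 2 ≤ 2 * |σ - x| := by
  have h1 : |σ| = 1 := by
    rw [← sq_abs] at hσ
    nlinarith [abs_nonneg σ]
  have h2 : |σ + x| ≤ 2 := (abs_add_le _ _).trans (by
    have : |x| ≤ 1 := abs_le.2 ⟨hx.1.le, hx.2.le⟩
    linarith)
  calc 1 - x ^ 2 = (σ + x) * (σ - x) := by linarith
    _ ≤ |(σ + x) * (σ - x)| := le_abs_self _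
    _ = |σ + x| * |σ - x| := abs_mul _ _
    _ ≤ 2 * |σ - x| := by gcongr

theorem tendsto_cauchyT_prodH2 (ν : ℂ) {σ : ℝ} (hσ : σ ^ 2 = 1) :
    Tendsto (fun y : ℝ => cauchyT (prodH2 ν) (vpt σ y)) (𝓝[>] 0)
      (𝓝 (σ * (legW ν + ν * (ν + 1) * legPair ν ν))) := by
  obtain ⟨B, hB0, hB⟩ := exists_prod_bound ν
  rw [← integral_prodH2_div_sub ν hσ]
  refine tendsto_integral_filter_of_dominated_convergence (fun ξ => 2 * B) ?_ ?_
    (integrable_const _) ?_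
  · filter_upwards [self_mem_nhdsWithin] with y hy
    exact (integrableOn_div_sub (integrableOn_prodH2 ν) (vpt_im_pos hy)).1
  · filter_upwards [self_mem_nhdsWithin] with y hy
    refine (ae_restrict_iff' measurableSet_Ioo).2 (Eventually.of_forall fun x hx => ?_)
    have h1 := one_sub_sq_le_two_mul_abs hσ hx
    have h2 := (hB x hx).2.2
    have h3 := Complex.abs_re_le_norm (vpt σ y - x)
    rw [Complex.sub_re, vpt_re, Complex.ofReal_re] at h3
    have h4 := one_sub_sq_pos hx
    rw [norm_div, div_le_iff₀ (by linarith)]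
    nlinarith
  · refine (ae_restrict_iff' measurableSet_Ioo).2 (Eventually.of_forall fun ξ hξ => ?_)
    have hne : (σ : ℂ) - ξ ≠ 0 := by
      rw [sub_ne_zero]
      intro h
      rw [← Complex.ofReal_injective h] at hξ
      nlinarith [one_sub_sq_pos hξ]
    exact (tendsto_const_nhds (x := prodH2 ν ξ)).div ((tendsto_vpt σ).sub_const (ξ : ℂ)) hne

/-- At σ = ±1 the quasi-derivative A has a zero, so the terms containing it vanish in the limit and
only the third component contributes. The M terms of that component cancel. -/
theorem tendsto_sysInv (ν : ℂ) {σ : ℝ} (hσ : σ ^ 2 = 1) {a A : ℂ → ℂ} {A' : ℂ}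
    (ha : ContinuousAt a σ) (ha1 : a σ = 1) (hA : HasDerivAt A A' σ) (hA0 : A σ = 0) :
    Tendsto (fun y : ℝ => sysInv ν a A a A (vpt σ y)) (𝓝[>] 0) (𝓝 (σ * legW ν)) := by
  have hσ' : σ ∉ Ioo (-1 : ℝ) 1 := fun h => by nlinarith [one_sub_sq_pos h]
  have hv := tendsto_vpt σ
  have h0 := tendsto_mul_cauchyT (integrableOn_prodH ν) hσ'
  have hy : Tendsto (fun y : ℝ => (y : ℂ)) (𝓝[>] 0) (𝓝 0) := by
    have := (Complex.continuous_ofReal.tendsto 0).mono_left (nhdsWithin_le_nhds (s := Ioi 0))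
    simpa using this
  have h1 := (tendsto_mul_cauchyT (integrableOn_prodH1 ν) hσ').add (hy.mul_const (legPair ν ν))
  have h2 := (tendsto_cauchyT_prodH2 ν hσ).sub
    ((hv.const_mul (ν * (ν + 1))).mul_const (legPair ν ν))
  have hav := ha.tendsto.comp hv
  rw [ha1] at hav
  have hAv := hA.continuousAt.tendsto.comp hv
  rw [hA0] at hAv
  -- Dividing A by y and multiplying the Cauchy transforms by y gives each factor a finite limit
  -- along the vertical approach.
  have hq : Tendsto (fun y : ℝ => A (vpt σ y) / y) (𝓝[>] 0) (𝓝 (A' * Complex.I)) := by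
    have hA2 : HasDerivAt A A' (vpt σ 0) := by rwa [vpt_zero]
    have hd : HasDerivAt (fun y : ℝ => A (vpt σ y)) (A' * Complex.I) 0 := by
      have := hA2.hasFDerivAt.restrictScalars ℝ
      have h3 := this.comp_hasDerivAt (0 : ℝ) (hasDerivAt_vpt σ 0)
      refine h3.congr_deriv ?_
      simp [mul_comm]
    have := (hasDerivAt_iff_tendsto_slope.1 hd).mono_left
      (nhdsWithin_mono 0 (fun y (hy : 0 < y) => hy.ne' : Ioi (0 : ℝ) ⊆ {0}ᶜ))
    refine this.congr fun y => ?_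
    rw [slope_def_module, vpt_zero, hA0, sub_zero, sub_zero, Complex.real_smul, div_eq_inv_mul]
    push_cast
    rfl
  have hall := ((h0.mul (hq.mul hAv)).sub (h1.mul (hav.mul hq))).add (h2.mul (hav.mul hav))
  have e : (0 : ℂ) * (A' * Complex.I * 0) - (0 + 0 * legPair ν ν) * (1 * (A' * Complex.I)) +
      ((σ : ℂ) * (legW ν + ν * (ν + 1) * legPair ν ν) - ν * (ν + 1) * σ * legPair ν ν) * (1 * 1) =
      σ * legW ν := by ring
  rw [e] at hall
  refine hall.congr' ?_
  filter_upwards [self_mem_nhdsWithin] with y hy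
  have hy0 : (y : ℂ) ≠ 0 := by exact_mod_cast (ne_of_gt hy)
  simp only [sysInv, sysY0, sysY1, sysY2, Function.comp_apply]
  field_simp
  ring

theorem isOpen_upper_inter_ball (c : ℂ) : IsOpen ({z : ℂ | 0 < z.im} ∩ Metric.ball c 2) :=
  (isOpen_lt continuous_const Complex.continuous_im).inter Metric.isOpen_ball

theorem convex_upper_inter_ball (c : ℂ) : Convex ℝ ({z : ℂ | 0 < z.im} ∩ Metric.ball c 2) :=
  (convex_halfSpace_im_gt 0).inter (convex_ball c 2)

theorem norm_one_sub_lt_of_mem_ball {z : ℂ} (h : z ∈ Metric.ball (1 : ℂ) 2) : ‖1 - z‖ < 2 := by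
  rw [norm_sub_rev, ← dist_eq_norm]; exact h

theorem norm_one_add_lt_of_mem_ball {z : ℂ} (h : z ∈ Metric.ball (-1 : ℂ) 2) : ‖1 + z‖ < 2 := by
  have : 1 + z = z - -1 := by ring
  rw [this, ← dist_eq_norm]; exact h

theorem sysInv_legF (ν : ℂ) {z : ℂ} (hz : z ∈ {z : ℂ | 0 < z.im} ∩ Metric.ball (1 : ℂ) 2) :
    sysInv ν (legF ν) (legD ν) (legF ν) (legD ν) z = legW ν := by
  have hlim := tendsto_sysInv ν (σ := 1) (by norm_num) (a := legF ν) (A := legD ν)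
    (by simpa using (hasDerivAt_legF' ν (z := 1) (by simp)).continuousAt)
    (by simpa using legF_one ν)
    (by simpa using hasDerivAt_legD ν (z := 1) (by simp)) (by simpa using legD_one ν)
  rw [Complex.ofReal_one, one_mul] at hlim
  refine tendsto_nhds_unique (tendsto_const_nhds.congr' ?_) hlim
  have hb : Metric.ball (1 : ℂ) 2 ∈ 𝓝 (((1 : ℝ) : ℂ)) := by
    rw [Complex.ofReal_one]; exact Metric.ball_mem_nhds _ (by norm_num)
  filter_upwards [self_mem_nhdsWithin, (tendsto_vpt 1).eventually hb] with y hy hy2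
  refine const_of_hasDerivAt_zero (isOpen_upper_inter_ball 1)
    (convex_upper_inter_ball 1).isPreconnected (fun w hw => ?_) hz ⟨vpt_im_pos hy, hy2⟩
  have h1 := norm_one_sub_lt_of_mem_ball hw.2
  exact hasDerivAt_sysInv hw.1 (hasDerivAt_legF ν h1 (one_sub_sq_ne_of_im_pos hw.1))
    (hasDerivAt_legD ν h1) (hasDerivAt_legF ν h1 (one_sub_sq_ne_of_im_pos hw.1))
    (hasDerivAt_legD ν h1)

theorem sysInv_legFr (ν : ℂ) {z : ℂ} (hz : z ∈ {z : ℂ | 0 < z.im} ∩ Metric.ball (-1 : ℂ) 2) :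
    sysInv ν (legFr ν) (legDr ν) (legFr ν) (legDr ν) z = -legW ν := by
  have hc : ContinuousAt (legFr ν) ((-1 : ℝ) : ℂ) := by
    have h1 := (hasDerivAt_legF' ν (z := 1) (by simp)).continuousAt
    have h2 : ContinuousAt (legF ν) (-((-1 : ℝ) : ℂ)) := by simpa using h1
    exact ContinuousAt.comp (f := fun z : ℂ => -z) h2 continuousAt_neg
  have hlim := tendsto_sysInv ν (σ := -1) (by norm_num) (a := legFr ν) (A := legDr ν) hc
    (by simpa [legFr] using legF_one ν)
    (hasDerivAt_legDr ν (z := ((-1 : ℝ) : ℂ)) (by simp)) (by simpa [legDr] using legD_one ν)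
  rw [Complex.ofReal_neg, Complex.ofReal_one, neg_one_mul] at hlim
  refine tendsto_nhds_unique (tendsto_const_nhds.congr' ?_) hlim
  have hb : Metric.ball (-1 : ℂ) 2 ∈ 𝓝 (((-1 : ℝ) : ℂ)) := by
    rw [Complex.ofReal_neg, Complex.ofReal_one]; exact Metric.ball_mem_nhds _ (by norm_num)
  filter_upwards [self_mem_nhdsWithin, (tendsto_vpt (-1)).eventually hb] with y hy hy2
  refine const_of_hasDerivAt_zero (isOpen_upper_inter_ball (-1))
    (convex_upper_inter_ball (-1)).isPreconnected (fun w hw => ?_) hz ⟨vpt_im_pos hy, hy2⟩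
  have h1 := norm_one_add_lt_of_mem_ball hw.2
  exact hasDerivAt_sysInv hw.1 (hasDerivAt_legFr ν h1 (one_sub_sq_ne_of_im_pos hw.1))
    (hasDerivAt_legDr ν h1) (hasDerivAt_legFr ν h1 (one_sub_sq_ne_of_im_pos hw.1))
    (hasDerivAt_legDr ν h1)

/-- The two solutions are regular at different endpoints, so this constant cannot be read off in the
same way. Its existence is enough. -/
theorem exists_sysInv_legF_legFr (ν : ℂ) : ∃ κ : ℂ,
    ∀ z ∈ ({z : ℂ | 0 < z.im} ∩ Metric.ball (1 : ℂ) 2) ∩ Metric.ball (-1 : ℂ) 2,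
      sysInv ν (legF ν) (legD ν) (legFr ν) (legDr ν) z = κ := by
  set U := ({z : ℂ | 0 < z.im} ∩ Metric.ball (1 : ℂ) 2) ∩ Metric.ball (-1 : ℂ) 2
  by_cases hU : U.Nonempty
  · obtain ⟨w, hw⟩ := hU
    refine ⟨_, fun z hz => const_of_hasDerivAt_zero
      ((isOpen_upper_inter_ball 1).inter Metric.isOpen_ball)
      ((convex_upper_inter_ball 1).inter (convex_ball (-1) 2)).isPreconnected (fun w hw => ?_)
      hz hw⟩
    have h1 := norm_one_sub_lt_of_mem_ball hw.1.2
    have h2 := norm_one_add_lt_of_mem_ball hw.2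
    have h3 := one_sub_sq_ne_of_im_pos hw.1.1
    exact hasDerivAt_sysInv hw.1.1 (hasDerivAt_legF ν h1 h3) (hasDerivAt_legD ν h1)
      (hasDerivAt_legFr ν h2 h3) (hasDerivAt_legDr ν h2)
  · exact ⟨0, fun z hz => absurd ⟨z, hz⟩ hU⟩

/-! ### Boundary values and the regularised Hilbert transform -/

/-- The boundary values of the Cauchy transform of `P_ν(x) P_ν(-x)`. -/
theorem exists_tendsto_sysY0 (ν : ℂ) (hW : legW ν ≠ 0) : ∃ κ : ℂ, ∀ x ∈ Ioo (-1 : ℝ) 1,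
    Tendsto (fun y : ℝ => sysY0 ν (vpt x y)) (𝓝[>] 0)
      (𝓝 ((legW ν * (legFr ν x ^ 2 - legF ν x ^ 2) - 2 * κ * (legF ν x * legFr ν x)) /
        legW ν ^ 2)) := by
  obtain ⟨κ, hκ⟩ := exists_sysInv_legF_legFr ν
  refine ⟨κ, fun x hx => ?_⟩
  have hv := tendsto_vpt x
  have n1 := norm_one_sub_ofReal_lt (x := x) ⟨hx.1, hx.2.le⟩
  have n2 := norm_one_add_ofReal_lt hx
  have hp := one_sub_sq_ne hx
  have f1 := (hasDerivAt_legF ν n1 hp).continuousAt.tendsto.comp hv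
  have f2 := (hasDerivAt_legD ν n1).continuousAt.tendsto.comp hv
  have f3 := (hasDerivAt_legFr ν n2 hp).continuousAt.tendsto.comp hv
  have f4 := (hasDerivAt_legDr ν n2).continuousAt.tendsto.comp hv
  have fW := (f1.mul f4).sub (f2.mul f3)
  have eW := wronskian_eq ν hx
  rw [eW] at fW
  change Tendsto _ _ (𝓝 (legW ν)) at fW
  have hnum := (((f3.pow 2).sub (f1.pow 2)).const_mul (legW ν)).sub
    ((f1.mul f3).const_mul (2 * κ))
  refine (hnum.div (fW.pow 2) (pow_ne_zero 2 hW)).congr' ?_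
  have hb1 : Metric.ball (1 : ℂ) 2 ∈ 𝓝 (x : ℂ) := Metric.isOpen_ball.mem_nhds (by
    rw [Metric.mem_ball, dist_eq_norm, norm_sub_rev]; exact n1)
  have hb2 : Metric.ball (-1 : ℂ) 2 ∈ 𝓝 (x : ℂ) := Metric.isOpen_ball.mem_nhds (by
    rw [Metric.mem_ball, dist_eq_norm, sub_neg_eq_add, add_comm]; exact n2)
  have hne := fW.eventually_ne hW
  filter_upwards [self_mem_nhdsWithin, hv.eventually hb1, hv.eventually hb2, hne] with y hy h1 h2 h3
  have g1 := sysInv_legF ν (z := vpt x y) ⟨vpt_im_pos hy, h1⟩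
  have g2 := sysInv_legFr ν (z := vpt x y) ⟨vpt_im_pos hy, h2⟩
  have g3 := hκ (vpt x y) ⟨⟨vpt_im_pos hy, h1⟩, h2⟩
  simp only [Function.comp_apply] at h3 ⊢
  simp only [Pi.div_apply]
  rw [div_eq_iff (pow_ne_zero 2 h3)]
  simp only [sysInv] at g1 g2 g3
  generalize legF ν (vpt x y) = f at *
  generalize legFr ν (vpt x y) = g at *
  generalize legD ν (vpt x y) = F at *
  generalize legDr ν (vpt x y) = G at *
  -- In the combination g²I(f, f) + f²I(g, g) - 2fg I(f, g) of the invariants, the second and third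
  -- components drop out and the first is multiplied by the squared Wronskian.
  linear_combination -g ^ 2 * g1 - f ^ 2 * g2 + 2 * f * g * g3

/-- Reflection exchanges f and g. Antisymmetrising in x therefore keeps g² - f² and removes the
unknown constant, which multiplies the even function fg. -/
theorem tendsto_sysY0_sub (ν : ℂ) (hW : legW ν ≠ 0) {x : ℝ} (hx : x ∈ Ioo (-1 : ℝ) 1) :
    Tendsto (fun y : ℝ => (sysY0 ν (vpt x y) - sysY0 ν (vpt (-x) y)) / 2) (𝓝[>] 0)
      (𝓝 ((legFr ν x ^ 2 - legF ν x ^ 2) / legW ν)) := by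
  obtain ⟨κ, hκ⟩ := exists_tendsto_sysY0 ν hW
  have := ((hκ x hx).sub (hκ (-x) (neg_mem_Ioo_one hx))).div_const 2
  have e1 : legFr ν ((-x : ℝ) : ℂ) = legF ν x := by simp [legFr]
  have e2 : legF ν ((-x : ℝ) : ℂ) = legFr ν x := by simp [legFr]
  rw [e1, e2] at this
  convert this using 2
  field_simp
  ring

/-- The regularised Hilbert kernel `t / (t ^ 2 + y ^ 2)`. -/
noncomputable def hilbK (y t : ℝ) : ℝ := t / (t ^ 2 + y ^ 2)

theorem hilbK_neg (y t : ℝ) : hilbK y (-t) = -hilbK y t := by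
  rw [hilbK, hilbK, neg_sq, neg_div]

theorem continuous_hilbK {y : ℝ} (hy : 0 < y) : Continuous (hilbK y) :=
  continuous_id.div (by fun_prop) fun t => by positivity

theorem abs_hilbK_le {y : ℝ} (hy : 0 < y) (t : ℝ) : |hilbK y t| ≤ y⁻¹ := by
  rw [hilbK, abs_div, abs_of_pos (by positivity : 0 < t ^ 2 + y ^ 2), div_le_iff₀ (by positivity)]
  field_simp
  nlinarith [sq_abs t, sq_nonneg (|t| - y), abs_nonneg t]

theorem abs_hilbK_le_inv {y t : ℝ} (ht : t ≠ 0) : |hilbK y t| ≤ |t|⁻¹ := by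
  have h : 0 < t ^ 2 := by positivity
  have h' : 0 < |t| := abs_pos.2 ht
  rw [hilbK, abs_div, abs_of_pos (by positivity : 0 < t ^ 2 + y ^ 2), div_le_iff₀ (by positivity)]
  field_simp
  nlinarith [sq_abs t, sq_nonneg y]

theorem abs_mul_hilbK_le (y t : ℝ) : |t| * |hilbK y t| ≤ 1 := by
  rcases eq_or_ne t 0 with rfl | ht
  · simp
  · calc |t| * |hilbK y t| ≤ |t| * |t|⁻¹ := by
          gcongr
          exact abs_hilbK_le_inv ht
      _ = 1 := mul_inv_cancel₀ (abs_pos.2 ht).ne'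

theorem integrableOn_prodH_mul_hilbK (ν : ℂ) {y : ℝ} (hy : 0 < y) (x : ℝ) :
    IntegrableOn (fun ξ : ℝ => prodH ν ξ * (hilbK y (x - ξ) : ℂ)) (Ioo (-1) 1) := by
  refine integrableOn_mul_of_bounded (integrableOn_prodH ν) (C := y⁻¹) ?_ fun ξ => ?_
  · exact Complex.continuous_ofReal.comp ((continuous_hilbK hy).comp (by fun_prop))
  · rw [Complex.norm_real]
    exact abs_hilbK_le hy _

theorem setIntegral_comp_neg (φ : ℝ → ℂ) :
    ∫ x in Ioo (-1 : ℝ) 1, φ (-x) = ∫ x in Ioo (-1 : ℝ) 1, φ x := by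
  rw [← integral_Ioc_eq_integral_Ioo, ← integral_Ioc_eq_integral_Ioo,
    ← intervalIntegral.integral_of_le (by norm_num),
    ← intervalIntegral.integral_of_le (by norm_num), intervalIntegral.integral_comp_neg]
  norm_num

/-- As H is even, reflecting x amounts to conjugating the kernel with a sign, so the half difference
averages 1/(x + iy - ξ) and 1/(x - iy - ξ). This is a principal value regularised by y. -/
theorem sysY0_sub_eq (ν : ℂ) {y : ℝ} (hy : 0 < y) (x : ℝ) :
    (sysY0 ν (vpt x y) - sysY0 ν (vpt (-x) y)) / 2 =
      ∫ ξ in Ioo (-1 : ℝ) 1, prodH ν ξ * (hilbK y (x - ξ) : ℂ) := by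
  have e1 : sysY0 ν (vpt (-x) y) = ∫ ξ in Ioo (-1 : ℝ) 1, -(prodH ν ξ / (vpt x (-y) - ξ)) := by
    rw [sysY0, cauchyT, ← setIntegral_comp_neg]
    refine setIntegral_congr_fun measurableSet_Ioo fun ξ _ => ?_
    rw [prodH_neg, ← div_neg]
    congr 1
    simp only [vpt]; push_cast; ring
  have hi1 := integrableOn_div_sub (integrableOn_prodH ν) (vpt_im_pos (x := x) hy)
  have hne : ∀ ξ : ℝ, vpt x (-y) - ξ ≠ 0 := fun ξ h => by
    have := congrArg Complex.im h
    simp only [vpt, Complex.sub_im, Complex.add_im, Complex.ofReal_im, Complex.mul_im,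
      Complex.I_im, Complex.I_re, Complex.ofReal_re, Complex.zero_im] at this
    simp at this
    exact hy.ne' this
  have hpt : ∀ ξ : ℝ, prodH ν ξ / (vpt x y - ξ) - -(prodH ν ξ / (vpt x (-y) - ξ)) =
      2 * (prodH ν ξ * (hilbK y (x - ξ) : ℂ)) := by
    intro ξ
    have h1 := hne ξ
    have h2 := sub_ofReal_ne_zero (vpt_im_pos (x := x) hy) ξ
    have h3 : ((x : ℂ) - ξ) ^ 2 + (y : ℂ) ^ 2 = (vpt x y - ξ) * (vpt x (-y) - ξ) := by
      simp only [vpt]; push_cast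
      linear_combination (y : ℂ) ^ 2 * Complex.I_sq
    have h4 : (2 : ℂ) * ((x : ℂ) - ξ) = (vpt x y - ξ) + (vpt x (-y) - ξ) := by
      simp only [vpt]; push_cast; ring
    rw [hilbK]
    push_cast
    rw [h3, mul_left_comm, ← mul_div_assoc, h4]
    field_simp
    ring
  have hi2 : IntegrableOn (fun ξ : ℝ => -(prodH ν ξ / (vpt x (-y) - ξ))) (Ioo (-1) 1) := by
    have : (fun ξ : ℝ => -(prodH ν ξ / (vpt x (-y) - ξ))) = fun ξ : ℝ =>
        prodH ν ξ / (vpt x y - ξ) - 2 * (prodH ν ξ * (hilbK y (x - ξ) : ℂ)) := by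
      funext ξ; rw [← hpt]; ring
    rw [this]
    exact hi1.sub ((integrableOn_prodH_mul_hilbK ν hy x).const_mul 2)
  rw [e1, sysY0, cauchyT, ← integral_sub hi1 hi2]
  simp only [hpt]
  rw [integral_const_mul, mul_div_cancel_left₀ _ two_ne_zero]

/-! ### A bound for the regularised Hilbert transform -/

theorem exists_setIntegral_abs_rpow_le : ∃ C : ℝ, ∀ x ∈ Ioo (-1 : ℝ) 1,
    IntegrableOn (fun ξ : ℝ => |x - ξ| ^ (-(1 / 2) : ℝ)) (Ioo (-1) 1) ∧
      ∫ ξ in Ioo (-1 : ℝ) 1, |x - ξ| ^ (-(1 / 2) : ℝ) ≤ C := by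
  have h1 : IntervalIntegrable (fun t : ℝ => |t| ^ (-(1 / 2) : ℝ)) volume 0 2 := by
    refine (intervalIntegral.intervalIntegrable_rpow' (a := 0) (b := 2) (r := -(1 / 2))
      (by norm_num)).congr fun t ht => ?_
    rw [uIoc_of_le (by norm_num)] at ht
    simp only [abs_of_pos ht.1]
  have h2 : IntervalIntegrable (fun t : ℝ => |t| ^ (-(1 / 2) : ℝ)) volume (-2) 2 := by
    have := h1.comp_sub_left 0
    simp only [zero_sub, abs_neg, neg_zero] at this
    exact this.symm.trans h1
  refine ⟨∫ t in (-2 : ℝ)..2, |t| ^ (-(1 / 2) : ℝ), fun x hx => ?_⟩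
  have hsub : uIcc (x - 1) (x - -1) ⊆ uIcc (-2 : ℝ) 2 := by
    rw [uIcc_of_le (by linarith), uIcc_of_le (by norm_num)]
    exact Icc_subset_Icc (by linarith [hx.1]) (by linarith [hx.2])
  have h3 := h2.mono_set hsub
  have h4 := h3.comp_sub_left x
  simp only [sub_sub_cancel] at h4
  constructor
  · exact (intervalIntegrable_iff_integrableOn_Ioo_of_le (by norm_num)).1 h4.symm
  · rw [← integral_Ioc_eq_integral_Ioo, ← intervalIntegral.integral_of_le (by norm_num),
      intervalIntegral.integral_comp_sub_left (fun t => |t| ^ (-(1 / 2) : ℝ)) x]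
    exact intervalIntegral.integral_mono_interval (by linarith [hx.1]) (by linarith)
      (by linarith [hx.2]) (Eventually.of_forall fun t => Real.rpow_nonneg (abs_nonneg t) _) h2

theorem setIntegral_indicator_hilbK {x D y : ℝ} (hD : 0 < D)
    (hsub : Ioo (x - D) (x + D) ⊆ Ioo (-1 : ℝ) 1) (c : ℂ) :
    ∫ ξ in Ioo (-1 : ℝ) 1, (Ioo (x - D) (x + D)).indicator
      (fun ξ => c * (hilbK y (x - ξ) : ℂ)) ξ = 0 := by
  rw [setIntegral_indicator measurableSet_Ioo, inter_eq_right.2 hsub, integral_const_mul]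
  have h0 : ∫ ξ in Ioo (x - D) (x + D), (hilbK y (x - ξ) : ℂ) = 0 := by
    rw [← integral_Ioc_eq_integral_Ioo, ← intervalIntegral.integral_of_le (by linarith),
      intervalIntegral.integral_comp_sub_left (fun t => (hilbK y t : ℂ)) x]
    have e1 : x - (x + D) = -D := by ring
    have e2 : x - (x - D) = D := by ring
    rw [e1, e2]
    have h := intervalIntegral.integral_comp_neg (a := -D) (b := D) (fun t => (hilbK y t : ℂ))
    simp only [hilbK_neg, Complex.ofReal_neg, intervalIntegral.integral_neg, neg_neg] at h
    have : (2 : ℂ) * ∫ t in (-D)..D, (hilbK y t : ℂ) = 0 := by linear_combination -h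
    simpa using this
  rw [h0, mul_zero]

/-- Mean value inequality with H' = `prodH1`/(1 - x²), the numerator being bounded and the
denominator at least D on the interval. -/
theorem norm_prodH_sub_le {ν : ℂ} {B : ℝ} (hB : ∀ x ∈ Ioo (-1 : ℝ) 1, ‖prodH1 ν x‖ ≤ B)
    {x D : ℝ} (hD : 0 < D) (hsub : ∀ ξ ∈ Ioo (x - D) (x + D), ξ ∈ Ioo (-1 : ℝ) 1 ∧ D ≤ 1 - ξ ^ 2)
    {ξ : ℝ} (hξ : ξ ∈ Ioo (x - D) (x + D)) :
    ‖prodH ν ξ - prodH ν x‖ ≤ B / D * |x - ξ| := by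
  have := (convex_Ioo (x - D) (x + D)).norm_image_sub_le_of_norm_hasDerivWithin_le
    (f := prodH ν) (f' := fun ξ => prodH1 ν ξ / (1 - ξ ^ 2)) (C := B / D) (x := x) (y := ξ)
    (fun t ht => (hasDerivAt_prodH ν (hsub t ht).1).hasDerivWithinAt)
    (fun t ht => by
      rw [norm_div, norm_one_sub_sq (hsub t ht).1]
      have h1 := hB t (hsub t ht).1
      have h2 := (norm_nonneg _).trans h1
      exact div_le_div₀ h2 h1 hD (hsub t ht).2)
    ⟨by linarith, by linarith⟩ hξ
  rwa [Real.norm_eq_abs, abs_sub_comm] at this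

theorem mem_Ioo_of_near {x ξ : ℝ} (hx : x ∈ Ioo (-1 : ℝ) 1)
    (hξ : ξ ∈ Ioo (x - (1 - x ^ 2) / 4) (x + (1 - x ^ 2) / 4)) :
    ξ ∈ Ioo (-1 : ℝ) 1 ∧ (1 - x ^ 2) / 4 ≤ 1 - ξ ^ 2 := by
  have h1 := hξ.1
  have h2 := hξ.2
  have h3 := hx.1
  have h4 := hx.2
  have h5 : ξ < 1 := by nlinarith
  have h6 : -1 < ξ := by nlinarith
  refine ⟨⟨h6, h5⟩, ?_⟩
  have h7 : (1 - x) / 2 ≤ 1 - ξ := by nlinarith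
  have h8 : (1 + x) / 2 ≤ 1 + ξ := by nlinarith
  nlinarith

/-- Young's inequality separates the weight from the kernel. The exponents double but stay above -1,
so both pieces are integrable. -/
theorem rpow_neg_le_of_young {p t : ℝ} (hp : 0 < p) (ht : 0 < t) :
    p ^ (-(1 / 8) : ℝ) * t ^ (-(1 / 4) : ℝ) ≤ p ^ (-(1 / 4) : ℝ) + t ^ (-(1 / 2) : ℝ) := by
  have e1 : p ^ (-(1 / 4) : ℝ) = (p ^ (-(1 / 8) : ℝ)) ^ 2 := by
    rw [← Real.rpow_natCast, ← Real.rpow_mul hp.le]; norm_num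
  have e2 : t ^ (-(1 / 2) : ℝ) = (t ^ (-(1 / 4) : ℝ)) ^ 2 := by
    rw [← Real.rpow_natCast, ← Real.rpow_mul ht.le]; norm_num
  rw [e1, e2]
  nlinarith [sq_nonneg (p ^ (-(1 / 8) : ℝ) - t ^ (-(1 / 4) : ℝ)),
    sq_nonneg (p ^ (-(1 / 8) : ℝ)), sq_nonneg (t ^ (-(1 / 4) : ℝ))]

theorem rpow_split {D t : ℝ} (hD : 0 < D) (ht : 0 < t) :
    D ≤ t → t⁻¹ ≤ D ^ (-(3 / 4) : ℝ) * t ^ (-(1 / 4) : ℝ) := fun h => by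
  have e : t⁻¹ = t ^ (-(3 / 4) : ℝ) * t ^ (-(1 / 4) : ℝ) := by
    rw [← Real.rpow_add ht, ← Real.rpow_neg_one]; norm_num
  rw [e]
  have := Real.rpow_le_rpow_of_nonpos hD h (by norm_num : -(3 / 4 : ℝ) ≤ 0)
  have := Real.rpow_nonneg ht.le (-(1 / 4))
  gcongr

theorem rpow_split' {D t : ℝ} (ht : 0 < t) (h : t ≤ D) :
    D⁻¹ ≤ D ^ (-(3 / 4) : ℝ) * t ^ (-(1 / 4) : ℝ) := by
  have hD := ht.trans_le h
  have e : D⁻¹ = D ^ (-(3 / 4) : ℝ) * D ^ (-(1 / 4) : ℝ) := by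
    rw [← Real.rpow_add hD, ← Real.rpow_neg_one]; norm_num
  rw [e]
  have := Real.rpow_le_rpow_of_nonpos ht h (by norm_num : -(1 / 4 : ℝ) ≤ 0)
  have := Real.rpow_nonneg hD.le (-(3 / 4))
  gcongr

/-- A bound for the regularised Hilbert transform that does not depend on the regularisation. -/
theorem exists_norm_hilbert_le (ν : ℂ) : ∃ C : ℝ, 0 ≤ C ∧ ∀ x ∈ Ioo (-1 : ℝ) 1, ∀ y : ℝ, 0 < y →
    ‖∫ ξ in Ioo (-1 : ℝ) 1, prodH ν ξ * (hilbK y (x - ξ) : ℂ)‖ ≤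
      C * (1 - x ^ 2) ^ (-(3 / 4) : ℝ) := by
  obtain ⟨B, hB0, hB⟩ := exists_prod_bound ν
  obtain ⟨C₁, hC₁⟩ := exists_setIntegral_abs_rpow_le
  have hC₁0 : 0 ≤ C₁ := le_trans (integral_nonneg fun t => Real.rpow_nonneg (abs_nonneg _) _)
    (hC₁ 0 (by norm_num)).2
  set C₂ := ∫ ξ in Ioo (-1 : ℝ) 1, (1 - ξ ^ 2) ^ (-(1 / 4) : ℝ) with hC₂
  have hC₂0 : 0 ≤ C₂ := setIntegral_nonneg measurableSet_Ioo fun ξ hξ =>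
    Real.rpow_nonneg (one_sub_sq_pos hξ).le _
  have hi4 := integrableOn_one_sub_sq_rpow (r := 1 / 4) (by norm_num) (by norm_num)
  refine ⟨B * (C₂ + C₁) * 4 ^ (3 / 4 : ℝ), by positivity, fun x hx y hy => ?_⟩
  -- A radius comparable with the distance to the endpoints: on the window around x of radius D the
  -- weight 1 - ξ² is still at least D.
  set D := (1 - x ^ 2) / 4 with hDdef
  have hp := one_sub_sq_pos hx
  have hD : 0 < D := by positivity
  have hnear := fun ξ (hξ : ξ ∈ Ioo (x - D) (x + D)) => mem_Ioo_of_near hx hξ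
  -- The kernel is odd about x, so subtracting H(x) times the kernel on the symmetric window leaves
  -- the integral unchanged and makes the integrand bounded there.
  have hzero := setIntegral_indicator_hilbK (y := y) hD (fun ξ hξ => (hnear ξ hξ).1) (prodH ν x)
  have hind : IntegrableOn (fun ξ => (Ioo (x - D) (x + D)).indicator
      (fun ξ => prodH ν x * (hilbK y (x - ξ) : ℂ)) ξ) (Ioo (-1) 1) := by
    refine IntegrableOn.indicator ?_ measurableSet_Ioo
    have : Continuous fun ξ : ℝ => prodH ν x * (hilbK y (x - ξ) : ℂ) :=
      continuous_const.mul
        (Complex.continuous_ofReal.comp ((continuous_hilbK hy).comp (by fun_prop)))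
    exact (this.integrableOn_Icc (a := -1) (b := 1)).mono_set Ioo_subset_Icc_self
  have hsplit : ∫ ξ in Ioo (-1 : ℝ) 1, prodH ν ξ * (hilbK y (x - ξ) : ℂ) =
      ∫ ξ in Ioo (-1 : ℝ) 1, (prodH ν ξ * (hilbK y (x - ξ) : ℂ) -
        (Ioo (x - D) (x + D)).indicator (fun ξ => prodH ν x * (hilbK y (x - ξ) : ℂ)) ξ) := by
    rw [integral_sub (integrableOn_prodH_mul_hilbK ν hy x) hind, hzero, sub_zero]
  have hbd : ∀ ξ ∈ Ioo (-1 : ℝ) 1, ‖prodH ν ξ * (hilbK y (x - ξ) : ℂ) -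
        (Ioo (x - D) (x + D)).indicator (fun ξ => prodH ν x * (hilbK y (x - ξ) : ℂ)) ξ‖ ≤
      B * D ^ (-(3 / 4) : ℝ) * ((1 - ξ ^ 2) ^ (-(1 / 4) : ℝ) + |x - ξ| ^ (-(1 / 2) : ℝ)) := by
    intro ξ hξ
    have hpξ := one_sub_sq_pos hξ
    have hD34 := Real.rpow_nonneg hD.le (-(3 / 4))
    by_cases hxξ : x - ξ = 0
    · have h1 := Real.rpow_nonneg hpξ.le (-(1 / 4))
      have h2 := Real.rpow_nonneg (abs_nonneg (x - ξ)) (-(1 / 2))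
      have hk : hilbK y (x - ξ) = 0 := by rw [hxξ, hilbK, zero_div]
      have h3 : (Ioo (x - D) (x + D)).indicator
          (fun ξ => prodH ν x * (hilbK y (x - ξ) : ℂ)) ξ = 0 := by
        rw [indicator_apply, hk]; simp
      rw [h3, hk]
      simp only [Complex.ofReal_zero, mul_zero, sub_zero, norm_zero]
      positivity
    have ht : 0 < |x - ξ| := abs_pos.2 hxξ
    have hy4 := Real.rpow_nonneg ht.le (-(1 / 4))
    have hyoung := rpow_neg_le_of_young hpξ ht
    have hone : 1 ≤ (1 - ξ ^ 2) ^ (-(1 / 8) : ℝ) :=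
      Real.one_le_rpow_of_pos_of_le_one_of_nonpos hpξ (by nlinarith) (by norm_num)
    by_cases hN : ξ ∈ Ioo (x - D) (x + D)
    · rw [indicator_of_mem hN, ← sub_mul, norm_mul, Complex.norm_real, Real.norm_eq_abs]
      have h1 := norm_prodH_sub_le (fun x hx => (hB x hx).2.1) hD hnear hN
      have h2 : |x - ξ| ≤ D := by rw [abs_le]; constructor <;> linarith [hN.1, hN.2]
      calc _ ≤ (B / D * |x - ξ|) * |hilbK y (x - ξ)| := by gcongr
        _ = B / D * (|x - ξ| * |hilbK y (x - ξ)|) := by ring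
        _ ≤ B / D * 1 := by
            gcongr
            exact abs_mul_hilbK_le _ _
        _ = B * D⁻¹ := by ring
        _ ≤ B * (D ^ (-(3 / 4) : ℝ) * |x - ξ| ^ (-(1 / 4) : ℝ)) := by
            gcongr
            exact rpow_split' ht h2
        _ ≤ B * (D ^ (-(3 / 4) : ℝ) *
              ((1 - ξ ^ 2) ^ (-(1 / 8) : ℝ) * |x - ξ| ^ (-(1 / 4) : ℝ))) := by
            gcongr
            exact le_mul_of_one_le_left hy4 hone
        _ ≤ B * (D ^ (-(3 / 4) : ℝ) *
              ((1 - ξ ^ 2) ^ (-(1 / 4) : ℝ) + |x - ξ| ^ (-(1 / 2) : ℝ))) := by gcongr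
        _ = _ := by ring
    -- Away from x nothing is subtracted. Three quarters of the power of 1/|x - ξ| are spent on D,
    -- and the remaining quarter is integrated against the weight.
    · rw [indicator_of_notMem hN, sub_zero, norm_mul, Complex.norm_real, Real.norm_eq_abs]
      have h2 : D ≤ |x - ξ| := by
        by_contra h
        rw [not_le, abs_lt] at h
        exact hN ⟨by linarith [h.2], by linarith [h.1]⟩
      calc _ ≤ (B * (1 - ξ ^ 2) ^ (-(1 / 8) : ℝ)) * |x - ξ|⁻¹ := by
            gcongr
            · exact (hB ξ hξ).1
            · exact abs_hilbK_le_inv hxξ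
        _ ≤ (B * (1 - ξ ^ 2) ^ (-(1 / 8) : ℝ)) *
              (D ^ (-(3 / 4) : ℝ) * |x - ξ| ^ (-(1 / 4) : ℝ)) := by
            gcongr
            exact rpow_split hD ht h2
        _ = B * D ^ (-(3 / 4) : ℝ) *
              ((1 - ξ ^ 2) ^ (-(1 / 8) : ℝ) * |x - ξ| ^ (-(1 / 4) : ℝ)) := by ring
        _ ≤ _ := by gcongr
  rw [hsplit]
  calc _ ≤ ∫ ξ in Ioo (-1 : ℝ) 1, B * D ^ (-(3 / 4) : ℝ) *
        ((1 - ξ ^ 2) ^ (-(1 / 4) : ℝ) + |x - ξ| ^ (-(1 / 2) : ℝ)) :=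
        norm_integral_le_of_norm_le ((hi4.add (hC₁ x hx).1).const_mul _)
          ((ae_restrict_iff' measurableSet_Ioo).2 (Eventually.of_forall hbd))
    _ = B * D ^ (-(3 / 4) : ℝ) * (C₂ + ∫ ξ in Ioo (-1 : ℝ) 1, |x - ξ| ^ (-(1 / 2) : ℝ)) := by
        rw [integral_const_mul, integral_add hi4 (hC₁ x hx).1]
    _ ≤ B * D ^ (-(3 / 4) : ℝ) * (C₂ + C₁) := by
        have := Real.rpow_nonneg hD.le (-(3 / 4))
        gcongr
        exact (hC₁ x hx).2
    _ = _ := by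
        rw [hDdef, Real.div_rpow hp.le (by norm_num), Real.rpow_neg (by norm_num : (0 : ℝ) ≤ 4),
          div_inv_eq_mul]
        ring

/-! ### Symmetrisation and removal of the regularisation -/

theorem integrableOn_id_mul_prodH (ν : ℂ) :
    IntegrableOn (fun x : ℝ => (x : ℂ) * prodH ν x) (Ioo (-1) 1) := by
  refine Integrable.bdd_mul (c := 1) (integrableOn_prodH ν)
    Complex.continuous_ofReal.aestronglyMeasurable ?_
  refine (ae_restrict_iff' measurableSet_Ioo).2 (Eventually.of_forall fun x hx => ?_)
  rw [Complex.norm_real, Real.norm_eq_abs, abs_le]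
  exact ⟨hx.1.le, hx.2.le⟩

/-- Symmetrisation of the double integral against the odd kernel. -/
theorem two_mul_integral_hilbert (ν : ℂ) {y : ℝ} (hy : 0 < y) :
    2 * ∫ x in Ioo (-1 : ℝ) 1, (x : ℂ) * prodH ν x *
        ∫ ξ in Ioo (-1 : ℝ) 1, prodH ν ξ * (hilbK y (x - ξ) : ℂ) =
      ∫ x in Ioo (-1 : ℝ) 1, prodH ν x *
        ∫ ξ in Ioo (-1 : ℝ) 1, prodH ν ξ * (((x - ξ) * hilbK y (x - ξ) : ℝ) : ℂ) := by
  set m := (volume : Measure ℝ).restrict (Ioo (-1) 1) with hm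
  have hk : Continuous fun p : ℝ × ℝ => (hilbK y (p.1 - p.2) : ℂ) :=
    Complex.continuous_ofReal.comp ((continuous_hilbK hy).comp (by fun_prop))
  have hint : Integrable (fun p : ℝ × ℝ => ((p.1 : ℂ) * prodH ν p.1) * prodH ν p.2 *
      (hilbK y (p.1 - p.2) : ℂ)) (m.prod m) :=
    ((integrableOn_id_mul_prodH ν).mul_prod (integrableOn_prodH ν)).mul_bdd (c := y⁻¹)
      hk.aestronglyMeasurable (Eventually.of_forall fun p => by
        rw [Complex.norm_real]; exact abs_hilbK_le hy _)
  have hint' := hint.swap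
  have e1 : ∫ x in Ioo (-1 : ℝ) 1, (x : ℂ) * prodH ν x *
        ∫ ξ in Ioo (-1 : ℝ) 1, prodH ν ξ * (hilbK y (x - ξ) : ℂ) =
      ∫ x, ∫ ξ, (x : ℂ) * prodH ν x * prodH ν ξ * (hilbK y (x - ξ) : ℂ) ∂m ∂m := by
    refine integral_congr_ae (Eventually.of_forall fun x => ?_)
    simp only [← integral_const_mul, mul_assoc]
    rfl
  have e2 := integral_integral_swap (f := fun x ξ : ℝ =>
    (x : ℂ) * prodH ν x * prodH ν ξ * (hilbK y (x - ξ) : ℂ)) hint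
  have e3 : ∫ x in Ioo (-1 : ℝ) 1, prodH ν x *
        ∫ ξ in Ioo (-1 : ℝ) 1, prodH ν ξ * (((x - ξ) * hilbK y (x - ξ) : ℝ) : ℂ) =
      ∫ x, ∫ ξ, ((x : ℂ) * prodH ν x * prodH ν ξ * (hilbK y (x - ξ) : ℂ) +
        (ξ : ℂ) * prodH ν ξ * prodH ν x * (hilbK y (ξ - x) : ℂ)) ∂m ∂m := by
    refine integral_congr_ae (Eventually.of_forall fun x => ?_)
    simp only [← integral_const_mul]
    refine integral_congr_ae (Eventually.of_forall fun ξ => ?_)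
    have : hilbK y (ξ - x) = -hilbK y (x - ξ) := by rw [← hilbK_neg, neg_sub]
    simp only [this]
    push_cast
    ring
  have e4 : ∫ x, ∫ ξ, ((x : ℂ) * prodH ν x * prodH ν ξ * (hilbK y (x - ξ) : ℂ) +
        (ξ : ℂ) * prodH ν ξ * prodH ν x * (hilbK y (ξ - x) : ℂ)) ∂m ∂m =
      (∫ x, ∫ ξ, (x : ℂ) * prodH ν x * prodH ν ξ * (hilbK y (x - ξ) : ℂ) ∂m ∂m) +
        ∫ ξ, ∫ x, (x : ℂ) * prodH ν x * prodH ν ξ * (hilbK y (x - ξ) : ℂ) ∂m ∂m :=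
    integral_integral_add hint hint'
  rw [e3, e4, ← e2, e1, two_mul]

theorem norm_mul_hilbK_le (y t : ℝ) : ‖((t * hilbK y t : ℝ) : ℂ)‖ ≤ 1 := by
  rw [Complex.norm_real, Real.norm_eq_abs, abs_mul]
  exact abs_mul_hilbK_le y t

theorem tendsto_mul_hilbK {t : ℝ} (ht : t ≠ 0) :
    Tendsto (fun y : ℝ => ((t * hilbK y t : ℝ) : ℂ)) (𝓝[>] 0) (𝓝 1) := by
  have h : ContinuousAt (fun y : ℝ => t * (t / (t ^ 2 + y ^ 2))) 0 := by
    refine ContinuousAt.mul continuousAt_const (ContinuousAt.div continuousAt_const (by fun_prop) ?_)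
    positivity
  have h2 := h.tendsto.mono_left (nhdsWithin_le_nhds (s := Ioi 0))
  have e : t * (t / (t ^ 2 + 0 ^ 2)) = 1 := by field_simp; ring
  rw [e] at h2
  have := (Complex.continuous_ofReal.tendsto 1).comp h2
  rw [Complex.ofReal_one] at this
  exact this

theorem integrableOn_prodH_mul_mul_hilbK (ν : ℂ) {y : ℝ} (hy : 0 < y) (x : ℝ) :
    IntegrableOn (fun ξ : ℝ => prodH ν ξ * (((x - ξ) * hilbK y (x - ξ) : ℝ) : ℂ)) (Ioo (-1) 1) := by
  have hc := continuous_hilbK hy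
  exact integrableOn_mul_of_bounded (integrableOn_prodH ν) (C := 1)
    (Complex.continuous_ofReal.comp (by fun_prop)) fun ξ => norm_mul_hilbK_le _ _

theorem tendsto_double_integral (ν : ℂ) :
    Tendsto (fun y : ℝ => ∫ x in Ioo (-1 : ℝ) 1, prodH ν x *
        ∫ ξ in Ioo (-1 : ℝ) 1, prodH ν ξ * (((x - ξ) * hilbK y (x - ξ) : ℝ) : ℂ)) (𝓝[>] 0)
      (𝓝 (legPair ν ν ^ 2)) := by
  have hle : ∀ x y : ℝ, ‖∫ ξ in Ioo (-1 : ℝ) 1,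
      prodH ν ξ * (((x - ξ) * hilbK y (x - ξ) : ℝ) : ℂ)‖ ≤ ∫ ξ in Ioo (-1 : ℝ) 1, ‖prodH ν ξ‖ :=
    fun x y => norm_integral_le_of_norm_le (integrableOn_prodH ν).norm
      (Eventually.of_forall fun ξ => by
        rw [norm_mul]
        exact mul_le_of_le_one_right (norm_nonneg _) (norm_mul_hilbK_le _ _))
  have e : legPair ν ν ^ 2 = ∫ x in Ioo (-1 : ℝ) 1, prodH ν x * legPair ν ν := by
    rw [integral_mul_const, integral_prodH, sq]
  rw [e]
  refine tendsto_integral_filter_of_dominated_convergence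
    (fun x => ‖prodH ν x‖ * ∫ ξ in Ioo (-1 : ℝ) 1, ‖prodH ν ξ‖) ?_ ?_
    ((integrableOn_prodH ν).norm.mul_const _) ?_
  · filter_upwards [self_mem_nhdsWithin] with y hy
    have hc := continuous_hilbK hy
    refine (integrableOn_prodH ν).1.mul (Continuous.aestronglyMeasurable ?_)
    refine continuous_of_dominated (bound := fun ξ => ‖prodH ν ξ‖)
      (fun x => (integrableOn_prodH_mul_mul_hilbK ν hy x).1)
      (fun x => Eventually.of_forall fun ξ => ?_) (integrableOn_prodH ν).norm
      (Eventually.of_forall fun ξ => ?_)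
    · rw [norm_mul]
      exact mul_le_of_le_one_right (norm_nonneg _) (norm_mul_hilbK_le _ _)
    · exact continuous_const.mul (Complex.continuous_ofReal.comp (by fun_prop))
  · filter_upwards with y
    refine Eventually.of_forall fun x => ?_
    rw [norm_mul]
    have := hle x y
    gcongr
  · refine Eventually.of_forall fun x => ?_
    refine Tendsto.const_mul (prodH ν x) ?_
    rw [← integral_prodH]
    refine tendsto_integral_filter_of_dominated_convergence (fun ξ => ‖prodH ν ξ‖) ?_ ?_
      (integrableOn_prodH ν).norm ?_
    · filter_upwards [self_mem_nhdsWithin] with y hy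
      exact (integrableOn_prodH_mul_mul_hilbK ν hy x).1
    · filter_upwards with y
      refine Eventually.of_forall fun ξ => ?_
      rw [norm_mul]
      exact mul_le_of_le_one_right (norm_nonneg _) (norm_mul_hilbK_le _ _)
    -- The regularised t/(t² + y²), multiplied by t, tends to 1 except on the diagonal, which is a
    -- null set.
    · have hae : ∀ᵐ ξ ∂(volume.restrict (Ioo (-1 : ℝ) 1)), ξ ≠ x :=
        ae_restrict_of_ae (Measure.ae_ne volume x)
      filter_upwards [hae] with ξ hξ
      have := (tendsto_mul_hilbK (sub_ne_zero.2 hξ.symm)).const_mul (prodH ν ξ)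
      rwa [mul_one] at this

/-- The bounds with exponents -1/8 for H and -3/4 for its regularised transform combine to the
integrable majorant (1 - x²)^(-7/8), independent of y. -/
theorem tendsto_integral_hilbert (ν : ℂ) (hW : legW ν ≠ 0) :
    Tendsto (fun y : ℝ => ∫ x in Ioo (-1 : ℝ) 1, (x : ℂ) * prodH ν x *
        ∫ ξ in Ioo (-1 : ℝ) 1, prodH ν ξ * (hilbK y (x - ξ) : ℂ)) (𝓝[>] 0)
      (𝓝 (∫ x in Ioo (-1 : ℝ) 1, (x : ℂ) * prodH ν x *
        ((legFr ν x ^ 2 - legF ν x ^ 2) / legW ν))) := by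
  obtain ⟨B, hB0, hB⟩ := exists_prod_bound ν
  obtain ⟨C, hC0, hC⟩ := exists_norm_hilbert_le ν
  refine tendsto_integral_filter_of_dominated_convergence
    (fun x => B * C * (1 - x ^ 2) ^ (-(7 / 8) : ℝ)) ?_ ?_
    ((integrableOn_one_sub_sq_rpow (by norm_num) (by norm_num)).const_mul _) ?_
  · filter_upwards [self_mem_nhdsWithin] with y hy
    refine (integrableOn_id_mul_prodH ν).1.mul (Continuous.aestronglyMeasurable ?_)
    have hc := continuous_hilbK hy
    refine continuous_of_dominated (bound := fun ξ => ‖prodH ν ξ‖ * y⁻¹)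
      (fun x => (integrableOn_prodH_mul_hilbK ν hy x).1)
      (fun x => Eventually.of_forall fun ξ => ?_) ((integrableOn_prodH ν).norm.mul_const _)
      (Eventually.of_forall fun ξ => ?_)
    · rw [norm_mul, Complex.norm_real]
      have := abs_hilbK_le hy (x - ξ)
      rw [← Real.norm_eq_abs] at this
      gcongr
    · exact continuous_const.mul (Complex.continuous_ofReal.comp (by fun_prop))
  · filter_upwards [self_mem_nhdsWithin] with y hy
    refine (ae_restrict_iff' measurableSet_Ioo).2 (Eventually.of_forall fun x hx => ?_)
    have hp := one_sub_sq_pos hx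
    have h1 : ‖(x : ℂ)‖ ≤ 1 := by
      rw [Complex.norm_real, Real.norm_eq_abs, abs_le]
      exact ⟨hx.1.le, hx.2.le⟩
    rw [norm_mul, norm_mul]
    calc _ ≤ (1 * (B * (1 - x ^ 2) ^ (-(1 / 8) : ℝ))) * (C * (1 - x ^ 2) ^ (-(3 / 4) : ℝ)) := by
          gcongr
          · exact (hB x hx).1
          · exact hC x hx y hy
      _ = B * C * ((1 - x ^ 2) ^ (-(1 / 8) : ℝ) * (1 - x ^ 2) ^ (-(3 / 4) : ℝ)) := by ring
      _ = _ := by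
          rw [← Real.rpow_add hp]; norm_num
  · refine (ae_restrict_iff' measurableSet_Ioo).2 (Eventually.of_forall fun x hx => ?_)
    refine Tendsto.const_mul _ ((tendsto_sysY0_sub ν hW hx).congr' ?_)
    filter_upwards [self_mem_nhdsWithin] with y hy
    exact sysY0_sub_eq ν hy x

/-! ### The integral of `x P_ν(x) ^ 3 P_ν(-x)` -/

/-- Three factors are singular at -1 and one at 1. The milder exponent at 1 is weakened to -3/8, at
the cost of the constant 2, to obtain a symmetric weight. -/
theorem norm_quartic_le {ν : ℂ} {B : ℝ} (hB0 : 0 ≤ B) (hB : ∀ x ∈ Ioo (-1 : ℝ) 1,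
      ‖legF ν x‖ ≤ B * (1 + x) ^ (-(1 / 8) : ℝ) ∧ ‖legD ν x‖ ≤ B * (1 - x))
    {x : ℝ} (hx : x ∈ Ioo (-1 : ℝ) 1) :
    ‖(x : ℂ) * legF ν x ^ 3 * legFr ν x‖ ≤ 2 * B ^ 4 * (1 - x ^ 2) ^ (-(3 / 8) : ℝ) := by
  have hx1 : 0 < 1 - x := by linarith [hx.2]
  have hx2 : 0 < 1 + x := by linarith [hx.1]
  have h1 : ‖(x : ℂ)‖ ≤ 1 := by
    rw [Complex.norm_real, Real.norm_eq_abs, abs_le]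
    exact ⟨hx.1.le, hx.2.le⟩
  have h2 := (hB x hx).1
  have h3 := (norm_legFr_le hB hx).1
  have e1 : ((1 + x) ^ (-(1 / 8) : ℝ)) ^ 3 = (1 + x) ^ (-(3 / 8) : ℝ) := by
    rw [← Real.rpow_natCast, ← Real.rpow_mul hx2.le]; norm_num
  have e2 : (1 - x) ^ (-(1 / 8) : ℝ) = (1 - x) ^ (1 / 4 : ℝ) * (1 - x) ^ (-(3 / 8) : ℝ) := by
    rw [← Real.rpow_add hx1]; norm_num
  have e3 : (1 - x) ^ (1 / 4 : ℝ) ≤ 2 := by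
    calc (1 - x) ^ (1 / 4 : ℝ) ≤ 2 ^ (1 / 4 : ℝ) :=
          Real.rpow_le_rpow hx1.le (by linarith [hx.1]) (by norm_num)
      _ ≤ 2 ^ (1 : ℝ) := Real.rpow_le_rpow_of_exponent_le (by norm_num) (by norm_num)
      _ = 2 := Real.rpow_one 2
  have p1 := Real.rpow_nonneg hx1.le (-(3 / 8))
  have p2 := Real.rpow_nonneg hx2.le (-(3 / 8))
  rw [norm_mul, norm_mul, norm_pow, one_sub_sq_rpow hx]
  calc _ ≤ 1 * (B * (1 + x) ^ (-(1 / 8) : ℝ)) ^ 3 * (B * (1 - x) ^ (-(1 / 8) : ℝ)) := by gcongr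
    _ = B ^ 4 * (((1 + x) ^ (-(1 / 8) : ℝ)) ^ 3 * (1 - x) ^ (-(1 / 8) : ℝ)) := by ring
    _ = B ^ 4 * ((1 + x) ^ (-(3 / 8) : ℝ) *
          ((1 - x) ^ (1 / 4 : ℝ) * (1 - x) ^ (-(3 / 8) : ℝ))) := by rw [e1, e2]
    _ ≤ B ^ 4 * ((1 + x) ^ (-(3 / 8) : ℝ) * (2 * (1 - x) ^ (-(3 / 8) : ℝ))) := by gcongr
    _ = _ := by ring

theorem integrableOn_quartic (ν : ℂ) :
    IntegrableOn (fun x : ℝ => (x : ℂ) * legF ν x ^ 3 * legFr ν x) (Ioo (-1) 1) := by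
  obtain ⟨B, hB0, hB⟩ := exists_legendre_bound ‖ν‖
  refine integrableOn_of_norm_le ?_ (r := 3 / 8) (by norm_num) (by norm_num)
    fun x hx => norm_quartic_le hB0 (hB ν le_rfl) hx
  exact (Continuous.continuousOn Complex.continuous_ofReal).mul ((continuousOn_legF_real ν).pow 3)
    |>.mul (continuousOn_legFr_real ν)

/-- The integral of `x P_ν(x) ^ 3 P_ν(-x)`. -/
@[irreducible] noncomputable def legQuartic (ν : ℂ) : ℂ :=
  ∫ x in Ioo (-1 : ℝ) 1, (x : ℂ) * legF ν x ^ 3 * legFr ν x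

theorem legQuartic_of_ne (ν : ℂ) (hW : legW ν ≠ 0) :
    legQuartic ν = -(legW ν * legPair ν ν ^ 2 / 4) := by
  have h1 := (tendsto_integral_hilbert ν hW).const_mul 2
  have h2 := tendsto_nhds_unique (h1.congr' (by
    filter_upwards [self_mem_nhdsWithin] with y hy
    exact two_mul_integral_hilbert ν hy)) (tendsto_double_integral ν)
  have hr := setIntegral_comp_neg fun x : ℝ => (x : ℂ) * legF ν x ^ 3 * legFr ν x
  have hi := integrableOn_quartic ν
  have hi' : IntegrableOn (fun x : ℝ => ((-x : ℝ) : ℂ) * legF ν ((-x : ℝ) : ℂ) ^ 3 *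
      legFr ν ((-x : ℝ) : ℂ)) (Ioo (-1) 1) := by
    rw [← intervalIntegrable_iff_integrableOn_Ioo_of_le (by norm_num)] at hi ⊢
    have := (hi.comp_sub_left 0).symm
    simpa using this
  -- Since f and g are exchanged by reflection, xfg³ at x is minus xf³g at -x, and both halves have
  -- the same integral up to that sign.
  have e : ∀ x : ℝ, (x : ℂ) * prodH ν x * ((legFr ν x ^ 2 - legF ν x ^ 2) / legW ν) =
      (-(legW ν)⁻¹) * (((x : ℂ) * legF ν x ^ 3 * legFr ν x) + ((-x : ℝ) : ℂ) *
        legF ν ((-x : ℝ) : ℂ) ^ 3 * legFr ν ((-x : ℝ) : ℂ)) := by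
    intro x
    simp only [prodH, legFr, Complex.ofReal_neg, neg_neg]
    ring
  simp only [e] at h2
  rw [integral_const_mul, integral_add hi hi', hr] at h2
  rw [legQuartic]
  field_simp at h2 ⊢
  linear_combination -h2

theorem continuous_legQuartic : Continuous legQuartic := by
  rw [continuous_iff_continuousAt]
  intro ν₀
  obtain ⟨B, hB0, hB⟩ := exists_legendre_bound (‖ν₀‖ + 1)
  have hmem : ∀ᶠ ν : ℂ in 𝓝 ν₀, ‖ν‖ < ‖ν₀‖ + 1 :=
    continuous_norm.continuousAt.eventually_lt continuousAt_const (by linarith)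
  have efun : legQuartic = fun ν => ∫ x in Ioo (-1 : ℝ) 1, (x : ℂ) * legF ν x ^ 3 * legFr ν x := by
    funext ν; rw [legQuartic]
  rw [efun]
  refine tendsto_integral_filter_of_dominated_convergence
    (fun x : ℝ => 2 * B ^ 4 * (1 - x ^ 2) ^ (-(3 / 8) : ℝ)) ?_ ?_
    ((integrableOn_one_sub_sq_rpow (by norm_num) (by norm_num)).const_mul _) ?_
  · exact Eventually.of_forall fun ν => (integrableOn_quartic ν).1
  · filter_upwards [hmem] with ν hν
    refine (ae_restrict_iff' measurableSet_Ioo).2 (Eventually.of_forall fun x hx => ?_)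
    exact norm_quartic_le hB0 (hB _ hν.le) hx
  · refine (ae_restrict_iff' measurableSet_Ioo).2 (Eventually.of_forall fun x hx => ?_)
    have h1 := (continuous_legF_degree hx).tendsto ν₀
    have h2 := (continuous_legF_degree (neg_mem_Ioo_one hx)).tendsto ν₀
    have h3 := ((h1.pow 3).const_mul (x : ℂ)).mul h2
    simp only [legFr, ← Complex.ofReal_neg]
    exact h3

/-- The argument through the Wronskian fails at integers. Zeros of sin(πν) are simple, hence
isolated, and both sides are continuous in ν. -/
theorem legQuartic_eq (ν : ℂ) :
    legQuartic ν = Complex.sin (π * ν) / (2 * π) * legPair ν ν ^ 2 := by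
  have hpi : (π : ℂ) ≠ 0 := by exact_mod_cast Real.pi_ne_zero
  have hne : ∀ μ, Complex.sin (π * μ) ≠ 0 →
      legQuartic μ = Complex.sin (π * μ) / (2 * π) * legPair μ μ ^ 2 := by
    intro μ hμ
    have hW : legW μ ≠ 0 := by
      rw [legW]
      exact neg_ne_zero.2 (div_ne_zero (mul_ne_zero two_ne_zero hμ) hpi)
    rw [legQuartic_of_ne μ hW, legW]
    field_simp
    ring
  by_cases h : Complex.sin (π * ν) = 0
  swap
  · exact hne ν h
  have hd : HasDerivAt (fun μ : ℂ => Complex.sin (π * μ)) (Complex.cos (π * ν) * π) ν := by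
    have h := (hasDerivAt_id ν).const_mul (π : ℂ)
    rw [mul_one] at h
    exact (Complex.hasDerivAt_sin _).comp _ h
  have hc : Complex.cos (π * ν) ≠ 0 := fun hc => by
    have := Complex.sin_sq_add_cos_sq (π * ν)
    rw [h, hc] at this
    norm_num at this
  have hev := hd.eventually_ne (c := 0) (mul_ne_zero hc hpi)
  have h1 : Tendsto legQuartic (𝓝[≠] ν) (𝓝 (legQuartic ν)) :=
    (continuous_legQuartic.tendsto ν).mono_left nhdsWithin_le_nhds
  have h2 : Tendsto (fun μ => Complex.sin (π * μ) / (2 * π) * legPair μ μ ^ 2) (𝓝[≠] ν)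
      (𝓝 (Complex.sin (π * ν) / (2 * π) * legPair ν ν ^ 2)) := by
    have hs : Continuous fun μ : ℂ => Complex.sin (π * μ) / (2 * π) := by fun_prop
    exact ((hs.mul ((continuous_legPair_comp continuous_id continuous_id).pow 2)).tendsto
      ν).mono_left nhdsWithin_le_nhds
  refine tendsto_nhds_unique (h1.congr' ?_) h2
  filter_upwards [hev] with μ hμ using hne μ hμ

theorem legQuartic_eq_of_ne (ν : ℂ) (hν : ν ≠ -1 / 2) :
    legQuartic ν = Complex.sin (2 * ν * π) * Complex.cos (ν * π) / ((2 * ν + 1) ^ 2 * π) := by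
  have hpi : (π : ℂ) ≠ 0 := by exact_mod_cast Real.pi_ne_zero
  have h2 : 2 * ν + 1 ≠ 0 := fun h => hν (by linear_combination h / 2)
  have hM : legPair ν ν = 2 * Complex.cos (π * ν) / (2 * ν + 1) := by
    rw [eq_div_iff h2, mul_comm, legPair_self_mul]
  have e : (2 : ℂ) * ν * π = 2 * (π * ν) := by ring
  rw [legQuartic_eq, hM, e, Complex.sin_two_mul, mul_comm ν]
  field_simp

theorem legQuartic_neg_half : legQuartic (-1 / 2) = -π / 2 := by
  have hpi : (π : ℂ) ≠ 0 := by exact_mod_cast Real.pi_ne_zero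
  have e : (π : ℂ) * (-1 / 2) = -(π / 2) := by ring
  rw [legQuartic_eq, legPair_neg_half, e, Complex.sin_neg, Complex.sin_pi_div_two]
  field_simp

theorem intervalIntegrable_legendreP (ν : ℂ) : IntervalIntegrable
    (fun x : ℝ => (x : ℂ) * legendreP ν x ^ 3 * legendreP ν (-x)) volume (-1) 1 := by
  rw [intervalIntegrable_iff_integrableOn_Ioo_of_le (by norm_num)]
  refine (integrableOn_quartic ν).congr_fun (fun x hx => ?_) measurableSet_Ioo
  have hx' := neg_mem_Ioo_one hx
  simp only [legFr]
  rw [legendreP_eq_legF ν ⟨hx.1, hx.2.le⟩, legendreP_eq_legF ν ⟨hx'.1, hx'.2.le⟩,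
    Complex.ofReal_neg]

theorem integral_legendreP_eq (ν : ℂ) :
    ∫ x in (-1 : ℝ)..1, (x : ℂ) * legendreP ν x ^ 3 * legendreP ν (-x) = legQuartic ν := by
  rw [intervalIntegral.integral_of_le (by norm_num), integral_Ioc_eq_integral_Ioo, legQuartic]
  refine setIntegral_congr_fun measurableSet_Ioo fun x hx => ?_
  have hx' := neg_mem_Ioo_one hx
  simp only [legFr]
  rw [legendreP_eq_legF ν ⟨hx.1, hx.2.le⟩, legendreP_eq_legF ν ⟨hx'.1, hx'.2.le⟩,
    Complex.ofReal_neg]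

/-! ### Transport from degree -1/2 along algebraic changes of variable -/

/-- A change of variables that carries the hypergeometric equation of `K(√s)` to the Legendre
equation with eigenvalue `l` in the variable `x`, with multiplier `A`. -/
structure LegTransform (l : ℝ) (x x' A A' ρ ρ' s s' : ℝ → ℝ) (C : ℝ) : Prop where
  hasDerivAt_x : ∀ p ∈ Ioo (0 : ℝ) 1, HasDerivAt x (x' p) p
  hasDerivAt_A : ∀ p ∈ Ioo (0 : ℝ) 1, HasDerivAt A (A' p) p
  hasDerivAt_ρ : ∀ p ∈ Ioo (0 : ℝ) 1, HasDerivAt ρ (ρ' p) p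
  hasDerivAt_s : ∀ p ∈ Ioo (0 : ℝ) 1, HasDerivAt s (s' p) p
  one_sub_sq : ∀ p ∈ Ioo (0 : ℝ) 1, 0 < 1 - x p ^ 2
  s_mem : ∀ p ∈ Ioo (0 : ℝ) 1, s p ∈ Ioo (0 : ℝ) 1
  A_ne : ∀ p ∈ Ioo (0 : ℝ) 1, A p ≠ 0
  deriv_neg : ∀ p ∈ Ioo (0 : ℝ) 1, x' p < 0
  eq1 : ∀ p ∈ Ioo (0 : ℝ) 1, ρ p * x' p = (1 - x p ^ 2) * A' p
  eq2 : ∀ p ∈ Ioo (0 : ℝ) 1, (1 - x p ^ 2) * A p ^ 2 * s' p = C * (s p * (1 - s p)) * x' p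
  eq3 : ∀ p ∈ Ioo (0 : ℝ) 1, C * s' p / 4 + A p * ρ' p = -l * x' p * A p ^ 2

theorem mem_Ioo_of_one_sub_sq_pos {x : ℝ} (h : 0 < 1 - x ^ 2) : x ∈ Ioo (-1 : ℝ) 1 := by
  have : |x| < 1 := (sq_lt_one_iff_abs_lt_one x).1 (by linarith)
  exact abs_lt.1 this

section

variable {l : ℝ} {x x' A A' ρ ρ' s s' : ℝ → ℝ} {C : ℝ}

theorem LegTransform.mem (h : LegTransform l x x' A A' ρ ρ' s s' C) {p : ℝ}
    (hp : p ∈ Ioo (0 : ℝ) 1) : x p ∈ Ioo (-1 : ℝ) 1 :=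
  mem_Ioo_of_one_sub_sq_pos (h.one_sub_sq p hp)

theorem hasDerivAt_comp_real {f : ℝ → ℂ} {f' : ℂ} {x : ℝ → ℝ} {x' p : ℝ}
    (hf : HasDerivAt f f' (x p)) (hx : HasDerivAt x x' p) :
    HasDerivAt (fun p => f (x p)) ((x' : ℂ) * f') p := by
  have := hf.scomp p hx
  rwa [Complex.real_smul] at this

/-- Solutions of the Legendre system in a parameter, with prescribed behaviour where the argument
tends to `1`. -/
theorem eq_legF_of_system {ν : ℂ} (hW : legW ν ≠ 0) {x x' : ℝ → ℝ} {z Z : ℝ → ℂ}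
    (hx : ∀ p ∈ Ioo (0 : ℝ) 1, x p ∈ Ioo (-1 : ℝ) 1)
    (hxd : ∀ p ∈ Ioo (0 : ℝ) 1, HasDerivAt x (x' p) p)
    (hz : ∀ p ∈ Ioo (0 : ℝ) 1, HasDerivAt z (x' p * (Z p / (1 - (x p : ℂ) ^ 2))) p)
    (hZ : ∀ p ∈ Ioo (0 : ℝ) 1, HasDerivAt Z (x' p * (-(ν * (ν + 1)) * z p)) p)
    {F : Filter ℝ} [F.NeBot] (hF : ∀ᶠ p in F, p ∈ Ioo (0 : ℝ) 1) {z₁ : ℂ}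
    (hx1 : Tendsto x F (𝓝 1)) (hz1 : Tendsto z F (𝓝 z₁)) (hZ1 : Tendsto Z F (𝓝 0)) {p : ℝ}
    (hp : p ∈ Ioo (0 : ℝ) 1) : z p = z₁ * legF ν (x p) := by
  have hx1' : Tendsto x F (𝓝[<] 1) :=
    tendsto_nhdsWithin_iff.2 ⟨hx1, hF.mono fun q hq => (hx q hq).2⟩
  have dF : ∀ p ∈ Ioo (0 : ℝ) 1, HasDerivAt (fun p => legF ν (x p))
      (x' p * (legD ν (x p) / (1 - (x p : ℂ) ^ 2))) p := fun p hp =>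
    hasDerivAt_comp_real (hasDerivAt_legF_real ν (hx p hp)) (hxd p hp)
  have dD : ∀ p ∈ Ioo (0 : ℝ) 1, HasDerivAt (fun p => legD ν (x p))
      (x' p * (-(ν * (ν + 1)) * legF ν (x p))) p := fun p hp =>
    hasDerivAt_comp_real (hasDerivAt_legD_real ν (hx p hp)) (hxd p hp)
  have dFr : ∀ p ∈ Ioo (0 : ℝ) 1, HasDerivAt (fun p => legFr ν (x p))
      (x' p * (legDr ν (x p) / (1 - (x p : ℂ) ^ 2))) p := fun p hp =>
    hasDerivAt_comp_real (hasDerivAt_legFr_real ν (hx p hp)) (hxd p hp)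
  have dDr : ∀ p ∈ Ioo (0 : ℝ) 1, HasDerivAt (fun p => legDr ν (x p))
      (x' p * (-(ν * (ν + 1)) * legFr ν (x p))) p := fun p hp =>
    hasDerivAt_comp_real (hasDerivAt_legDr_real ν (hx p hp)) (hxd p hp)
  have c1 : ∀ q ∈ Ioo (0 : ℝ) 1, ∀ r ∈ Ioo (0 : ℝ) 1,
      legF ν (x q) * Z q - legD ν (x q) * z q = legF ν (x r) * Z r - legD ν (x r) * z r :=
    fun q hq r hr => const_of_hasDerivAt_zero
      (f := fun q => legF ν (x q) * Z q - legD ν (x q) * z q) isOpen_Ioo isPreconnected_Ioo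
      (fun p hp => (((dF p hp).mul (hZ p hp)).sub ((dD p hp).mul (hz p hp))).congr_deriv
        (by ring)) hq hr
  have c2 : ∀ q ∈ Ioo (0 : ℝ) 1,
      legFr ν (x q) * Z q - legDr ν (x q) * z q = legFr ν (x p) * Z p - legDr ν (x p) * z p :=
    fun q hq => const_of_hasDerivAt_zero
      (f := fun q => legFr ν (x q) * Z q - legDr ν (x q) * z q) isOpen_Ioo isPreconnected_Ioo
      (fun p hp => (((dFr p hp).mul (hZ p hp)).sub ((dDr p hp).mul (hz p hp))).congr_deriv
        (by ring)) hq hp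
  have lF := (continuousAt_legF_one ν).comp hx1'
  have lD := (tendsto_legD_one ν).comp hx1'
  -- The Wronskian with f is constant and tends to 0 where x → 1, because both quasi-derivatives do.
  -- Vanishing Wronskian means proportionality to f.
  have c0 : ∀ q ∈ Ioo (0 : ℝ) 1, legF ν (x q) * Z q - legD ν (x q) * z q = 0 := by
    intro q hq
    have hl := (lF.mul hZ1).sub (lD.mul hz1)
    rw [mul_zero, zero_mul, sub_zero] at hl
    refine tendsto_nhds_unique (tendsto_const_nhds.congr' ?_) hl
    filter_upwards [hF] with r hr using c1 q hq r hr
  -- The Wronskian with the second solution is also constant. Divided by W it gives the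
  -- proportionality factor, without dividing by f, which might vanish.
  set κ := -(legFr ν (x p) * Z p - legDr ν (x p) * z p) / legW ν with hκ
  have hzF : ∀ q ∈ Ioo (0 : ℝ) 1, z q = κ * legF ν (x q) := by
    intro q hq
    have hw : legF ν (x q) * legDr ν (x q) - legD ν (x q) * legFr ν (x q) = legW ν :=
      wronskian_eq ν (hx q hq)
    rw [hκ, ← c2 q hq, div_mul_eq_mul_div, eq_div_iff hW, ← hw]
    linear_combination legFr ν (x q) * c0 q hq
  have hκz : z₁ = κ := by
    refine tendsto_nhds_unique hz1 ?_
    have := lF.const_mul κ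
    rw [mul_one] at this
    refine this.congr' ?_
    filter_upwards [hF] with q hq using (hzF q hq).symm
  rw [hκz, hzF p hp]

/-- Reflect: replacing x by -x and Z by -Z preserves the system and moves the endpoint to 1. -/
theorem eq_legFr_of_system {ν : ℂ} (hW : legW ν ≠ 0) {x x' : ℝ → ℝ} {z Z : ℝ → ℂ}
    (hx : ∀ p ∈ Ioo (0 : ℝ) 1, x p ∈ Ioo (-1 : ℝ) 1)
    (hxd : ∀ p ∈ Ioo (0 : ℝ) 1, HasDerivAt x (x' p) p)
    (hz : ∀ p ∈ Ioo (0 : ℝ) 1, HasDerivAt z (x' p * (Z p / (1 - (x p : ℂ) ^ 2))) p)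
    (hZ : ∀ p ∈ Ioo (0 : ℝ) 1, HasDerivAt Z (x' p * (-(ν * (ν + 1)) * z p)) p)
    {F : Filter ℝ} [F.NeBot] (hF : ∀ᶠ p in F, p ∈ Ioo (0 : ℝ) 1) {z₁ : ℂ}
    (hx1 : Tendsto x F (𝓝 (-1))) (hz1 : Tendsto z F (𝓝 z₁)) (hZ1 : Tendsto Z F (𝓝 0)) {p : ℝ}
    (hp : p ∈ Ioo (0 : ℝ) 1) : z p = z₁ * legFr ν (x p) := by
  have h := eq_legF_of_system (ν := ν) hW (x := fun p => -x p) (x' := fun p => -x' p) (z := z)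
    (Z := fun p => -Z p) (fun p hp => neg_mem_Ioo_one (hx p hp)) (fun p hp => (hxd p hp).neg)
    (fun p hp => (hz p hp).congr_deriv (by push_cast; ring))
    (fun p hp => (hZ p hp).neg.congr_deriv (by push_cast; ring)) hF
    (by simpa using hx1.neg) hz1 (by simpa using hZ1.neg) hp
  rwa [Complex.ofReal_neg] at h

/-- Transport of the Legendre system of degree `-1/2` along a `LegTransform`. -/
theorem LegTransform.system (h : LegTransform l x x' A A' ρ ρ' s s' C) {k K : ℝ → ℂ}
    (hk : ∀ t ∈ Ioo (-1 : ℝ) 1, HasDerivAt k (K t / (1 - (t : ℂ) ^ 2)) t)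
    (hK : ∀ t ∈ Ioo (-1 : ℝ) 1, HasDerivAt K (1 / 4 * k t) t) {p : ℝ} (hp : p ∈ Ioo (0 : ℝ) 1) :
    HasDerivAt (fun p => (A p : ℂ) * k (1 - 2 * s p))
      (x' p * (((ρ p : ℂ) * k (1 - 2 * s p) - C / (2 * A p) * K (1 - 2 * s p)) /
        (1 - (x p : ℂ) ^ 2))) p ∧
    HasDerivAt (fun p => (ρ p : ℂ) * k (1 - 2 * s p) - C / (2 * A p) * K (1 - 2 * s p))
      (x' p * (-l * (A p * k (1 - 2 * s p)))) p := by
  have hs := h.s_mem p hp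
  have ht : 1 - 2 * s p ∈ Ioo (-1 : ℝ) 1 := ⟨by linarith [hs.2], by linarith [hs.1]⟩
  have hds : HasDerivAt (fun p => 1 - 2 * s p) (-(2 * s' p)) p :=
    ((h.hasDerivAt_s p hp).const_mul 2).const_sub 1
  have dk := (hk _ ht).scomp p hds
  have dK := (hK _ ht).scomp p hds
  have dA := (h.hasDerivAt_A p hp).ofReal_comp
  have dρ := (h.hasDerivAt_ρ p hp).ofReal_comp
  have hA : (A p : ℂ) ≠ 0 := by exact_mod_cast h.A_ne p hp
  have hx' : (x' p : ℂ) ≠ 0 := by exact_mod_cast (h.deriv_neg p hp).ne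
  have hP : 1 - (x p : ℂ) ^ 2 ≠ 0 := one_sub_sq_ne (h.mem hp)
  have hs0 : (s p : ℂ) ≠ 0 := by exact_mod_cast hs.1.ne'
  have hs1 : 1 - (s p : ℂ) ≠ 0 := by
    have : (1 - s p : ℝ) ≠ 0 := by linarith [hs.2]
    exact_mod_cast this
  have q1 : (ρ p : ℂ) * x' p = (1 - (x p : ℂ) ^ 2) * A' p := by exact_mod_cast h.eq1 p hp
  have q2 : (1 - (x p : ℂ) ^ 2) * A p ^ 2 * s' p = C * (s p * (1 - s p)) * x' p := by
    exact_mod_cast h.eq2 p hp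
  have q3 : C * (s' p : ℂ) / 4 + A p * ρ' p = -l * x' p * A p ^ 2 := by exact_mod_cast h.eq3 p hp
  have q4 : (ρ p : ℂ) * s' p * A p ^ 2 = A' p * C * (s p * (1 - s p)) := by
    refine mul_right_cancel₀ hx' ?_
    linear_combination s' p * A p ^ 2 * q1 + A' p * q2
  have e4 : 1 - ((1 - 2 * s p : ℝ) : ℂ) ^ 2 = 4 * (s p * (1 - s p)) := by push_cast; ring
  rw [e4] at dk
  simp only [Complex.real_smul, Function.comp_def] at dk dK
  -- By `eq1`, ρ is the quasi-derivative of the multiplier A. By `eq2`, the coefficient of K in the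
  -- quasi-derivative of A k is -C/(2A). Then `eq3` is what the second equation of the system
  -- requires of the coefficient of k.
  constructor
  · refine (dA.mul dk).congr_deriv ?_
    generalize k (1 - 2 * s p) = k₀
    generalize K (1 - 2 * s p) = K₀
    have h1 : (A' p : ℂ) = ρ p * x' p / (1 - (x p : ℂ) ^ 2) := by rw [eq_div_iff hP, q1]; ring
    have h2 : (s' p : ℂ) / (s p * (1 - s p)) = C * x' p / ((1 - (x p : ℂ) ^ 2) * A p ^ 2) := by
      rw [div_eq_div_iff (mul_ne_zero hs0 hs1) (mul_ne_zero hP (pow_ne_zero 2 hA))]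
      linear_combination q2
    have h3 : (A p : ℂ) * (((-(2 * s' p) : ℝ) : ℂ) * (K₀ / (4 * (s p * (1 - s p))))) =
        -(1 / 2) * A p * K₀ * (s' p / (s p * (1 - s p))) := by
      push_cast; field_simp; ring
    rw [h3, h2, h1]
    field_simp
    ring
  · have dAi : HasDerivAt (fun p => (C : ℂ) / (2 * A p)) (-(C * A' p) / (2 * A p ^ 2)) p := by
      have := (dA.const_mul 2).fun_inv (mul_ne_zero two_ne_zero hA)
      have h2 := this.const_mul (C : ℂ)
      simp only [← div_eq_mul_inv] at h2
      refine h2.congr_deriv ?_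
      field_simp
    refine ((dρ.mul dk).sub (dAi.mul dK)).congr_deriv ?_
    generalize k (1 - 2 * s p) = k₀
    generalize K (1 - 2 * s p) = K₀
    have h2 : (C : ℂ) * A' p / A p ^ 2 = ρ p * s' p / (s p * (1 - s p)) := by
      rw [div_eq_div_iff (pow_ne_zero 2 hA) (mul_ne_zero hs0 hs1)]
      linear_combination -q4
    have h3 : (ρ' p : ℂ) = (-l * x' p * A p ^ 2 - C * s' p / 4) / A p := by
      rw [eq_div_iff hA]; linear_combination q3
    have h4 : (ρ p : ℂ) * (((-(2 * s' p) : ℝ) : ℂ) * (K₀ / (4 * (s p * (1 - s p))))) =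
        -(1 / 2) * K₀ * (ρ p * s' p / (s p * (1 - s p))) := by
      push_cast; field_simp; ring
    have h5 : -((C : ℂ) * A' p) / (2 * A p ^ 2) * K₀ = -(1 / 2) * K₀ * (C * A' p / A p ^ 2) := by
      field_simp
    rw [h4, h5, h2, h3]
    push_cast
    field_simp
    ring

theorem hasDerivAt_legD_neg_half {t : ℝ} (ht : t ∈ Ioo (-1 : ℝ) 1) :
    HasDerivAt (fun t : ℝ => legD (-1 / 2) t) (1 / 4 * legF (-1 / 2) t) t :=
  (hasDerivAt_legD_real (-1 / 2) ht).congr_deriv (by ring)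

theorem hasDerivAt_legDr_neg_half {t : ℝ} (ht : t ∈ Ioo (-1 : ℝ) 1) :
    HasDerivAt (fun t : ℝ => legDr (-1 / 2) t) (1 / 4 * legFr (-1 / 2) t) t :=
  (hasDerivAt_legDr_real (-1 / 2) ht).congr_deriv (by ring)

theorem LegTransform.legF_eq (h : LegTransform l x x' A A' ρ ρ' s s' C) {ν : ℂ}
    (hW : legW ν ≠ 0) (hl : (l : ℂ) = ν * (ν + 1)) (hx : Tendsto x (𝓝[>] 0) (𝓝 1))
    (hA : Tendsto A (𝓝[>] 0) (𝓝 1)) (hρ : Tendsto ρ (𝓝[>] 0) (𝓝 0))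
    (hs : Tendsto s (𝓝[>] 0) (𝓝 0)) {p : ℝ} (hp : p ∈ Ioo (0 : ℝ) 1) :
    (A p : ℂ) * legF (-1 / 2) ((1 - 2 * s p : ℝ) : ℂ) = legF ν (x p) := by
  have hmem : ∀ᶠ p in 𝓝[>] (0 : ℝ), p ∈ Ioo (0 : ℝ) 1 := Ioo_mem_nhdsGT one_pos
  have ht : Tendsto (fun p => 1 - 2 * s p) (𝓝[>] 0) (𝓝[<] 1) := by
    refine tendsto_nhdsWithin_iff.2 ⟨by simpa using (hs.const_mul 2).const_sub 1, ?_⟩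
    filter_upwards [hmem] with q hq
    have := (h.s_mem q hq).1
    simp only [mem_Iio]; linarith
  have hAc := (Complex.continuous_ofReal.tendsto 1).comp hA
  have hρc := (Complex.continuous_ofReal.tendsto 0).comp hρ
  simp only [Complex.ofReal_one, Complex.ofReal_zero] at hAc hρc
  have lk := (continuousAt_legF_one (-1 / 2)).comp ht
  have lK := (tendsto_legD_one (-1 / 2)).comp ht
  have sys := fun p (hp : p ∈ Ioo (0 : ℝ) 1) => h.system (fun t ht => hasDerivAt_legF_real _ ht)
    (fun t ht => hasDerivAt_legD_neg_half ht) hp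
  have hz1 := hAc.mul lk
  have hZ1 := (hρc.mul lk).sub (((tendsto_const_nhds (x := (C : ℂ))).div (hAc.const_mul 2) (by simp)).mul lK)
  simp only [mul_one, mul_zero, sub_zero] at hz1 hZ1
  rw [hl] at sys
  have := eq_legF_of_system hW (fun p hp => h.mem hp) h.hasDerivAt_x (fun p hp => (sys p hp).1)
    (fun p hp => (sys p hp).2) hmem hx hz1 hZ1 hp
  rwa [one_mul] at this

/-- The solution regular at the other end is matched as p → 1, where the multiplier need not be 1.
The constant A₁ accounts for the different prefactors of the two elliptic integrals. -/
theorem LegTransform.legFr_eq (h : LegTransform l x x' A A' ρ ρ' s s' C) {ν : ℂ}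
    (hW : legW ν ≠ 0) (hl : (l : ℂ) = ν * (ν + 1)) (hx : Tendsto x (𝓝[<] 1) (𝓝 (-1))) {A₁ : ℝ}
    (hA₁ : A₁ ≠ 0)
    (hA : Tendsto A (𝓝[<] 1) (𝓝 A₁)) (hρ : Tendsto ρ (𝓝[<] 1) (𝓝 0))
    (hs : Tendsto s (𝓝[<] 1) (𝓝 1)) {p : ℝ} (hp : p ∈ Ioo (0 : ℝ) 1) :
    (A p : ℂ) * legFr (-1 / 2) ((1 - 2 * s p : ℝ) : ℂ) = A₁ * legFr ν (x p) := by
  have hmem : ∀ᶠ p in 𝓝[<] (1 : ℝ), p ∈ Ioo (0 : ℝ) 1 := Ioo_mem_nhdsLT one_pos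
  have ht : Tendsto (fun p => 1 - 2 * s p) (𝓝[<] 1) (𝓝[>] (-1)) := by
    refine tendsto_nhdsWithin_iff.2 ⟨?_, ?_⟩
    · have := (hs.const_mul 2).const_sub 1
      norm_num at this
      exact this
    · filter_upwards [hmem] with q hq
      have := (h.s_mem q hq).2
      simp only [mem_Ioi]; linarith
  have hAc := (Complex.continuous_ofReal.tendsto A₁).comp hA
  have hρc := (Complex.continuous_ofReal.tendsto 0).comp hρ
  simp only [Complex.ofReal_zero] at hρc
  have hA₁' : (2 : ℂ) * A₁ ≠ 0 := mul_ne_zero two_ne_zero (by exact_mod_cast hA₁)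
  have lk := (tendsto_legFr_neg_one (-1 / 2)).comp ht
  have lK := (tendsto_legDr_neg_one (-1 / 2)).comp ht
  have sys := fun p (hp : p ∈ Ioo (0 : ℝ) 1) => h.system (fun t ht => hasDerivAt_legFr_real _ ht)
    (fun t ht => hasDerivAt_legDr_neg_half ht) hp
  have hz1 := hAc.mul lk
  have hZ1 := (hρc.mul lk).sub (((tendsto_const_nhds (x := (C : ℂ))).div (hAc.const_mul 2) hA₁').mul lK)
  simp only [mul_one, mul_zero, sub_zero] at hz1 hZ1
  rw [hl] at sys
  exact eq_legFr_of_system hW (fun p hp => h.mem hp) h.hasDerivAt_x (fun p hp => (sys p hp).1)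
    (fun p hp => (sys p hp).2) hmem hx hz1 hZ1 hp

theorem LegTransform.image_eq (h : LegTransform l x x' A A' ρ ρ' s s' C)
    (h0 : Tendsto x (𝓝[>] 0) (𝓝 1)) (h1 : Tendsto x (𝓝[<] 1) (𝓝 (-1))) :
    x '' Ioo 0 1 = Ioo (-1) 1 := by
  have hc : ContinuousOn x (Ioo 0 1) := fun p hp =>
    (h.hasDerivAt_x p hp).continuousAt.continuousWithinAt
  refine Subset.antisymm ?_ fun v hv => ?_
  · rintro _ ⟨p, hp, rfl⟩
    exact h.mem hp
  · have hmem0 : ∀ᶠ p in 𝓝[>] (0 : ℝ), p ∈ Ioo (0 : ℝ) 1 := Ioo_mem_nhdsGT one_pos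
    have hmem1 : ∀ᶠ p in 𝓝[<] (1 : ℝ), p ∈ Ioo (0 : ℝ) 1 := Ioo_mem_nhdsLT one_pos
    obtain ⟨a, ha, hav⟩ := (hmem0.and (h0.eventually (lt_mem_nhds hv.2))).exists
    obtain ⟨b, hb, hbv⟩ := (hmem1.and (h1.eventually (gt_mem_nhds hv.1))).exists
    exact (isPreconnected_Ioo.image x hc).ordConnected.out (mem_image_of_mem x hb)
      (mem_image_of_mem x ha) ⟨hbv.le, hav.le⟩

theorem LegTransform.integral_eq (h : LegTransform l x x' A A' ρ ρ' s s' C)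
    (h0 : Tendsto x (𝓝[>] 0) (𝓝 1)) (h1 : Tendsto x (𝓝[<] 1) (𝓝 (-1))) (φ : ℝ → ℂ) :
    ∫ t in Ioo (-1 : ℝ) 1, φ t = ∫ p in Ioo (0 : ℝ) 1, ((-x' p : ℝ) : ℂ) * φ (x p) := by
  have hanti : StrictAntiOn x (Ioo 0 1) := strictAntiOn_of_deriv_neg (convex_Ioo 0 1)
    (fun p hp => (h.hasDerivAt_x p hp).continuousAt.continuousWithinAt) fun p hp => by
      rw [interior_Ioo] at hp
      rw [(h.hasDerivAt_x p hp).deriv]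
      exact h.deriv_neg p hp
  rw [← h.image_eq h0 h1, integral_image_eq_integral_abs_deriv_smul measurableSet_Ioo
    (fun p hp => (h.hasDerivAt_x p hp).hasDerivWithinAt) hanti.injOn]
  refine setIntegral_congr_fun measurableSet_Ioo fun p hp => ?_
  simp only [Complex.real_smul]
  rw [abs_of_neg (h.deriv_neg p hp)]

theorem ellipticK_sqrt_eq {t : ℝ} (ht : t ∈ Ioo (0 : ℝ) 1) :
    legF (-1 / 2) ((1 - 2 * t : ℝ) : ℂ) = ((2 / π * ellipticK (√t) : ℝ) : ℂ) := by
  have hpi : (π : ℂ) ≠ 0 := by exact_mod_cast Real.pi_ne_zero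
  rw [Complex.ofReal_mul, ellipticK_sqrt ⟨ht.1.le, ht.2⟩]
  push_cast
  field_simp

theorem ellipticK_sqrt_one_sub_eq {t : ℝ} (ht : t ∈ Ioo (0 : ℝ) 1) :
    legFr (-1 / 2) ((1 - 2 * t : ℝ) : ℂ) = ((2 / π * ellipticK (√(1 - t)) : ℝ) : ℂ) := by
  rw [← ellipticK_sqrt_eq ⟨by linarith [ht.2], by linarith [ht.1]⟩, legFr]
  congr 1
  push_cast
  ring

/-- The quartic Legendre integral as an integral over complete elliptic integrals. -/
theorem LegTransform.quartic_eq (h : LegTransform l x x' A A' ρ ρ' s s' C) {ν : ℂ}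
    (hW : legW ν ≠ 0) (hl : (l : ℂ) = ν * (ν + 1)) {A₁ : ℝ} (hA₁ : A₁ ≠ 0)
    (hx0 : Tendsto x (𝓝[>] 0) (𝓝 1)) (hA0 : Tendsto A (𝓝[>] 0) (𝓝 1))
    (hρ0 : Tendsto ρ (𝓝[>] 0) (𝓝 0)) (hs0 : Tendsto s (𝓝[>] 0) (𝓝 0))
    (hx1 : Tendsto x (𝓝[<] 1) (𝓝 (-1))) (hA1 : Tendsto A (𝓝[<] 1) (𝓝 A₁))
    (hρ1 : Tendsto ρ (𝓝[<] 1) (𝓝 0)) (hs1 : Tendsto s (𝓝[<] 1) (𝓝 1)) :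
    legQuartic ν = ((16 / (π ^ 4 * A₁) * ∫ p in Ioo (0 : ℝ) 1,
      -x' p * x p * A p ^ 4 * ellipticK (√(s p)) ^ 3 * ellipticK (√(1 - s p)) : ℝ) : ℂ) ∧
    -legQuartic ν = ((16 / (π ^ 4 * A₁ ^ 3) * ∫ p in Ioo (0 : ℝ) 1,
      -x' p * x p * A p ^ 4 * ellipticK (√(1 - s p)) ^ 3 * ellipticK (√(s p)) : ℝ) : ℂ) := by
  have hpi : (π : ℂ) ≠ 0 := by exact_mod_cast Real.pi_ne_zero
  have hA₁' : (A₁ : ℂ) ≠ 0 := by exact_mod_cast hA₁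
  have ef : ∀ p ∈ Ioo (0 : ℝ) 1, legF ν (x p) =
      A p * ((2 / π * ellipticK (√(s p)) : ℝ) : ℂ) := fun p hp => by
    rw [← ellipticK_sqrt_eq (h.s_mem p hp), h.legF_eq hW hl hx0 hA0 hρ0 hs0 hp]
  have eg : ∀ p ∈ Ioo (0 : ℝ) 1, legFr ν (x p) =
      A p / A₁ * ((2 / π * ellipticK (√(1 - s p)) : ℝ) : ℂ) := fun p hp => by
    rw [← ellipticK_sqrt_one_sub_eq (h.s_mem p hp), div_mul_eq_mul_div,
      h.legFr_eq hW hl hx1 hA₁ hA1 hρ1 hs1 hp, mul_div_cancel_left₀ _ hA₁']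
  -- The second formula is the first integral reflected: exchanging f and g changes the sign through
  -- the factor x.
  have hr : ∫ t in Ioo (-1 : ℝ) 1, (t : ℂ) * legF ν t * legFr ν t ^ 3 = -legQuartic ν := by
    rw [legQuartic, ← setIntegral_comp_neg, ← integral_neg]
    refine integral_congr_ae (Eventually.of_forall fun t => ?_)
    simp only [legFr, Complex.ofReal_neg, neg_neg]
    ring
  constructor
  · rw [legQuartic, h.integral_eq hx0 hx1, ← integral_const_mul, ← integral_complex_ofReal]
    refine setIntegral_congr_fun measurableSet_Ioo fun p hp => ?_
    simp only [ef p hp, eg p hp]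
    push_cast
    field_simp
    ring
  · rw [← hr, h.integral_eq hx0 hx1, ← integral_const_mul, ← integral_complex_ofReal]
    refine setIntegral_congr_fun measurableSet_Ioo fun p hp => ?_
    simp only [ef p hp, eg p hp]
    push_cast
    field_simp
    ring

end

/-! ### Closed values at the special degrees and the general substitution -/

theorem legW_ofReal_ne {r : ℝ} (h0 : -1 < r) (h1 : r < 0) : legW r ≠ 0 := by
  have hpi : (π : ℂ) ≠ 0 := by exact_mod_cast Real.pi_ne_zero
  have hs : Real.sin (π * r) ≠ 0 :=
    (Real.sin_neg_of_neg_of_neg_pi_lt (by nlinarith [Real.pi_pos]) (by nlinarith [Real.pi_pos])).ne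
  rw [legW]
  refine neg_ne_zero.2 (div_ne_zero (mul_ne_zero two_ne_zero ?_) hpi)
  exact_mod_cast hs

theorem legQuartic_ofReal {r : ℝ} (hr : r ≠ -1 / 2) :
    legQuartic r = ((Real.sin (2 * r * π) * Real.cos (r * π) / ((2 * r + 1) ^ 2 * π) : ℝ) : ℂ) := by
  rw [legQuartic_eq_of_ne]
  · push_cast; rfl
  · intro h
    apply hr
    have : (r : ℂ) = ((-1 / 2 : ℝ) : ℂ) := by rw [h]; push_cast; rfl
    exact Complex.ofReal_injective this

theorem legQuartic_neg_third : legQuartic (-1 / 3) = ((-(9 * √3 / (4 * π)) : ℝ) : ℂ) := by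
  have e : (-1 / 3 : ℂ) = ((-1 / 3 : ℝ) : ℂ) := by push_cast; rfl
  have e1 : 2 * (-1 / 3) * π = -(π - π / 3) := by ring
  have e2 : -1 / 3 * π = -(π / 3) := by ring
  rw [e, legQuartic_ofReal (by norm_num), e1, e2, Real.sin_neg, Real.sin_pi_sub,
    Real.sin_pi_div_three, Real.cos_neg, Real.cos_pi_div_three]
  congr 1
  field_simp
  norm_num

theorem legQuartic_neg_quarter : legQuartic (-1 / 4) = ((-(2 * √2 / π) : ℝ) : ℂ) := by
  have e : (-1 / 4 : ℂ) = ((-1 / 4 : ℝ) : ℂ) := by push_cast; rfl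
  have e1 : 2 * (-1 / 4) * π = -(π / 2) := by ring
  have e2 : -1 / 4 * π = -(π / 4) := by ring
  rw [e, legQuartic_ofReal (by norm_num), e1, e2, Real.sin_neg, Real.sin_pi_div_two, Real.cos_neg,
    Real.cos_pi_div_four]
  congr 1
  field_simp
  norm_num

theorem legQuartic_neg_sixth : legQuartic (-1 / 6) = ((-(27 / (16 * π)) : ℝ) : ℂ) := by
  have e : (-1 / 6 : ℂ) = ((-1 / 6 : ℝ) : ℂ) := by push_cast; rfl
  have e1 : 2 * (-1 / 6) * π = -(π / 3) := by ring
  have e2 : -1 / 6 * π = -(π / 6) := by ring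
  have h3 : √3 ^ 2 = (3 : ℝ) := Real.sq_sqrt (by norm_num)
  rw [e, legQuartic_ofReal (by norm_num), e1, e2, Real.sin_neg, Real.sin_pi_div_three,
    Real.cos_neg, Real.cos_pi_div_six]
  congr 1
  field_simp
  rw [h3]
  norm_num

theorem tendsto_nhdsGT_of_continuousAt {f : ℝ → ℝ} {a b : ℝ} (h : ContinuousAt f a)
    (hb : f a = b) : Tendsto f (𝓝[>] a) (𝓝 b) :=
  hb ▸ h.tendsto.mono_left nhdsWithin_le_nhds

theorem tendsto_nhdsLT_of_continuousAt {f : ℝ → ℝ} {a b : ℝ} (h : ContinuousAt f a)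
    (hb : f a = b) : Tendsto f (𝓝[<] a) (𝓝 b) :=
  hb ▸ h.tendsto.mono_left nhdsWithin_le_nhds

/-- With (2/π)⁴ = 16/π⁴ from the four elliptic integrals, the prefactors carry one power of A₁ when
K(√(1 - s)) occurs once and three when it is cubed. -/
theorem LegTransform.ellipticK_integrals {l : ℝ} {x x' A A' ρ ρ' s s' : ℝ → ℝ} {C : ℝ}
    (h : LegTransform l x x' A A' ρ ρ' s s' C) {r : ℝ} (hr0 : -1 < r) (hr1 : r < 0)
    (hl : l = r * (r + 1)) {A₁ : ℝ} (hA₁ : A₁ ≠ 0)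
    (cx0 : ContinuousAt x 0) (cA0 : ContinuousAt A 0) (cρ0 : ContinuousAt ρ 0)
    (cs0 : ContinuousAt s 0) (cx1 : ContinuousAt x 1) (cA1 : ContinuousAt A 1)
    (cρ1 : ContinuousAt ρ 1) (cs1 : ContinuousAt s 1)
    (hx0 : x 0 = 1) (hA0 : A 0 = 1) (hρ0 : ρ 0 = 0) (hs0 : s 0 = 0)
    (hx1 : x 1 = -1) (hA1 : A 1 = A₁) (hρ1 : ρ 1 = 0) (hs1 : s 1 = 1)
    {v c : ℝ} {w : ℝ → ℝ} (hv : legQuartic (r : ℂ) = (v : ℂ))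
    (hw : ∀ p ∈ Ioo (0 : ℝ) 1, -x' p * x p * A p ^ 4 = c * w p) :
    16 * c / (π ^ 4 * A₁) * (∫ p in Ioo (0 : ℝ) 1,
        w p * ellipticK (√(s p)) ^ 3 * ellipticK (√(1 - s p))) = v ∧
      -(16 * c / (π ^ 4 * A₁ ^ 3)) * (∫ p in Ioo (0 : ℝ) 1,
        w p * ellipticK (√(1 - s p)) ^ 3 * ellipticK (√(s p))) = v := by
  obtain ⟨h1, h2⟩ := h.quartic_eq (legW_ofReal_ne hr0 hr1) (by rw [hl]; push_cast; ring) hA₁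
    (tendsto_nhdsGT_of_continuousAt cx0 hx0) (tendsto_nhdsGT_of_continuousAt cA0 hA0)
    (tendsto_nhdsGT_of_continuousAt cρ0 hρ0) (tendsto_nhdsGT_of_continuousAt cs0 hs0)
    (tendsto_nhdsLT_of_continuousAt cx1 hx1) (tendsto_nhdsLT_of_continuousAt cA1 hA1)
    (tendsto_nhdsLT_of_continuousAt cρ1 hρ1) (tendsto_nhdsLT_of_continuousAt cs1 hs1)
  have key : ∀ f g : ℝ → ℝ, (∫ p in Ioo (0 : ℝ) 1, -x' p * x p * A p ^ 4 * f p * g p) =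
      c * ∫ p in Ioo (0 : ℝ) 1, w p * f p * g p := fun f g => by
    rw [← integral_const_mul]
    refine setIntegral_congr_fun measurableSet_Ioo fun p hp => ?_
    simp only [hw p hp]
    ring
  rw [key fun p => ellipticK (√(s p)) ^ 3, hv] at h1
  rw [key fun p => ellipticK (√(1 - s p)) ^ 3, hv, ← Complex.ofReal_neg] at h2
  have h1' := Complex.ofReal_injective h1
  have h2' := Complex.ofReal_injective h2
  constructor
  · rw [h1']; ring
  · rw [eq_neg_iff_add_eq_zero.2 (by rw [← h2']; ring : v + 16 / (π ^ 4 * A₁ ^ 3) * _ = 0)]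
    ring

theorem intervalIntegral_eq_Ioo (f : ℝ → ℝ) :
    ∫ p in (0 : ℝ)..1, f p = ∫ p in Ioo (0 : ℝ) 1, f p := by
  rw [intervalIntegral.integral_of_le zero_le_one, integral_Ioc_eq_integral_Ioo]

/-! ### Degree `-1/2` -/

theorem legTransform_half : LegTransform (-1 / 4) (fun p => 1 - 2 * p) (fun _ => -2) (fun _ => 1)
    (fun _ => 0) (fun _ => 0) (fun _ => 0) (fun p => p) (fun _ => 1) (-2) where
  hasDerivAt_x p _ := by simpa using ((hasDerivAt_id p).const_mul 2).const_sub 1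
  hasDerivAt_A p _ := hasDerivAt_const p 1
  hasDerivAt_ρ p _ := hasDerivAt_const p 0
  hasDerivAt_s p _ := hasDerivAt_id p
  one_sub_sq p hp := by nlinarith [hp.1, hp.2]
  s_mem p hp := hp
  A_ne p _ := one_ne_zero
  deriv_neg p _ := by norm_num
  eq1 p _ := by ring
  eq2 p _ := by ring
  eq3 p _ := by norm_num

theorem integral_half :
    32 / π ^ 4 * ∫ t in (0 : ℝ)..1, (1 - 2 * t) * ellipticK (√t) ^ 3 * ellipticK (√(1 - t)) =
        -π / 2 ∧
      -(32 / π ^ 4) * ∫ t in (0 : ℝ)..1,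
        (1 - 2 * t) * ellipticK (√(1 - t)) ^ 3 * ellipticK (√t) = -π / 2 := by
  have e : legQuartic ((-1 / 2 : ℝ) : ℂ) = ((-π / 2 : ℝ) : ℂ) := by
    push_cast
    exact legQuartic_neg_half
  obtain ⟨h1, h2⟩ := legTransform_half.ellipticK_integrals (r := -1 / 2) (c := 2) (A₁ := 1)
    (w := fun t => 1 - 2 * t) (by norm_num) (by norm_num) (by norm_num) one_ne_zero
    (by fun_prop) (by fun_prop) (by fun_prop) (by fun_prop) (by fun_prop) (by fun_prop)
    (by fun_prop) (by fun_prop) (by norm_num) rfl rfl rfl (by norm_num) rfl rfl rfl e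
    (fun p _ => by ring)
  rw [intervalIntegral_eq_Ioo, intervalIntegral_eq_Ioo]
  norm_num at h1 h2 ⊢
  exact ⟨h1, h2⟩

/-! ### Degree `-1/4` -/

theorem hasDerivAt_sqrt_one_add_mul (c : ℝ) {p : ℝ} (hp : 0 < 1 + c * p) :
    HasDerivAt (fun p => √(1 + c * p)) (c / (2 * √(1 + c * p))) p := by
  simpa using (((hasDerivAt_id p).const_mul c).const_add 1).sqrt hp.ne'

/-- Quadratic transformation s = 2p/(1 + p), with multiplier (1 + p)^(-1/2) and x = 1 - 2p². -/
theorem legTransform_quarter : LegTransform (-3 / 16) (fun p => 1 - 2 * p ^ 2) (fun p => -4 * p)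
    (fun p => 1 / √(1 + 1 * p)) (fun p => -1 / (2 * √(1 + 1 * p) ^ 3))
    (fun p => p * (1 - p) / (2 * √(1 + 1 * p)))
    (fun p => (1 - 2 * p) / (2 * √(1 + 1 * p)) - p * (1 - p) / (4 * √(1 + 1 * p) ^ 3))
    (fun p => 2 * p / (1 + p)) (fun p => 2 / (1 + p) ^ 2) (-1) := by
  have pos : ∀ p ∈ Ioo (0 : ℝ) 1, 0 < 1 + 1 * p := fun p hp => by linarith [hp.1]
  have sq : ∀ p ∈ Ioo (0 : ℝ) 1, √(1 + 1 * p) ^ 2 = 1 + p := fun p hp => by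
    rw [Real.sq_sqrt (pos p hp).le, one_mul]
  have rpos : ∀ p ∈ Ioo (0 : ℝ) 1, 0 < √(1 + 1 * p) := fun p hp => Real.sqrt_pos.2 (pos p hp)
  constructor
  · intro p _
    refine (((hasDerivAt_pow 2 p).const_mul 2).const_sub 1).congr_deriv ?_
    norm_num; ring
  · intro p hp
    have := (rpos p hp).ne'
    refine ((hasDerivAt_const p (1 : ℝ)).div (hasDerivAt_sqrt_one_add_mul 1 (pos p hp))
      this).congr_deriv ?_
    field_simp; ring
  · intro p hp
    have := (rpos p hp).ne'
    refine (((hasDerivAt_id p).mul ((hasDerivAt_id p).const_sub 1)).div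
      ((hasDerivAt_sqrt_one_add_mul 1 (pos p hp)).const_mul 2)
      (mul_ne_zero two_ne_zero this)).congr_deriv ?_
    simp only [Pi.mul_apply, id]
    field_simp; ring
  · intro p hp
    have : 1 + p ≠ 0 := by linarith [hp.1]
    refine (((hasDerivAt_id p).const_mul 2).div ((hasDerivAt_id p).const_add 1)
      this).congr_deriv ?_
    simp only [id]
    field_simp; ring
  · intro p hp
    have : 0 < 4 * p ^ 2 * ((1 - p) * (1 + p)) := by
      have := hp.1; have : 0 < 1 - p := by linarith [hp.2]
      positivity
    linarith
  · intro p hp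
    have : 0 < 1 + p := by linarith [hp.1]
    refine ⟨by have := hp.1; positivity, (div_lt_one this).2 (by linarith [hp.2])⟩
  · intro p hp
    exact (one_div_pos.2 (rpos p hp)).ne'
  · intro p hp
    linarith [hp.1]
  all_goals
    intro p hp
    have h1 := (rpos p hp).ne'
    have h2 := sq p hp
    -- Eliminating p in favour of r = √(1 + p) turns the three identities into rational identities
    -- in r.
    have h3 : p = √(1 + 1 * p) ^ 2 - 1 := by rw [h2]; ring
    have h4 : 1 + p ≠ 0 := by linarith [hp.1]
    generalize √(1 + 1 * p) = r at *
    subst h3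
    have h5 : 1 + (r ^ 2 - 1) = r ^ 2 := by ring
    try simp only [h5]
    field_simp
    ring

theorem integral_comp_sqrt (f : ℝ → ℝ) :
    ∫ u in Ioo (0 : ℝ) 1, f (√u) = 2 * ∫ p in Ioo (0 : ℝ) 1, p * f p := by
  have himg : (fun p : ℝ => p ^ 2) '' Ioo 0 1 = Ioo 0 1 := by
    ext u
    constructor
    · rintro ⟨p, hp, rfl⟩
      exact ⟨pow_pos hp.1 2, pow_lt_one₀ hp.1.le hp.2 two_ne_zero⟩
    · intro hu
      refine ⟨√u, ⟨Real.sqrt_pos.2 hu.1, ?_⟩, Real.sq_sqrt hu.1.le⟩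
      rw [Real.sqrt_lt' one_pos, one_pow]
      exact hu.2
  have hinj : InjOn (fun p : ℝ => p ^ 2) (Ioo 0 1) := fun a ha b hb hab =>
    (pow_left_inj₀ ha.1.le hb.1.le two_ne_zero).1 hab
  have := integral_image_eq_integral_abs_deriv_smul (measurableSet_Ioo (a := (0 : ℝ)) (b := 1))
    (fun p _ => (hasDerivAt_pow 2 p).hasDerivWithinAt) hinj fun u => f (√u)
  rw [himg] at this
  rw [this, ← integral_const_mul]
  refine setIntegral_congr_fun measurableSet_Ioo fun p hp => ?_
  have h0 := hp.1.le
  simp only [Real.sqrt_sq h0, smul_eq_mul, Nat.cast_ofNat, Nat.add_one_sub_one, pow_one]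
  rw [abs_of_nonneg (by positivity)]
  ring

theorem integral_quarter :
    32 * √2 / π ^ 4 * ∫ u in (0 : ℝ)..1,
        (1 - 2 * u) / (1 + √u) ^ 2 *
          ellipticK (√(2 * √u / (1 + √u))) ^ 3 *
          ellipticK (√((1 - √u) / (1 + √u))) = -(2 * √2 / π) ∧
      -(64 * √2 / π ^ 4) * ∫ u in (0 : ℝ)..1,
        (1 - 2 * u) / (1 + √u) ^ 2 *
          ellipticK (√((1 - √u) / (1 + √u))) ^ 3 *
          ellipticK (√(2 * √u / (1 + √u))) = -(2 * √2 / π) := by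
  have e : legQuartic ((-1 / 4 : ℝ) : ℂ) = ((-(2 * √2 / π) : ℝ) : ℂ) := by
    have := legQuartic_neg_quarter
    rwa [show (-1 / 4 : ℂ) = ((-1 / 4 : ℝ) : ℂ) by push_cast; rfl] at this
  have h2 : √2 ≠ (0 : ℝ) := by positivity
  have h22 : √2 ^ 2 = (2 : ℝ) := Real.sq_sqrt zero_le_two
  obtain ⟨h1, h2⟩ := legTransform_quarter.ellipticK_integrals (r := -1 / 4) (c := 4) (A₁ := 1 / √2)
    (w := fun p => p * ((1 - 2 * p ^ 2) / (1 + p) ^ 2)) (by norm_num) (by norm_num) (by norm_num)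
    (by positivity)
    (by fun_prop) (by fun_prop (disch := norm_num)) (by fun_prop (disch := norm_num))
    (by fun_prop (disch := norm_num)) (by fun_prop) (by fun_prop (disch := positivity))
    (by fun_prop (disch := positivity)) (by fun_prop (disch := norm_num))
    (by norm_num) (by norm_num) (by norm_num) (by norm_num) (by norm_num) (by norm_num)
    (by norm_num) (by norm_num) e
    (fun p hp => by
      have h : √(1 + 1 * p) ^ 4 = (1 + p) ^ 2 := by
        rw [show √(1 + 1 * p) ^ 4 = (√(1 + 1 * p) ^ 2) ^ 2 by ring,
          Real.sq_sqrt (by linarith [hp.1]), one_mul]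
      simp only [div_pow, h]
      ring)
  -- The stated integrals use u = p². The Jacobian contributes the factor 2 and the p in the weight,
  -- while 1 - 2p/(1 + p) = (1 - p)/(1 + p) is the complementary parameter.
  have key : ∀ F : ℝ → ℝ → ℝ, (∫ u in (0 : ℝ)..1, (1 - 2 * u) / (1 + √u) ^ 2 *
      F (2 * √u / (1 + √u)) ((1 - √u) / (1 + √u))) = 2 * ∫ p in Ioo (0 : ℝ) 1,
      p * ((1 - 2 * p ^ 2) / (1 + p) ^ 2) * F (2 * p / (1 + p)) (1 - 2 * p / (1 + p)) := by
    intro F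
    have := integral_comp_sqrt fun p => (1 - 2 * p ^ 2) / (1 + p) ^ 2 *
      F (2 * p / (1 + p)) ((1 - p) / (1 + p))
    rw [intervalIntegral_eq_Ioo]
    refine ((setIntegral_congr_fun measurableSet_Ioo fun u hu => ?_).trans this).trans ?_
    · simp only [Real.sq_sqrt hu.1.le]
    · congr 1
      refine setIntegral_congr_fun measurableSet_Ioo fun p hp => ?_
      have h4 : 1 + p ≠ 0 := by linarith [hp.1]
      have : 1 - 2 * p / (1 + p) = (1 - p) / (1 + p) := by field_simp; ring
      simp only [this]
      ring
  have k1 := key fun s t => ellipticK (√s) ^ 3 * ellipticK (√t)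
  have k2 := key fun s t => ellipticK (√t) ^ 3 * ellipticK (√s)
  simp only [← mul_assoc] at k1 k2 h1 h2
  rw [k1, k2]
  constructor
  · rw [← h1]
    generalize (∫ p in Ioo (0 : ℝ) 1, _ : ℝ) = I
    field_simp
    ring
  · rw [← h2]
    generalize (∫ p in Ioo (0 : ℝ) 1, _ : ℝ) = I
    field_simp
    rw [h22]
    ring

/-! ### Degree `-1/6` -/

theorem one_sub_add_sq_pos (p : ℝ) : 0 < 1 - p + p ^ 2 := by nlinarith [sq_nonneg (p - 1 / 2)]

theorem fourthRoot_pow {q : ℝ} (hq : 0 < q) : √(√q) ^ 4 = q := by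
  rw [show √(√q) ^ 4 = (√(√q) ^ 2) ^ 2 by ring, Real.sq_sqrt (Real.sqrt_nonneg q),
    Real.sq_sqrt hq.le]

theorem hasDerivAt_fourthRoot (p : ℝ) : HasDerivAt (fun p : ℝ => √(√(1 - p + p ^ 2)))
    ((2 * p - 1) / (4 * √(√(1 - p + p ^ 2)) ^ 3)) p := by
  have hq := one_sub_add_sq_pos p
  have h := ((((hasDerivAt_id p).const_sub 1).add (hasDerivAt_pow 2 p)).sqrt hq.ne').sqrt
    (Real.sqrt_pos.2 hq).ne'
  have h1 : √(1 - p + p ^ 2) = √(√(1 - p + p ^ 2)) ^ 2 := (Real.sq_sqrt (Real.sqrt_nonneg _)).symm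
  have h2 : 0 < √(√(1 - p + p ^ 2)) := Real.sqrt_pos.2 (Real.sqrt_pos.2 hq)
  refine h.congr_deriv ?_
  simp only [Pi.add_apply, id]
  generalize √(√(1 - p + p ^ 2)) = a at *
  rw [h1]
  field_simp
  norm_num
  ring

/-- The parameter is the elliptic parameter itself, and 1 - x² = 27p²(1 - p)²/(4(1 - p + p²)³) is
1728/j in terms of the modular invariant. The multiplier is the fourth root of 1 - p + p². -/
theorem legTransform_sixth : LegTransform (-5 / 36)
    (fun p => (1 + p) * (2 - p) * (1 - 2 * p) / (2 * √(√(1 - p + p ^ 2)) ^ 6))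
    (fun p => -(27 / 4) * (p * (1 - p)) / √(√(1 - p + p ^ 2)) ^ 10)
    (fun p => √(√(1 - p + p ^ 2))) (fun p => (2 * p - 1) / (4 * √(√(1 - p + p ^ 2)) ^ 3))
    (fun p => -(p * (1 - p) * (2 * p - 1)) / (4 * √(√(1 - p + p ^ 2)) ^ 5))
    (fun p => -(6 * p - 6 * p ^ 2 - 1) / (4 * √(√(1 - p + p ^ 2)) ^ 5) +
      5 * (p * (1 - p) * (2 * p - 1) ^ 2) / (16 * √(√(1 - p + p ^ 2)) ^ 9))
    (fun p => p) (fun _ => 1) (-1) := by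
  have apos : ∀ p : ℝ, 0 < √(√(1 - p + p ^ 2)) := fun p =>
    Real.sqrt_pos.2 (Real.sqrt_pos.2 (one_sub_add_sq_pos p))
  have a4 : ∀ p : ℝ, √(√(1 - p + p ^ 2)) ^ 4 = 1 - p + p ^ 2 := fun p =>
    fourthRoot_pow (one_sub_add_sq_pos p)
  -- This is the discriminant identity 4(1 - p + p²)³ - ((1 + p)(2 - p)(1 - 2p))² = 27p²(1 - p)².
  have hx2 : ∀ p : ℝ, 1 - ((1 + p) * (2 - p) * (1 - 2 * p) / (2 * √(√(1 - p + p ^ 2)) ^ 6)) ^ 2 =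
      27 * (p * (1 - p)) ^ 2 / (4 * √(√(1 - p + p ^ 2)) ^ 12) := by
    intro p
    have h1 := (apos p).ne'
    have h2 := a4 p
    generalize √(√(1 - p + p ^ 2)) = a at *
    have h12 : a ^ 12 = (1 - p + p ^ 2) ^ 3 := by rw [← h2]; ring
    field_simp
    rw [h12]
    ring
  constructor
  · intro p _
    have h1 := (apos p).ne'
    have h2 := a4 p
    refine (((((hasDerivAt_id p).const_add 1).mul ((hasDerivAt_id p).const_sub 2)).mul
      (((hasDerivAt_id p).const_mul 2).const_sub 1)).div
      (((hasDerivAt_fourthRoot p).pow 6).const_mul 2)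
      (mul_ne_zero two_ne_zero (pow_ne_zero 6 h1))).congr_deriv ?_
    simp only [Pi.mul_apply, Pi.pow_apply, id]
    generalize √(√(1 - p + p ^ 2)) = a at *
    have h8 : a ^ 8 = (1 - p + p ^ 2) ^ 2 := by rw [← h2]; ring
    norm_num
    field_simp
    ring_nf
    ring_nf at h2
    simp only [h2]
    ring
  · intro p _
    exact hasDerivAt_fourthRoot p
  · intro p _
    have h1 := (apos p).ne'
    refine ((((hasDerivAt_id p).mul ((hasDerivAt_id p).const_sub 1)).mul
      (((hasDerivAt_id p).const_mul 2).sub_const 1)).neg.div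
      (((hasDerivAt_fourthRoot p).pow 5).const_mul 4)
      (mul_ne_zero four_ne_zero (pow_ne_zero 5 h1))).congr_deriv ?_
    simp only [Pi.mul_apply, Pi.pow_apply, Pi.neg_apply, id]
    generalize √(√(1 - p + p ^ 2)) = a at *
    norm_num
    field_simp
    ring
  · intro p _
    exact hasDerivAt_id p
  · intro p hp
    rw [hx2]
    have := hp.1
    have : 0 < 1 - p := by linarith [hp.2]
    have := apos p
    positivity
  · intro p hp
    exact hp
  · intro p _
    exact (apos p).ne'
  · intro p hp
    have := hp.1
    have : 0 < 1 - p := by linarith [hp.2]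
    have := apos p
    have : 0 < 27 / 4 * (p * (1 - p)) / √(√(1 - p + p ^ 2)) ^ 10 := by positivity
    rw [neg_mul, neg_div]
    linarith
  · intro p _
    rw [hx2]
    have h1 := (apos p).ne'
    field_simp
  · intro p _
    rw [hx2]
    have h1 := (apos p).ne'
    field_simp
  · intro p _
    have h1 := (apos p).ne'
    have h2 := a4 p
    generalize √(√(1 - p + p ^ 2)) = a at *
    have h8 : a ^ 8 = (1 - p + p ^ 2) ^ 2 := by rw [← h2]; ring
    field_simp
    ring_nf
    ring_nf at h2 h8
    simp only [h2, h8]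
    ring

theorem integral_sixth :
    54 / π ^ 4 * ∫ t in (0 : ℝ)..1,
        t * (1 - t) * (1 + t) * (2 - t) * (1 - 2 * t) / (1 - t + t ^ 2) ^ 3 *
          ellipticK (√t) ^ 3 * ellipticK (√(1 - t)) = -(27 / (16 * π)) ∧
      -(54 / π ^ 4) * ∫ t in (0 : ℝ)..1,
        t * (1 - t) * (1 + t) * (2 - t) * (1 - 2 * t) / (1 - t + t ^ 2) ^ 3 *
          ellipticK (√(1 - t)) ^ 3 * ellipticK (√t) = -(27 / (16 * π)) := by
  have e : legQuartic ((-1 / 6 : ℝ) : ℂ) = ((-(27 / (16 * π)) : ℝ) : ℂ) := by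
    have := legQuartic_neg_sixth
    rwa [show (-1 / 6 : ℂ) = ((-1 / 6 : ℝ) : ℂ) by push_cast; rfl] at this
  obtain ⟨h1, h2⟩ := legTransform_sixth.ellipticK_integrals (r := -1 / 6) (c := 27 / 8) (A₁ := 1)
    (w := fun t => t * (1 - t) * (1 + t) * (2 - t) * (1 - 2 * t) / (1 - t + t ^ 2) ^ 3)
    (by norm_num) (by norm_num) (by norm_num) one_ne_zero
    (by fun_prop (disch := norm_num)) (by fun_prop) (by fun_prop (disch := norm_num))
    (by fun_prop) (by fun_prop (disch := norm_num)) (by fun_prop)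
    (by fun_prop (disch := norm_num)) (by fun_prop)
    (by norm_num) (by norm_num) (by norm_num) rfl (by norm_num) (by norm_num)
    (by norm_num) rfl e
    (fun p _ => by
      have h1 : √(√(1 - p + p ^ 2)) ≠ 0 :=
        (Real.sqrt_pos.2 (Real.sqrt_pos.2 (one_sub_add_sq_pos p))).ne'
      have h2 := fourthRoot_pow (one_sub_add_sq_pos p)
      generalize √(√(1 - p + p ^ 2)) = a at *
      rw [← h2]
      field_simp
      ring)
  rw [intervalIntegral_eq_Ioo, intervalIntegral_eq_Ioo]
  norm_num at h1 h2 ⊢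
  exact ⟨h1, h2⟩

/-! ### Degree `-1/3` -/

theorem one_add_add_sq_pos (p : ℝ) : 0 < 1 + p + p ^ 2 := by nlinarith [sq_nonneg (p + 1 / 2)]

/-- Ramanujan's cubic transformation: x = 1 - 2α with α = 27p²(1 + p)²/(4(1 + p + p²)³), and s =
p³(2 + p)/(1 + 2p). -/
theorem legTransform_third : LegTransform (-2 / 9)
    (fun p => 1 - 2 * (27 * p ^ 2 * (1 + p) ^ 2 / (4 * (1 + p + p ^ 2) ^ 3)))
    (fun p => -(27 * (p * (1 + p) * (1 + 2 * p) * (1 - p) * (2 + p))) / (2 * (1 + p + p ^ 2) ^ 4))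
    (fun p => (1 + p + p ^ 2) / √(1 + 2 * p)) (fun p => 3 * (p * (1 + p)) / √(1 + 2 * p) ^ 3)
    (fun p => -(3 * (p ^ 2 * (1 + p) ^ 2 * (1 - p) * (2 + p))) /
      (2 * (√(1 + 2 * p) * (1 + p + p ^ 2) ^ 2)))
    (fun p => -(3 * (4 * p + 9 * p ^ 2 - 4 * p ^ 3 - 15 * p ^ 4 - 6 * p ^ 5)) /
        (2 * (√(1 + 2 * p) * (1 + p + p ^ 2) ^ 2)) +
      3 * (p ^ 2 * (1 + p) ^ 2 * (1 - p) * (2 + p)) * ((1 + p + p ^ 2) +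
        2 * √(1 + 2 * p) ^ 4) / (2 * (√(1 + 2 * p) ^ 3 * (1 + p + p ^ 2) ^ 3)))
    (fun p => p ^ 3 * (2 + p) / (1 + 2 * p)) (fun p => 6 * (p * (1 + p)) ^ 2 / (1 + 2 * p) ^ 2)
    (-3) := by
  have pos : ∀ p ∈ Ioo (0 : ℝ) 1, 0 < 1 + 2 * p := fun p hp => by linarith [hp.1]
  have sq : ∀ p ∈ Ioo (0 : ℝ) 1, √(1 + 2 * p) ^ 2 = 1 + 2 * p := fun p hp =>
    Real.sq_sqrt (pos p hp).le
  have rpos : ∀ p ∈ Ioo (0 : ℝ) 1, 0 < √(1 + 2 * p) := fun p hp => Real.sqrt_pos.2 (pos p hp)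
  have hs : ∀ p ∈ Ioo (0 : ℝ) 1, 1 - p ^ 3 * (2 + p) / (1 + 2 * p) =
      (1 - p) * (1 + p) ^ 3 / (1 + 2 * p) := fun p hp => by
    rw [one_sub_div (pos p hp).ne']
    ring
  -- Here 1 - x² = 4α(1 - α), and 1 - α is also a square over the same denominator: 4(1 + p + p²)³ -
  -- 27p²(1 + p)² = ((1 - p)(2 + p)(1 + 2p))².
  have hx2 : ∀ p : ℝ, 1 - (1 - 2 * (27 * p ^ 2 * (1 + p) ^ 2 / (4 * (1 + p + p ^ 2) ^ 3))) ^ 2 =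
      27 * (p * (1 + p) * (1 - p) * (2 + p) * (1 + 2 * p)) ^ 2 / (4 * (1 + p + p ^ 2) ^ 6) := by
    intro p
    have := (one_add_add_sq_pos p).ne'
    field_simp
    ring
  have dq : ∀ p : ℝ, HasDerivAt (fun p : ℝ => 1 + p + p ^ 2) (1 + 2 * p) p := fun p => by
    refine (((hasDerivAt_id p).const_add 1).add (hasDerivAt_pow 2 p)).congr_deriv ?_
    norm_num
  constructor
  · intro p _
    have hq := (one_add_add_sq_pos p).ne'
    refine ((((((hasDerivAt_pow 2 p).const_mul 27).mul (((hasDerivAt_id p).const_add 1).pow 2)).div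
      (((dq p).pow 3).const_mul 4) (mul_ne_zero four_ne_zero (pow_ne_zero 3 hq))).const_mul
      2).const_sub 1).congr_deriv ?_
    simp only [Pi.mul_apply, Pi.pow_apply, id]
    norm_num
    field_simp
    ring
  · intro p hp
    have h1 := (rpos p hp).ne'
    refine ((dq p).div (hasDerivAt_sqrt_one_add_mul 2 (pos p hp)) h1).congr_deriv ?_
    field_simp
    rw [sq p hp]
    ring
  · intro p hp
    have h1 := (rpos p hp).ne'
    have hq := (one_add_add_sq_pos p).ne'
    refine (((((hasDerivAt_pow 2 p).mul (((hasDerivAt_id p).const_add 1).pow 2)).mul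
      ((hasDerivAt_id p).const_sub 1)).mul ((hasDerivAt_id p).const_add 2)).const_mul 3).neg.div
      (((hasDerivAt_sqrt_one_add_mul 2 (pos p hp)).mul ((dq p).pow 2)).const_mul 2)
      (mul_ne_zero two_ne_zero (mul_ne_zero h1 (pow_ne_zero 2 hq))) |>.congr_deriv ?_
    have h2 := sq p hp
    simp only [Pi.mul_apply, Pi.pow_apply, Pi.neg_apply, id]
    generalize √(1 + 2 * p) = r at *
    simp only [← h2]
    norm_num
    field_simp
    ring
  · intro p hp
    have := (pos p hp).ne'
    refine (((hasDerivAt_pow 3 p).mul ((hasDerivAt_id p).const_add 2)).div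
      (((hasDerivAt_id p).const_mul 2).const_add 1) this).congr_deriv ?_
    simp only [Pi.mul_apply, id]
    norm_num
    field_simp
    ring
  · intro p hp
    rw [hx2]
    have := hp.1
    have : 0 < 1 - p := by linarith [hp.2]
    have := one_add_add_sq_pos p
    positivity
  · intro p hp
    have h0 := hp.1
    have h1 : 0 < 1 - p := by linarith [hp.2]
    refine ⟨by positivity, ?_⟩
    have : 0 < 1 - p ^ 3 * (2 + p) / (1 + 2 * p) := by rw [hs p hp]; positivity
    linarith
  · intro p hp
    exact (div_pos (one_add_add_sq_pos p) (rpos p hp)).ne'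
  · intro p hp
    have := hp.1
    have : 0 < 1 - p := by linarith [hp.2]
    have := one_add_add_sq_pos p
    rw [neg_div, neg_lt_zero]
    positivity
  · intro p hp
    rw [hx2]
    have h1 := (rpos p hp).ne'
    have hq := (one_add_add_sq_pos p).ne'
    have h2 := sq p hp
    generalize √(1 + 2 * p) = r at *
    rw [← h2]
    field_simp
    ring
  · intro p hp
    rw [hx2, hs p hp]
    have h0 := (pos p hp).ne'
    have h1 := (rpos p hp).ne'
    have hq := (one_add_add_sq_pos p).ne'
    rw [div_pow _ (√(1 + 2 * p)), sq p hp]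
    field_simp
    ring
  · intro p hp
    have h0 := (pos p hp).ne'
    have h1 := (rpos p hp).ne'
    have hq := (one_add_add_sq_pos p).ne'
    have h2 := sq p hp
    generalize √(1 + 2 * p) = r at *
    have h4 : r ^ 4 = (1 + 2 * p) ^ 2 := by rw [← h2]; ring
    have hr : ∀ a b : ℝ, (1 + p + p ^ 2) / r *
        (a / (2 * (r * (1 + p + p ^ 2) ^ 2)) +
          b / (2 * (r ^ 3 * (1 + p + p ^ 2) ^ 3))) =
        a / (2 * (r ^ 2 * (1 + p + p ^ 2))) +
          b / (2 * (r ^ 4 * (1 + p + p ^ 2) ^ 2)) := fun a b => by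
      field_simp
    rw [hr, h4, div_pow _ r, h2]
    rw [mul_comm 2 p] at h0 ⊢
    field_simp
    ring

theorem integral_third :
    216 / (√3 * π ^ 4) * ∫ p in (0 : ℝ)..1,
        (1 - p ^ 2) * p * (2 + p) / (1 + 2 * p) *
          (1 - 2 * (27 * p ^ 2 * (1 + p) ^ 2 / (4 * (1 + p + p ^ 2) ^ 3))) *
          ellipticK (√(p ^ 3 * (2 + p) / (1 + 2 * p))) ^ 3 *
          ellipticK (√(1 - p ^ 3 * (2 + p) / (1 + 2 * p))) = -(9 * √3 / (4 * π)) ∧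
      -(72 / (√3 * π ^ 4)) * ∫ p in (0 : ℝ)..1,
        (1 - p ^ 2) * p * (2 + p) / (1 + 2 * p) *
          (1 - 2 * (27 * p ^ 2 * (1 + p) ^ 2 / (4 * (1 + p + p ^ 2) ^ 3))) *
          ellipticK (√(1 - p ^ 3 * (2 + p) / (1 + 2 * p))) ^ 3 *
          ellipticK (√(p ^ 3 * (2 + p) / (1 + 2 * p))) = -(9 * √3 / (4 * π)) := by
  have e : legQuartic ((-1 / 3 : ℝ) : ℂ) = ((-(9 * √3 / (4 * π)) : ℝ) : ℂ) := by
    have := legQuartic_neg_third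
    rwa [show (-1 / 3 : ℂ) = ((-1 / 3 : ℝ) : ℂ) by push_cast; rfl] at this
  have h33 : √3 ^ 2 = (3 : ℝ) := Real.sq_sqrt (by norm_num)
  have h12 : √(1 + 2 * 1) = √3 := by norm_num
  -- The multiplier at p = 1 is 3/√3 = √3, and 16 · 27/2 = 216. In the second integral A₁³ = 3√3
  -- lowers 216 to 72.
  obtain ⟨h1, h2⟩ := legTransform_third.ellipticK_integrals (r := -1 / 3) (c := 27 / 2) (A₁ := √3)
    (w := fun p => (1 - p ^ 2) * p * (2 + p) / (1 + 2 * p) *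
          (1 - 2 * (27 * p ^ 2 * (1 + p) ^ 2 / (4 * (1 + p + p ^ 2) ^ 3))))
    (by norm_num) (by norm_num) (by norm_num) (by positivity)
    (by fun_prop (disch := norm_num)) (by fun_prop (disch := norm_num))
    (by fun_prop (disch := norm_num)) (by fun_prop (disch := norm_num))
    (by fun_prop (disch := norm_num)) (by fun_prop (disch := positivity))
    (by fun_prop (disch := positivity)) (by fun_prop (disch := norm_num))
    (by norm_num) (by norm_num) (by norm_num) (by norm_num) (by norm_num)
    (by
      simp only [h12]
      rw [div_eq_iff (by positivity), ← pow_two, h33]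
      norm_num)
    (by norm_num) (by norm_num) e
    (fun p hp => by
      have h0 : (1 + 2 * p) ≠ 0 := by linarith [hp.1]
      have hq := (one_add_add_sq_pos p).ne'
      have h4 : √(1 + 2 * p) ^ 4 = (1 + 2 * p) ^ 2 := by
        rw [show √(1 + 2 * p) ^ 4 = (√(1 + 2 * p) ^ 2) ^ 2 by ring,
          Real.sq_sqrt (by linarith [hp.1])]
      simp only [div_pow, h4]
      generalize 1 - 2 * (27 * p ^ 2 * (1 + p) ^ 2 / (4 * (1 + p + p ^ 2) ^ 3)) = X
      field_simp
      ring)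
  rw [intervalIntegral_eq_Ioo, intervalIntegral_eq_Ioo]
  constructor
  · rw [← h1]
    congr 1
    field_simp
    norm_num
  · rw [← h2]
    congr 1
    field_simp
    rw [h33]
    norm_num

end

theorem mainTheorem6 :
    -- the integrals over `(-1, 1)` converge absolutely for every complex degree
    (∀ ν : ℂ, IntervalIntegrable
      (fun x : ℝ => (x : ℂ) * legendreP ν x ^ 3 * legendreP ν (-x)) volume (-1) 1) ∧
    -- the identity for general degree
    (∀ ν : ℂ, ν ≠ -1 / 2 →
      ∫ x in (-1 : ℝ)..1, (x : ℂ) * legendreP ν x ^ 3 * legendreP ν (-x) =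
        Complex.sin (2 * ν * (π : ℂ)) * Complex.cos (ν * (π : ℂ)) /
          ((2 * ν + 1) ^ 2 * (π : ℂ))) ∧
    -- degree `-1/2`
    (∫ x in (-1 : ℝ)..1, (x : ℂ) * legendreP (-1 / 2) x ^ 3 * legendreP (-1 / 2) (-x) =
        -(π : ℂ) / 2 ∧
      32 / π ^ 4 * ∫ t in (0 : ℝ)..1,
        (1 - 2 * t) * ellipticK (√t) ^ 3 * ellipticK (√(1 - t)) = -π / 2 ∧
      -(32 / π ^ 4) * ∫ t in (0 : ℝ)..1,
        (1 - 2 * t) * ellipticK (√(1 - t)) ^ 3 * ellipticK (√t) = -π / 2) ∧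
    -- degree `-1/3`
    (∫ x in (-1 : ℝ)..1, (x : ℂ) * legendreP (-1 / 3) x ^ 3 * legendreP (-1 / 3) (-x) =
        -((9 * √3 / (4 * π) : ℝ) : ℂ) ∧
      216 / (√3 * π ^ 4) * ∫ p in (0 : ℝ)..1,
        (1 - p ^ 2) * p * (2 + p) / (1 + 2 * p) *
          (1 - 2 * (27 * p ^ 2 * (1 + p) ^ 2 / (4 * (1 + p + p ^ 2) ^ 3))) *
          ellipticK (√(p ^ 3 * (2 + p) / (1 + 2 * p))) ^ 3 *
          ellipticK (√(1 - p ^ 3 * (2 + p) / (1 + 2 * p))) = -(9 * √3 / (4 * π)) ∧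
      -(72 / (√3 * π ^ 4)) * ∫ p in (0 : ℝ)..1,
        (1 - p ^ 2) * p * (2 + p) / (1 + 2 * p) *
          (1 - 2 * (27 * p ^ 2 * (1 + p) ^ 2 / (4 * (1 + p + p ^ 2) ^ 3))) *
          ellipticK (√(1 - p ^ 3 * (2 + p) / (1 + 2 * p))) ^ 3 *
          ellipticK (√(p ^ 3 * (2 + p) / (1 + 2 * p))) = -(9 * √3 / (4 * π))) ∧
    -- degree `-1/4`
    (∫ x in (-1 : ℝ)..1, (x : ℂ) * legendreP (-1 / 4) x ^ 3 * legendreP (-1 / 4) (-x) =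
        -((2 * √2 / π : ℝ) : ℂ) ∧
      32 * √2 / π ^ 4 * ∫ u in (0 : ℝ)..1,
        (1 - 2 * u) / (1 + √u) ^ 2 *
          ellipticK (√(2 * √u / (1 + √u))) ^ 3 *
          ellipticK (√((1 - √u) / (1 + √u))) = -(2 * √2 / π) ∧
      -(64 * √2 / π ^ 4) * ∫ u in (0 : ℝ)..1,
        (1 - 2 * u) / (1 + √u) ^ 2 *
          ellipticK (√((1 - √u) / (1 + √u))) ^ 3 *
          ellipticK (√(2 * √u / (1 + √u))) = -(2 * √2 / π)) ∧
    -- degree `-1/6`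
    (∫ x in (-1 : ℝ)..1, (x : ℂ) * legendreP (-1 / 6) x ^ 3 * legendreP (-1 / 6) (-x) =
        -((27 / (16 * π) : ℝ) : ℂ) ∧
      54 / π ^ 4 * ∫ t in (0 : ℝ)..1,
        t * (1 - t) * (1 + t) * (2 - t) * (1 - 2 * t) / (1 - t + t ^ 2) ^ 3 *
          ellipticK (√t) ^ 3 * ellipticK (√(1 - t)) = -(27 / (16 * π)) ∧
      -(54 / π ^ 4) * ∫ t in (0 : ℝ)..1,
        t * (1 - t) * (1 + t) * (2 - t) * (1 - 2 * t) / (1 - t + t ^ 2) ^ 3 *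
          ellipticK (√(1 - t)) ^ 3 * ellipticK (√t) = -(27 / (16 * π))) := by
  refine ⟨intervalIntegrable_legendreP, fun ν hν => ?_, ⟨?_, integral_half⟩, ⟨?_, integral_third⟩,
    ⟨?_, integral_quarter⟩, ⟨?_, integral_sixth⟩⟩
  · rw [integral_legendreP_eq, legQuartic_eq_of_ne ν hν]
  · rw [integral_legendreP_eq, legQuartic_neg_half]
  · rw [integral_legendreP_eq, legQuartic_neg_third, Complex.ofReal_neg]
  · rw [integral_legendreP_eq, legQuartic_neg_quarter, Complex.ofReal_neg]
  · rw [integral_legendreP_eq, legQuartic_neg_sixth, Complex.ofReal_neg]
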